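/- Let $L\ge 1$, let $n_1,\dots,n_{L+1}\ge 1$ and $k_1,\dots,k_L\ge 0$ be integers, and put $N_i=n_1+\dots+n_i$, $N=N_{L+1}$. **Moduli matrices.** Consider tuples $(q_1(z),\dots,q_L(z))$, where $q_i(z)$ is an $N_i\times N_{i+1}$ matrix with entries in $\mathbb C[z]$. Put $\xi_i=q_iq_{i+1}\cdots q_L=(\mathfrak D_i,\widetilde{\mathfrak D}_i)$, where $\mathfrak D_i$ consists of the first $N_i$ columns. The tuple is a moduli matrix of charge $(k_1,\dots,k_L)$ if for every $i$ the polynomial $\det\mathfrak D_i$ has degree exactly $k_i$ and $\mathfrak D_i(z)^{-1}\widetilde{\mathfrak D}_i(z)=O(z^{-1})$ as $z\to\infty$. The moduli space $\mathcal M_{\rm vtx}$ of BPS vortices of charge $(k_1,\dots,k_L)$ in the $U(N_1)\times\dots\times U(N_L)$ linear-quiver gauged linear sigma model is the set of moduli matrices modulo $V$-transformations $q_i\mapsto V_iq_iV_{i+1}^{-1}$, with $V_i\in GL(N_i,\mathbb C[z])$ for $1\le i\le L$ and $V_{L+1}=1$. **Half-ADHM data.** Consider complex matrices $Z_i$ ($k_i\times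 k_i$), $\Upsilon_i$ ($n_i\times k_i$), $\widetilde\Upsilon_i$ ($k_i\times n_{i+1}$) for $1\le i\le L$ and $W_i$ ($k_i\times k_{i+1}$) for $1\le i\le L-1$, such that $$Z_iW_i-W_iZ_{i+1}=\widetilde\Upsilon_i\Upsilon_{i+1}\qquad(1\le i\le L-1)$$ and such that the following free condition holds: for every $1\le i\le L$, if $v\in\mathbb C^{k_i}$ satisfies $\Upsilon_jW_jW_{j+1}\cdots W_{i-1}(z\mathbf 1-Z_i)^{-1}v=0$ for all $1\le j\le i$ and all $z\in\mathbb C$ that are not eigenvalues of $Z_i$, then $v=0$. The group $G=GL(k_1,\mathbb C)\times\dots\times GL(k_L,\mathbb C)$ acts on these data by $(Z_i,\Upsilon_i,\widetilde\Upsilon_i,W_i)\mapsto(g_i^{-1}Z_ig_i,\ \Upsilon_ig_i,\ g_i^{-1}\widetilde\Upsilon_i,\ g_i^{-1}W_ig_{i+1})$. Let $\mathcal Q$ be the quotient by $G$, with the quotient topology. For given data let $\Psi_i$ be the $N_i\times k_i$ matrix with blocks of rows $\Upsilon_jW_j\cdots W_{i-1}$ ($j=1,\dots,i$), and let $\widetilde\Psi_i$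 be the $k_i\times(N-N_i)$ matrix with blocks of columns $W_i\cdots W_{j-1}\widetilde\Upsilon_j$ ($j=i,\dots,L$). **Claim.** 1. There is a bijection $\Phi:\mathcal M_{\rm vtx}\to\mathcal Q$ such that $\Phi([q])$ is the class of $\{Z_i,\Upsilon_i,\widetilde\Upsilon_i,W_i\}$ if and only if there are polynomial $N_i\times k_i$ matrices $\mathfrak J_i(z)$, whose columns form a basis of the complex vector space of polynomial vectors $j(z)$ with $\mathfrak D_i(z)^{-1}j(z)=O(z^{-1})$, that satisfy the half-ADHM mapping relations $$\mathfrak D_i(z)\Psi_i=\mathfrak J_i(z)(z\mathbf 1-Z_i),\qquad \widetilde{\mathfrak D}_i(z)=\mathfrak J_i(z)\widetilde\Psi_i\qquad(1\le i\le L).$$ For all such $q$, data and $\mathfrak J_i$ one has $q_i(z)\mathfrak J_{i+1}(z)=\mathfrak J_i(z)W_i$ for $1\le i\le L-1$. 2. $\mathcal Q$ is non-empty, Hausdorff and second countable, and it carries the structure of a complex manifold of dimension $\sum_{i=1}^Lk_i(n_i+n_{i+1})$ that is natural for both descriptions. That is, every holomorphic family of half-ADHM data, and every holomorphic family of moduli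 matrices (entries of bounded degree in $z$, with coefficients holomorphic in the parameters), over an open subset of some $\mathbb C^m$ induces a holomorphic map to $\mathcal Q$ (through $\Phi$ in the second case); and every point of $\mathcal Q$ has an open neighbourhood $T$ on which there are a holomorphic family of half-ADHM data and a holomorphic family of moduli matrices, both parametrized by $x\in T$, whose members at $x$ represent $x$ (through $\Phi$ in the second case). -/

import Mathlib

open scoped Manifold ContDiff Polynomial Asymptotics
open Polynomial

noncomputable section

namespace VortexQuiver

/-! ### Conventions

All indices start at `0`: the node `i : Fin L` is the `(i+1)`-st gauge node `U(N_{i+1})`, `k i` is its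
vortex number, and `n 0, …, n L` are the block sizes of the flag, so that the rank of the node `i`
is `n 0 + ⋯ + n i`. The values `n j` with `j > L` and `k i` with `i ≥ L` are never used. -/

/-- The index set of cardinality `n 0 + ⋯ + n (m-1)`, split into `m` consecutive blocks. -/
abbrev Col (n : ℕ → ℕ) (m : ℕ) : Type := (j : Fin m) × Fin (n j)

/-- The indices of the flavour set `Col n (L+1)` outside of the first `i+1` blocks: the pair `(j, b)`,
with `i ≤ j < L`, stands for the `b`-th index in the block `j+1`. -/
abbrev CoCol (n : ℕ → ℕ) (L i : ℕ) : Type := (j : {j : Fin L // i ≤ (j : ℕ)}) × Fin (n ((j : ℕ) + 1))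

/-! ### Moduli matrices -/

/-- Tuples `(q_1(z), …, q_L(z))` of polynomial matrices, `q_i` of size `N_i × N_{i+1}`. -/
abbrev QTuple (n : ℕ → ℕ) (L : ℕ) : Type :=
  (i : Fin L) → Matrix (Col n (i + 1)) (Col n (i + 2)) ℂ[X]

variable {n k : ℕ → ℕ} {L : ℕ}

/-- `ξ_m = q_m q_{m+1} ⋯ q_{L-1}` (the identity matrix for `m = L`). -/
def xi (q : QTuple n L) (m : ℕ) (hm : m ≤ L) : Matrix (Col n (m + 1)) (Col n (L + 1)) ℂ[X] :=
  Nat.decreasingInduction (motive := fun m _ => Matrix (Col n (m + 1)) (Col n (L + 1)) ℂ[X])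
    (fun m h M => q ⟨m, h⟩ * M) 1 hm

/-- The square part `𝔇_i` of `ξ_i = (𝔇_i, 𝔇̃_i)`. -/
def frakD (q : QTuple n L) (i : Fin L) : Matrix (Col n (i + 1)) (Col n (i + 1)) ℂ[X] :=
  (xi q i i.2.le).submatrix id (fun c => ⟨⟨c.1, by omega⟩, c.2⟩)

/-- The remaining columns `𝔇̃_i` of `ξ_i = (𝔇_i, 𝔇̃_i)`. -/
def frakDt (q : QTuple n L) (i : Fin L) : Matrix (Col n (i + 1)) (CoCol n L i) ℂ[X] :=
  (xi q i i.2.le).submatrix id (fun c => ⟨⟨(c.1 : ℕ) + 1, by omega⟩, c.2⟩)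

/-- The value of a polynomial matrix at a point `z`. -/
def evalAt {α β : Type} (z : ℂ) (M : Matrix α β ℂ[X]) : Matrix α β ℂ := M.map (eval z)

/-- `D(z)⁻¹ M(z) = O(z⁻¹)` as `z → ∞`, entrywise. -/
def InvMulIsBigO {α β : Type} [Fintype α] [DecidableEq α]
    (D : Matrix α α ℂ[X]) (M : Matrix α β ℂ[X]) : Prop :=
  ∀ a b, (fun z : ℂ => ((evalAt z D)⁻¹ * evalAt z M) a b) =O[Bornology.cobounded ℂ] (fun z => z⁻¹)

/-- The boundary conditions with vortex numbers `k`: `det 𝔇_i` is a polynomial of degree exactly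
`k_i`, and `𝔇_i⁻¹ 𝔇̃_i = O(z⁻¹)`. -/
structure IsModuliMatrix (k : ℕ → ℕ) (q : QTuple n L) : Prop where
  degree_det : ∀ i : Fin L, (frakD q i).det.degree = (k i : WithBot ℕ)
  asymptotic : ∀ i : Fin L, InvMulIsBigO (frakD q i) (frakDt q i)

/-- The moduli matrices with vortex numbers `k`. -/
abbrev ModuliMatrix (n k : ℕ → ℕ) (L : ℕ) : Type := {q : QTuple n L // IsModuliMatrix k q}

/-- Tuples `(V_1(z), …, V_L(z))` with `V_i(z)` invertible over the polynomial ring. -/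
abbrev VGroup (n : ℕ → ℕ) (L : ℕ) : Type :=
  (i : Fin L) → Matrix.GeneralLinearGroup (Col n (i + 1)) ℂ[X]

/-- The tuple `V` completed by `V_{L+1} = 1`. -/
def vExt (V : VGroup n L) (m : ℕ) : Matrix.GeneralLinearGroup (Col n (m + 1)) ℂ[X] :=
  if h : m < L then V ⟨m, h⟩ else 1

/-- The `V`-transformation `q_i ↦ V_i q_i V_{i+1}⁻¹`. -/
def vAct (V : VGroup n L) (q : QTuple n L) : QTuple n L := fun i =>
  (vExt V i).val * q i * ((vExt V (i + 1))⁻¹).val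

theorem vExt_one (m : ℕ) : vExt (1 : VGroup n L) m = 1 := by
  unfold vExt; split <;> rfl

theorem vExt_mul (V V' : VGroup n L) (m : ℕ) : vExt (V * V') m = vExt V m * vExt V' m := by
  unfold vExt; split <;> simp

theorem vAct_one (q : QTuple n L) : vAct 1 q = q := by
  funext i; simp [vAct, vExt_one]

theorem vAct_mul (V V' : VGroup n L) (q : QTuple n L) : vAct (V * V') q = vAct V (vAct V' q) := by
  funext i; simp only [vAct, vExt_mul, mul_inv_rev, Units.val_mul, Matrix.mul_assoc]

/-- `V`-equivalence of moduli matrices. -/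
instance vSetoid (n k : ℕ → ℕ) (L : ℕ) : Setoid (ModuliMatrix n k L) where
  r q q' := ∃ V : VGroup n L, q'.1 = vAct V q.1
  iseqv :=
    { refl := fun q => ⟨1, (vAct_one _).symm⟩
      symm := by
        rintro q q' ⟨V, h⟩
        exact ⟨V⁻¹, by rw [h, ← vAct_mul, inv_mul_cancel, vAct_one]⟩
      trans := by
        rintro q q' q'' ⟨V, h⟩ ⟨V', h'⟩
        exact ⟨V' * V, by rw [h', h, vAct_mul]⟩ }

/-- The vortex moduli space: moduli matrices modulo `V`-transformations. -/
abbrev VortexModuli (n k : ℕ → ℕ) (L : ℕ) : Type := Quotient (vSetoid n k L)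

/-! ### Half-ADHM data -/

/-- Tuples of constant matrices `{Z_i, Υ_i, Υ̃_i, W_i}`. -/
@[ext] structure Data (n k : ℕ → ℕ) (L : ℕ) : Type where
  Z : (i : Fin L) → Matrix (Fin (k i)) (Fin (k i)) ℂ
  U : (i : Fin L) → Matrix (Fin (n i)) (Fin (k i)) ℂ
  Ut : (i : Fin L) → Matrix (Fin (k i)) (Fin (n (i + 1))) ℂ
  W : (i : Fin (L - 1)) → Matrix (Fin (k i)) (Fin (k (i + 1))) ℂ

namespace Data

/-- The tuple of all matrices, as a point of a product of matrix spaces. -/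
def toProd (d : Data n k L) :
    ((i : Fin L) → Matrix (Fin (k i)) (Fin (k i)) ℂ) ×
    ((i : Fin L) → Matrix (Fin (n i)) (Fin (k i)) ℂ) ×
    ((i : Fin L) → Matrix (Fin (k i)) (Fin (n (i + 1))) ℂ) ×
    ((i : Fin (L - 1)) → Matrix (Fin (k i)) (Fin (k (i + 1))) ℂ) :=
  (d.Z, d.U, d.Ut, d.W)

/-- The usual topology of the finite-dimensional vector space of all matrix entries. -/
instance : TopologicalSpace (Data n k L) := TopologicalSpace.induced toProd inferInstance

/-- The product `W_j W_{j+1} ⋯ W_{i-1}` for `j ≤ i < L` (the identity matrix for `j = i`). -/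
def chain (d : Data n k L) {j i : ℕ} (h : j ≤ i) : i < L → Matrix (Fin (k j)) (Fin (k i)) ℂ :=
  Nat.leRec (motive := fun i _ => i < L → Matrix (Fin (k j)) (Fin (k i)) ℂ)
    (fun _ => 1) (fun i _ M hi => M (by omega) * d.W ⟨i, by omega⟩) h

/-- `Ψ_i`: its `j`-th block of rows, `j ≤ i`, is `Υ_j W_j ⋯ W_{i-1}`. -/
def Psi (d : Data n k L) (i : Fin L) : Matrix (Col n (i + 1)) (Fin (k i)) ℂ := fun r c =>
  (d.U ⟨r.1, by omega⟩ * d.chain (Nat.lt_succ_iff.mp r.1.2) i.2) r.2 c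

/-- `Ψ̃_i`: its `j`-th block of columns, `j ≥ i`, is `W_i ⋯ W_{j-1} Υ̃_j`. -/
def Psit (d : Data n k L) (i : Fin L) : Matrix (Fin (k i)) (CoCol n L i) ℂ := fun r c =>
  (d.chain c.1.2 c.1.1.2 * d.Ut c.1.1) r c.2

/-- The constraints `Z_i W_i - W_i Z_{i+1} = Υ̃_i Υ_{i+1}` for `1 ≤ i ≤ L - 1`. -/
def Constraint (d : Data n k L) : Prop :=
  ∀ i : Fin (L - 1),
    d.Z ⟨i, by omega⟩ * d.W i - d.W i * d.Z ⟨i + 1, by omega⟩ =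
      d.Ut ⟨i, by omega⟩ * d.U ⟨i + 1, by omega⟩

/-- The free condition: if `Υ_j W_j ⋯ W_{i-1} (z - Z_i)⁻¹ v = 0` for all `j ≤ i` and all `z` for
which the inverse exists, then `v = 0`. -/
def Free (d : Data n k L) : Prop :=
  ∀ (i : Fin L) (v : Fin (k i) → ℂ),
    (∀ (j : ℕ) (hj : j ≤ i) (z : ℂ), IsUnit (Matrix.scalar (Fin (k i)) z - d.Z i).det →
      (d.U ⟨j, by omega⟩ * d.chain hj i.2 * (Matrix.scalar (Fin (k i)) z - d.Z i)⁻¹).mulVec v = 0) →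
    v = 0

/-- The group `GL(k_1, ℂ) × ⋯ × GL(k_L, ℂ)`. -/
abbrev Gauge (k : ℕ → ℕ) (L : ℕ) : Type := (i : Fin L) → Matrix.GeneralLinearGroup (Fin (k i)) ℂ

/-- The (right) action
`(Z_i, Υ_i, Υ̃_i, W_i) ↦ (g_i⁻¹ Z_i g_i, Υ_i g_i, g_i⁻¹ Υ̃_i, g_i⁻¹ W_i g_{i+1})`. -/
def act (d : Data n k L) (g : Gauge k L) : Data n k L where
  Z i := (g i)⁻¹.val * d.Z i * (g i).val
  U i := d.U i * (g i).val
  Ut i := (g i)⁻¹.val * d.Ut i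
  W i := (g ⟨i, by omega⟩)⁻¹.val * d.W i * (g ⟨i + 1, by omega⟩).val

theorem act_one (d : Data n k L) : d.act 1 = d := by
  ext1 <;> funext i <;> simp [act]

theorem act_mul (d : Data n k L) (g h : Gauge k L) : d.act (g * h) = (d.act g).act h := by
  ext1 <;> funext i <;>
    simp only [act, Pi.mul_apply, mul_inv_rev, Units.val_mul, Matrix.mul_assoc]

end Data

/-- Half-ADHM data: tuples subject to the constraints and to the free condition. -/
abbrev HalfADHM (n k : ℕ → ℕ) (L : ℕ) : Type := {d : Data n k L // d.Constraint ∧ d.Free}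

/-- Gauge equivalence of half-ADHM data. -/
instance gaugeSetoid (n k : ℕ → ℕ) (L : ℕ) : Setoid (HalfADHM n k L) where
  r d d' := ∃ g : Data.Gauge k L, d'.1 = d.1.act g
  iseqv :=
    { refl := fun d => ⟨1, (Data.act_one _).symm⟩
      symm := by
        rintro d d' ⟨g, h⟩
        exact ⟨g⁻¹, by rw [h, ← Data.act_mul, mul_inv_cancel, Data.act_one]⟩
      trans := by
        rintro d d' d'' ⟨g, h⟩ ⟨g', h'⟩
        exact ⟨g * g', by rw [h', h, Data.act_mul]⟩ }

/-- The quotient of the half-ADHM data by `GL(k_1, ℂ) × ⋯ × GL(k_L, ℂ)`, with the quotient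
topology. -/
abbrev HalfADHMQuotient (n k : ℕ → ℕ) (L : ℕ) : Type := Quotient (gaugeSetoid n k L)

/-! ### The half-ADHM mapping relation -/

/-- The columns of the polynomial matrix `J` form a basis of the complex vector space of polynomial
column vectors `j(z)` with `D(z)⁻¹ j(z) = O(z⁻¹)`. -/
structure IsSolutionBasis {α κ : Type} [Fintype α] [DecidableEq α] [Fintype κ]
    (D : Matrix α α ℂ[X]) (J : Matrix α κ ℂ[X]) : Prop where
  solution : InvMulIsBigO D J
  independent : ∀ v : κ → ℂ, J.mulVec (fun c => C (v c)) = 0 → v = 0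
  spanning : ∀ f : α → ℂ[X], InvMulIsBigO D (Matrix.of fun a (_ : Unit) => f a) →
    ∃ v : κ → ℂ, f = J.mulVec (fun c => C (v c))

/-- The half-ADHM mapping relation between `q` and `d`, through the polynomial matrices `J_i`:
`𝔇_i Ψ_i = J_i (z - Z_i)` and `𝔇̃_i = J_i Ψ̃_i`. -/
structure MappingRelation (q : QTuple n L) (d : Data n k L)
    (J : (i : Fin L) → Matrix (Col n (i + 1)) (Fin (k i)) ℂ[X]) : Prop where
  basis : ∀ i : Fin L, IsSolutionBasis (frakD q i) (J i)
  square : ∀ i : Fin L,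
    frakD q i * (d.Psi i).map C = J i * (Matrix.scalar (Fin (k i)) X - (d.Z i).map C)
  rest : ∀ i : Fin L, frakDt q i = J i * (d.Psit i).map C

/-! ### Holomorphic families -/

/-- A family of matrix tuples, parametrized by a complex manifold `S` modelled on `E`, all of whose
entries are holomorphic on the subset `T`. -/
structure HolomorphicData (E : Type) [NormedAddCommGroup E] [NormedSpace ℂ E] {S : Type}
    [TopologicalSpace S] [ChartedSpace E S] (T : Set S) (d : S → Data n k L) : Prop where
  Z : ∀ i a b, MDifferentiableOn 𝓘(ℂ, E) 𝓘(ℂ, ℂ) (fun s => (d s).Z i a b) T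
  U : ∀ i a b, MDifferentiableOn 𝓘(ℂ, E) 𝓘(ℂ, ℂ) (fun s => (d s).U i a b) T
  Ut : ∀ i a b, MDifferentiableOn 𝓘(ℂ, E) 𝓘(ℂ, ℂ) (fun s => (d s).Ut i a b) T
  W : ∀ i a b, MDifferentiableOn 𝓘(ℂ, E) 𝓘(ℂ, ℂ) (fun s => (d s).W i a b) T

/-- A family of tuples of polynomial matrices, parametrized by a complex manifold `S` modelled on
`E`, whose entries have bounded degree and coefficients that are holomorphic on the subset `T`. -/
structure HolomorphicQ (E : Type) [NormedAddCommGroup E] [NormedSpace ℂ E] {S : Type}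
    [TopologicalSpace S] [ChartedSpace E S] (T : Set S) (q : S → QTuple n L) : Prop where
  bounded : ∃ M : ℕ, ∀ s ∈ T, ∀ i a b, (q s i a b).natDegree ≤ M
  coeff : ∀ i a b l, MDifferentiableOn 𝓘(ℂ, E) 𝓘(ℂ, ℂ) (fun s => (q s i a b).coeff l) T

end VortexQuiver

end

open VortexQuiver

set_option linter.unusedSectionVars false

noncomputable section

namespace VortexQuiver

/-! ### Asymptotics and degrees -/

/-! Fix a node and write `D` for `𝔇_i`. Division with remainder splits every polynomial vector
uniquely as `D p + r` with `D⁻¹ r` strictly proper. The strictly proper vectors therefore represent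
the cokernel of `D` and form a space of dimension `deg det D = k_i`; let the columns of `J` be a
basis. Dividing `z J` by `D` gives `z J = D Ψ + J Z`, where the quotient `Ψ` is constant because
`D⁻¹ z J` is bounded: this is the square mapping relation. The boundary condition says that `𝔇̃ = J
Ψ̃`. Since `𝔇_i⁻¹ q_i 𝔇_{i+1}` is bounded, `q_i` maps the solutions at the node `i+1` to solutions
at the node `i`, which defines `W_i`. Computing `q_i 𝔇_{i+1} Ψ_{i+1}` in two ways and separating the
multiple of `𝔇_i` from the strictly proper part yields both the constraints and the block form of
`Ψ_i` (`MappingRelation.of_relations`). The only freedom is the choice of the bases, that is, the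
gauge group (`MappingRelation.exists_gauge`).

In the other direction, the free condition says that every pair `(Ψ_i, Z_i)` is observable
(`Data.free_iff`). Hence a staircase of rows `(Ψ Z ^ a)_s`, `a < l s`, is a basis
(`Observable.exists_stair`). Once the gauge makes it the standard basis, the relations expressing
the next row of each step form a polynomial matrix `D` with monic determinant of degree `k_i` and `D
Ψ = J (z - Z)` (`normalForm_isSolutionBasis`). A row `p` is a left multiple of `D` as soon as `p Ψ
(z - Z)⁻¹` is polynomial (`IsSolutionBasis.exists_eq_mul`). This produces `q_i` as a right quotient
(`Data.toQ_mul`), and it shows that `q` is unique up to `V`-transformations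
(`MappingRelation.exists_vAct`).

For the geometry, gauge equivalence is cut out by polynomial equations, so the quotient by the open
projection is Hausdorff. The gauge is fixed by requiring a selected frame to be the identity. The
map (constraints, frame) is a submersion there (`Data.fderiv_sliceMap_surjective`): a covector
annihilating the linearized constraints is killed by observability, and the gauge directions fill
the frames. Its level sets are slices, which provide the charts. All matrices of the normal form are
obtained by division by monic polynomials of constant degree, so slices carry holomorphic families
of moduli matrices. Conversely, for a holomorphic family of moduli matrices, local holomorphic
solution bases exist and the data solve injective linear systems (`exists_differentiableAt_data`).
-/

theorem isBigO_cobounded_iff_degree_le {p q : ℂ[X]} :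
    (fun z => p.eval z) =O[Bornology.cobounded ℂ] (fun z => q.eval z) ↔ p.degree ≤ q.degree := by
  refine ⟨fun h => ?_, isBigO_cobounded_of_degree_le⟩
  by_contra! hlt
  have hp : p ≠ 0 := ne_zero_of_degree_gt hlt
  have h2 := h.trans_isLittleO (isLittleO_cobounded_of_degree_lt (R := ℂ) hlt)
  refine Asymptotics.isLittleO_irrefl ?_ h2
  refine Filter.Eventually.frequently ?_
  have := eventually_cofinite_not_isRoot hp
  exact Bornology.le_cofinite ℂ this

theorem isBigO_div_iff_degree_lt {p q : ℂ[X]} (hq : q ≠ 0) :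
    (fun z => (q.eval z)⁻¹ * p.eval z) =O[Bornology.cobounded ℂ] (fun z => z⁻¹) ↔
      p.degree < q.degree := by
  have hev : ∀ᶠ z in Bornology.cobounded ℂ, q.eval z ≠ 0 :=
    Bornology.le_cofinite ℂ (eventually_cofinite_not_isRoot hq)
  have hz : ∀ᶠ z in Bornology.cobounded ℂ, z ≠ 0 := by
    have := eventually_cofinite_not_isRoot (X_ne_zero (R := ℂ))
    filter_upwards [Bornology.le_cofinite ℂ this] with z hz
    simpa using hz
  -- The decay `z⁻¹` is absorbed into an extra factor `X`, which turns the strict inequality into a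
  -- weak one.
  have h1 : p.degree < q.degree ↔ (X * p).degree ≤ q.degree := by
    by_cases hp : p = 0
    · simp [hp, bot_lt_iff_ne_bot, hq]
    · rw [degree_mul, degree_X, degree_eq_natDegree hp, degree_eq_natDegree hq]
      norm_cast
      omega
  rw [h1, ← isBigO_cobounded_iff_degree_le]
  constructor
  · intro h
    have := (h.mul (Asymptotics.isBigO_refl (fun z => z * q.eval z) (Bornology.cobounded ℂ)))
    refine (this.congr' ?_ ?_)
    · filter_upwards [hev, hz] with z h1 h2
      simp; field_simp
    · filter_upwards [hev, hz] with z h1 h2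
      field_simp
  · intro h
    have := (h.mul (Asymptotics.isBigO_refl (fun z => z⁻¹ * (q.eval z)⁻¹) (Bornology.cobounded ℂ)))
    refine (this.congr' ?_ ?_)
    · filter_upwards [hev, hz] with z h1 h2
      simp; field_simp
    · filter_upwards [hev, hz] with z h1 h2
      field_simp

/-- `D⁻¹ M` is a matrix of strictly proper rational functions. -/
def StrictlyProper {α β : Type} [Fintype α] [DecidableEq α]
    (D : Matrix α α ℂ[X]) (M : Matrix α β ℂ[X]) : Prop :=
  ∀ a b, ((D.adjugate * M) a b).degree < D.det.degree

/-! ### Strict properness and division with remainder by a polynomial matrix. -/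

section Proper

variable {α β γ κ : Type} [Fintype α] [DecidableEq α] [Fintype κ]

theorem evalAt_mul (z : ℂ) (M : Matrix β α ℂ[X]) (N : Matrix α γ ℂ[X]) :
    evalAt z (M * N) = evalAt z M * evalAt z N :=
  Matrix.map_mul (f := evalRingHom z)

/-- Cramer's rule. The pointwise formula holds at every `z`, since both sides vanish by convention
where `det D` has a zero. -/
theorem invMulIsBigO_iff {D : Matrix α α ℂ[X]} (hD : D.det ≠ 0) (M : Matrix α β ℂ[X]) :
    InvMulIsBigO D M ↔ StrictlyProper D M := by
  refine forall_congr' fun a => forall_congr' fun b => ?_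
  rw [← isBigO_div_iff_degree_lt hD]
  have : ∀ z : ℂ, ((evalAt z D)⁻¹ * evalAt z M) a b =
      (D.det.eval z)⁻¹ * ((D.adjugate * M) a b).eval z := by
    intro z
    have h1 : (evalAt z D).det = D.det.eval z := ((evalRingHom z).map_det D).symm
    have h2 : (evalAt z D).adjugate = evalAt z D.adjugate :=
      ((evalRingHom z).map_adjugate D).symm
    rw [Matrix.inv_def, h1, h2, Ring.inverse_eq_inv', Matrix.smul_mul, Matrix.smul_apply,
      ← evalAt_mul]
    rfl
  simp only [this]

theorem strictlyProper_iff_coeff {D : Matrix α α ℂ[X]} (hD : D.det ≠ 0) {M : Matrix α β ℂ[X]} :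
    StrictlyProper D M ↔
      ∀ a b m, D.det.natDegree ≤ m → ((D.adjugate * M) a b).coeff m = 0 := by
  refine forall_congr' fun a => forall_congr' fun b => ?_
  rw [degree_eq_natDegree hD, degree_lt_iff_coeff_zero]

theorem StrictlyProper.mul_const {D : Matrix α α ℂ[X]} {M : Matrix α κ ℂ[X]}
    (h : StrictlyProper D M) (B : Matrix κ β ℂ) (hD : D.det ≠ 0) :
    StrictlyProper D (M * B.map C) := by
  rw [strictlyProper_iff_coeff hD] at *
  intro a b m hm
  rw [← Matrix.mul_assoc, Matrix.mul_apply, finsetSum_coeff]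
  exact Finset.sum_eq_zero fun c _ => by simp [h a c m hm]

/-- `D⁻¹ (D P) = P` is polynomial, and a strictly proper polynomial is zero. This is the uniqueness
of division with remainder by `D`. -/
theorem StrictlyProper.eq_zero_of_mul {D : Matrix α α ℂ[X]} {P : Matrix α β ℂ[X]}
    (h : StrictlyProper D (D * P)) : P = 0 := by
  ext1 a b
  have := h a b
  rw [← Matrix.mul_assoc, Matrix.adjugate_mul, Matrix.smul_mul, Matrix.one_mul,
    Matrix.smul_apply, smul_eq_mul, degree_mul] at this
  by_contra hne
  have h0 : 0 ≤ (P a b).degree := zero_le_degree_iff.2 hne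
  exact absurd this (not_lt.2 (le_add_of_nonneg_right h0))

/-- The quotient comes from Euclidean division of each entry of `adj D * M` by `det D`; after
multiplication by `adj D` the remainder is the entrywise remainder. -/
theorem exists_eq_mul_add_strictlyProper {D : Matrix α α ℂ[X]} (hD : D.det ≠ 0)
    (M : Matrix α β ℂ[X]) :
    StrictlyProper D (M - D * (D.adjugate * M).map (· / D.det)) := by
  intro a b
  have : (D.adjugate * (M - D * (D.adjugate * M).map (· / D.det))) a b =
      (D.adjugate * M) a b % D.det := by
    rw [Matrix.mul_sub, ← Matrix.mul_assoc, Matrix.adjugate_mul, Matrix.smul_mul, Matrix.one_mul,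
      Matrix.sub_apply, Matrix.smul_apply, Matrix.map_apply, smul_eq_mul, EuclideanDomain.mod_eq_sub_mul_div]
  rw [this]
  exact degree_mod_lt _ hD

theorem map_C_sub (A B : Matrix κ β ℂ) : (A - B).map C = A.map C - B.map C := by
  ext1 a b; simp

theorem mulVec_C_eq (J : Matrix α κ ℂ[X]) (v : κ → ℂ) :
    (Matrix.of fun a (_ : Unit) => J.mulVec (fun c => C (v c)) a) =
      J * (Matrix.of fun c (_ : Unit) => v c).map C := by
  ext1 a b
  simp [Matrix.mul_apply, Matrix.mulVec, dotProduct]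

end Proper

/-! ### Cancellation, expansion and change of basis for solution bases. -/

namespace IsSolutionBasis

variable {α β κ κ' : Type} [Fintype α] [DecidableEq α] [Fintype κ] [Fintype κ']
  {D : Matrix α α ℂ[X]} {J : Matrix α κ ℂ[X]}

theorem strictlyProper (h : IsSolutionBasis D J) (hD : D.det ≠ 0) : StrictlyProper D J :=
  (invMulIsBigO_iff hD J).1 h.solution

theorem eq_zero (h : IsSolutionBasis D J) {A : Matrix κ β ℂ} (hA : J * A.map C = 0) : A = 0 := by
  ext a b
  have := h.independent (fun c => A c b) (by
    funext x
    have := congrFun (congrFun hA x) b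
    simpa [Matrix.mul_apply, Matrix.mulVec, dotProduct] using this)
  exact congrFun this a

theorem cancel (h : IsSolutionBasis D J) {A B : Matrix κ β ℂ} (hA : J * A.map C = J * B.map C) :
    A = B := by
  rw [← sub_eq_zero]
  apply h.eq_zero
  rw [map_C_sub, Matrix.mul_sub, hA, sub_self]

theorem exists_eq (h : IsSolutionBasis D J) (hD : D.det ≠ 0) {M : Matrix α β ℂ[X]}
    (hM : StrictlyProper D M) : ∃ B : Matrix κ β ℂ, M = J * B.map C := by
  have : ∀ b, ∃ v : κ → ℂ, (fun a => M a b) = J.mulVec (fun c => C (v c)) := fun b =>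
    h.spanning _ ((invMulIsBigO_iff hD _).2 fun a _ => hM a b)
  choose v hv using this
  refine ⟨Matrix.of fun c b => v b c, ?_⟩
  ext1 a b
  rw [congrFun (hv b) a]
  simp [Matrix.mul_apply, Matrix.mulVec, dotProduct]

/-- Comparison of constant coefficients in an identity between `D P` and a strictly proper part. -/
theorem eq_zero_of_eq (h : IsSolutionBasis D J) (hD : D.det ≠ 0) {A : Matrix κ β ℂ}
    {P : Matrix α β ℂ[X]} (hA : J * A.map C = D * P) : A = 0 ∧ P = 0 := by
  have hP : P = 0 := by
    apply StrictlyProper.eq_zero_of_mul (D := D)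
    rw [← hA]
    exact (h.strictlyProper hD).mul_const A hD
  refine ⟨h.eq_zero (by rw [hA, hP, Matrix.mul_zero]), hP⟩

theorem exists_mul_invertible [DecidableEq κ] (h : IsSolutionBasis D J) {J' : Matrix α κ ℂ[X]}
    (h' : IsSolutionBasis D J') (hD : D.det ≠ 0) :
    ∃ g : Matrix.GeneralLinearGroup κ ℂ, J' = J * g.val.map C := by
  obtain ⟨A, hA⟩ := h.exists_eq hD (h'.strictlyProper hD)
  obtain ⟨B, hB⟩ := h'.exists_eq hD (h.strictlyProper hD)
  have h1 : A * B = 1 := by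
    apply h.cancel
    rw [Matrix.map_mul, ← Matrix.mul_assoc, ← hA, ← hB, Matrix.map_one _ C.map_zero C.map_one, Matrix.mul_one]
  have h2 : B * A = 1 := by
    apply h'.cancel
    rw [Matrix.map_mul, ← Matrix.mul_assoc, ← hB, ← hA, Matrix.map_one _ C.map_zero C.map_one, Matrix.mul_one]
  exact ⟨⟨A, B, h1, h2⟩, hA⟩

theorem mul_right [DecidableEq κ] (h : IsSolutionBasis D J) (hD : D.det ≠ 0)
    (g : Matrix.GeneralLinearGroup κ ℂ) :
    IsSolutionBasis D (J * g.val.map C) := by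
  refine ⟨(invMulIsBigO_iff hD _).2 ((h.strictlyProper hD).mul_const _ hD), fun v hv => ?_,
    fun f hf => ?_⟩
  · have : g.val * (Matrix.of fun c (_ : Unit) => v c) = 0 := by
      apply h.eq_zero
      rw [Matrix.map_mul, ← Matrix.mul_assoc, ← mulVec_C_eq, hv]; rfl
    have h2 : (g⁻¹.val * g.val) * (Matrix.of fun c (_ : Unit) => v c) = 0 := by
      rw [Matrix.mul_assoc, this, Matrix.mul_zero]
    rw [← Units.val_mul, inv_mul_cancel, Units.val_one, Matrix.one_mul] at h2
    funext c
    exact congrFun (congrFun h2 c) ()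
  · obtain ⟨v, hv⟩ := h.spanning f hf
    refine ⟨g⁻¹.val.mulVec v, ?_⟩
    have : (Matrix.of fun a (_ : Unit) => f a) = Matrix.of fun a (_ : Unit) =>
        (J * g.val.map C).mulVec (fun c => C (g⁻¹.val.mulVec v c)) a := by
      rw [mulVec_C_eq]
      have h3 : (Matrix.of fun c (_ : Unit) => g⁻¹.val.mulVec v c) =
          g⁻¹.val * (Matrix.of fun c (_ : Unit) => v c) := by
        ext a b; simp [Matrix.mul_apply, Matrix.mulVec, dotProduct]
      rw [h3, Matrix.map_mul, Matrix.mul_assoc, ← Matrix.mul_assoc (g.val.map C), ← Matrix.map_mul,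
        ← Units.val_mul, mul_inv_cancel, Units.val_one, Matrix.map_one _ C.map_zero C.map_one, Matrix.one_mul,
        ← mulVec_C_eq, hv]
    funext a
    exact congrFun (congrFun this a) ()

/-- `(V D)⁻¹ (V M) = D⁻¹ M`, and `det V` is a unit of degree zero, so strict properness is
unaffected by `V`. -/
theorem mul_left (h : IsSolutionBasis D J) (hD : D.det ≠ 0)
    (V : Matrix.GeneralLinearGroup α ℂ[X]) :
    IsSolutionBasis (V.val * D) (V.val * J) := by
  have hV : IsUnit V.val.det := (Matrix.isUnit_iff_isUnit_det _).1 V.isUnit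
  have hVD : (V.val * D).det ≠ 0 := by
    rw [Matrix.det_mul]; exact mul_ne_zero hV.ne_zero hD
  have key : ∀ {β : Type} (M : Matrix α β ℂ[X]),
      StrictlyProper (V.val * D) (V.val * M) ↔ StrictlyProper D M := by
    intro β M
    refine forall_congr' fun a => forall_congr' fun b => ?_
    rw [Matrix.adjugate_mul_distrib, Matrix.mul_assoc, ← Matrix.mul_assoc V.val.adjugate,
      Matrix.adjugate_mul, Matrix.smul_mul, Matrix.one_mul, Matrix.mul_smul, Matrix.smul_apply,
      smul_eq_mul, Matrix.det_mul, degree_mul, degree_mul, degree_eq_zero_of_isUnit hV, zero_add,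
      zero_add]
  refine ⟨(invMulIsBigO_iff hVD _).2 ((key J).2 (h.strictlyProper hD)), fun v hv => ?_,
    fun f hf => ?_⟩
  · apply h.independent
    have : V⁻¹.val.mulVec ((V.val * J).mulVec (fun c => C (v c))) = 0 := by rw [hv]; simp
    rwa [Matrix.mulVec_mulVec, ← Matrix.mul_assoc, ← Units.val_mul, inv_mul_cancel, Units.val_one,
      Matrix.one_mul] at this
  · have hf' : f = V.val.mulVec (V⁻¹.val.mulVec f) := by
      rw [Matrix.mulVec_mulVec, ← Units.val_mul, mul_inv_cancel, Units.val_one, Matrix.one_mulVec]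
    obtain ⟨v, hv⟩ := h.spanning (V⁻¹.val.mulVec f) (by
      rw [invMulIsBigO_iff hD, ← key]
      rw [invMulIsBigO_iff hVD] at hf
      convert hf using 1
      ext1 a b
      conv_rhs => rw [hf']
      simp [Matrix.mul_apply, Matrix.mulVec, dotProduct])
    refine ⟨v, ?_⟩
    rw [← Matrix.mulVec_mulVec, ← hv, ← hf']

end IsSolutionBasis

end VortexQuiver
end

noncomputable section

namespace VortexQuiver

/-! ### Observable pairs -/

section Observable

variable {α κ : Type} [Fintype κ] [DecidableEq κ]

/-- The coefficients of the adjugate of `X - Z`. -/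
def adjCoeff (Z : Matrix κ κ ℂ) (m : ℕ) : Matrix κ κ ℂ :=
  Z.charmatrix.adjugate.map (fun p => p.coeff m)

theorem charmatrix_eq (Z : Matrix κ κ ℂ) : Z.charmatrix = (X : ℂ[X]) • 1 - Z.map C := by
  rw [Matrix.charmatrix, Matrix.smul_one_eq_diagonal]; rfl

theorem mul_charmatrix (J : Matrix α κ ℂ[X]) (Z : Matrix κ κ ℂ) :
    J * Z.charmatrix = (X : ℂ[X]) • J - J * Z.map C := by
  rw [charmatrix_eq, Matrix.mul_sub, Matrix.mul_smul, Matrix.mul_one]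

/-- The coefficient of `X ^ (m + 1)` in `(X - Z) * adj (X - Z) = χ_Z(X)`. With the constant
coefficient in `mul_adjCoeff_zero` this is the Faddeev–LeVerrier recursion. -/
theorem adjCoeff_eq (Z : Matrix κ κ ℂ) (m : ℕ) :
    adjCoeff Z m = Z * adjCoeff Z (m + 1) + Matrix.scalar κ (Z.charpoly.coeff (m + 1)) := by
  have h := Matrix.mul_adjugate Z.charmatrix
  conv_lhs at h => arg 1; rw [charmatrix_eq]
  rw [Matrix.sub_mul, Matrix.smul_mul, Matrix.one_mul, sub_eq_iff_eq_add'] at h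
  ext a b
  have := congrArg (fun p => coeff p (m + 1)) (congrFun (congrFun h a) b)
  simp only [Matrix.smul_apply, smul_eq_mul, coeff_X_mul, Matrix.add_apply, coeff_add,
    Matrix.mul_apply, finsetSum_coeff, Matrix.map_apply, coeff_C_mul] at this
  simp only [adjCoeff, Matrix.map_apply, Matrix.add_apply, Matrix.mul_apply]
  rw [this]
  congr 1
  by_cases hab : a = b
  · subst hab; simp [Matrix.charpoly]
  · simp [hab]

theorem mul_adjCoeff_zero (Z : Matrix κ κ ℂ) :
    Z * adjCoeff Z 0 = - Matrix.scalar κ (Z.charpoly.coeff 0) := by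
  have h := Matrix.mul_adjugate Z.charmatrix
  conv_lhs at h => arg 1; rw [charmatrix_eq]
  rw [Matrix.sub_mul, Matrix.smul_mul, Matrix.one_mul, sub_eq_iff_eq_add', ← sub_eq_iff_eq_add] at h
  ext a b
  have := congrArg (fun p => coeff p 0) (congrFun (congrFun h a) b)
  simp only [Matrix.smul_apply, smul_eq_mul, mul_coeff_zero, coeff_X_zero, Matrix.sub_apply, coeff_sub,
    Matrix.mul_apply, finsetSum_coeff, Matrix.map_apply, coeff_C_zero, zero_mul, zero_sub] at this
  simp only [adjCoeff, Matrix.map_apply, Matrix.neg_apply, Matrix.mul_apply]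
  rw [← this]
  congr 1
  by_cases hab : a = b
  · subst hab; simp [Matrix.charpoly]
  · simp [hab]

theorem exists_adjCoeff_eq_zero (Z : Matrix κ κ ℂ) : ∃ M, ∀ m, M ≤ m → adjCoeff Z m = 0 := by
  refine ⟨(∑ a, ∑ b, (Z.charmatrix.adjugate a b).natDegree) + 1, fun m hm => ?_⟩
  ext a b
  apply coeff_eq_zero_of_natDegree_lt
  refine lt_of_le_of_lt ?_ (Nat.lt_of_succ_le hm)
  exact (Finset.single_le_sum (f := fun b => (Z.charmatrix.adjugate a b).natDegree)
    (fun _ _ => Nat.zero_le _) (Finset.mem_univ b)).trans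
    (Finset.single_le_sum (f := fun a => ∑ b, (Z.charmatrix.adjugate a b).natDegree)
      (fun _ _ => Nat.zero_le _) (Finset.mem_univ a))

/-- Downward induction for statements about the coefficients of the adjugate. -/
theorem adjCoeff_induction (Z : Matrix κ κ ℂ) {p : ℕ → Prop}
    (h0 : ∀ m, adjCoeff Z m = 0 → p m) (h1 : ∀ m, p (m + 1) → p m) (m : ℕ) : p m := by
  obtain ⟨M, hM⟩ := exists_adjCoeff_eq_zero Z
  have : ∀ j m, M ≤ m + j → p m := by
    intro j
    induction j with
    | zero => exact fun m hm => h0 m (hM m hm)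
    | succ j ih => exact fun m hm => h1 m (ih (m + 1) (by omega))
  exact this M m (by omega)

/-- Beyond the degree of `χ_Z` the recursion has no inhomogeneous term, so vanishing propagates
downwards from the crude bound. -/
theorem adjCoeff_eq_zero (Z : Matrix κ κ ℂ) {m : ℕ} (hm : Fintype.card κ ≤ m) :
    adjCoeff Z m = 0 := by
  revert hm
  refine adjCoeff_induction Z (p := fun m => Fintype.card κ ≤ m → adjCoeff Z m = 0)
    (fun m h _ => h) (fun m ih hm => ?_) m
  rw [adjCoeff_eq, ih (by omega), Matrix.mul_zero, coeff_eq_zero_of_natDegree_lt, map_zero, add_zero]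
  rw [Matrix.charpoly_natDegree_eq_dim]; omega

/-- The rows `Ψ Z ^ j` separate vectors. -/
def Observable (Ψ : Matrix α κ ℂ) (Z : Matrix κ κ ℂ) : Prop :=
  ∀ v : κ → ℂ, (∀ j : ℕ, (Ψ * Z ^ j).mulVec v = 0) → v = 0

/-- The recursion expresses the coefficients of `adj (X - Z)` triangularly through the powers of
`Z`, with top coefficient `1`; the two families of conditions therefore imply each other. -/
theorem mul_adjugate_mulVec_eq_zero_iff (Ψ : Matrix α κ ℂ) (Z : Matrix κ κ ℂ) (v : κ → ℂ) :
    (Ψ.map C * Z.charmatrix.adjugate).mulVec (fun c => C (v c)) = 0 ↔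
      ∀ j : ℕ, (Ψ * Z ^ j).mulVec v = 0 := by
  have h1 : (Ψ.map C * Z.charmatrix.adjugate).mulVec (fun c => C (v c)) = 0 ↔
      ∀ m, (Ψ * adjCoeff Z m).mulVec v = 0 := by
    constructor
    · intro h m
      funext a
      have := congrArg (fun p => coeff p m) (congrFun h a)
      simpa [Matrix.mulVec, dotProduct, Matrix.mul_apply, finsetSum_coeff, adjCoeff] using this
    · intro h
      funext a
      ext m
      have := congrFun (h m) a
      simpa [Matrix.mulVec, dotProduct, Matrix.mul_apply, finsetSum_coeff, adjCoeff] using this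
  rw [h1]
  constructor
  · intro h
    rcases isEmpty_or_nonempty κ with hκ | hκ
    · intro j; funext a; simp [Matrix.mulVec, dotProduct]
    -- The index `card κ - 1` is meaningful only for nonempty `κ`, which is why the empty case was
    -- split off.
    have hv : adjCoeff Z (Fintype.card κ - 1) = 1 := by
      have hpos : 0 < Fintype.card κ := Fintype.card_pos
      have hc : Z.charpoly.coeff (Fintype.card κ) = 1 := by
        have := Z.charpoly_monic.coeff_natDegree
        rwa [Matrix.charpoly_natDegree_eq_dim] at this
      rw [adjCoeff_eq, Nat.sub_add_cancel hpos, adjCoeff_eq_zero Z le_rfl, hc]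
      simp
    -- Each induction step trades the extra factor `Z` for a shift of the coefficient index and a
    -- scalar term; the scalar term dies by the top coefficient of the previous step.
    have key : ∀ j m, (Ψ * Z ^ j * adjCoeff Z m).mulVec v = 0 := by
      intro j
      induction j with
      | zero => intro m; simpa using h m
      | succ j ih =>
        have hj : (Ψ * Z ^ j).mulVec v = 0 := by simpa [hv] using ih (Fintype.card κ - 1)
        have hs : ∀ x : ℂ, (Ψ * Z ^ j * Matrix.scalar κ x).mulVec v = 0 := by
          intro x
          rw [← Matrix.mulVec_mulVec]
          have : (Matrix.scalar κ x).mulVec v = x • v := by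
            funext a; simp [Matrix.mulVec_diagonal]
          rw [this, Matrix.mulVec_smul, hj, smul_zero]
        intro m
        have hz : Ψ * Z ^ (j + 1) * adjCoeff Z m = Ψ * Z ^ j * (Z * adjCoeff Z m) := by
          rw [pow_succ]; simp only [Matrix.mul_assoc]
        rw [hz]
        rcases m with _ | m
        · rw [mul_adjCoeff_zero, Matrix.mul_neg, Matrix.neg_mulVec, hs, neg_zero]
        · rw [← sub_eq_of_eq_add (adjCoeff_eq Z m), Matrix.mul_sub, Matrix.sub_mulVec, ih m, hs,
            sub_zero]
    intro j
    simpa [hv] using key j (Fintype.card κ - 1)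
  · intro h
    have key : ∀ m j, (Ψ * Z ^ j * adjCoeff Z m).mulVec v = 0 := by
      refine adjCoeff_induction Z (fun m hm j => by rw [hm]; simp) (fun m ih j => ?_)
      rw [adjCoeff_eq, Matrix.mul_add, Matrix.add_mulVec, ← Matrix.mul_assoc, Matrix.mul_assoc Ψ,
        ← pow_succ, ih, zero_add, ← Matrix.mulVec_mulVec]
      have : (Matrix.scalar κ (Z.charpoly.coeff (m + 1))).mulVec v =
          (Z.charpoly.coeff (m + 1)) • v := by
        funext a; simp [Matrix.mulVec_diagonal]
      rw [this, Matrix.mulVec_smul, h, smul_zero]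
    intro m
    simpa using key m 0

end Observable

/-! ### The relation `D Ψ = J (X - Z)` -/

section Node

variable {α β κ : Type} [Fintype α] [DecidableEq α] [Fintype κ] [DecidableEq κ]
  {D : Matrix α α ℂ[X]} {J : Matrix α κ ℂ[X]} {Z : Matrix κ κ ℂ} {Ψ : Matrix α κ ℂ}

/-- The identity `D⁻¹ J = Ψ (X - Z)⁻¹` with denominators cleared. -/
theorem charpoly_smul_adjugate_mul (h : D * Ψ.map C = J * Z.charmatrix) :
    Z.charpoly • (D.adjugate * J) = D.det • (Ψ.map C * Z.charmatrix.adjugate) := by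
  have h1 : D.adjugate * (D * Ψ.map C) * Z.charmatrix.adjugate =
      D.adjugate * (J * Z.charmatrix) * Z.charmatrix.adjugate := by rw [h]
  rw [← Matrix.mul_assoc, Matrix.adjugate_mul, ← Matrix.mul_assoc, Matrix.mul_assoc _ Z.charmatrix,
    Matrix.mul_adjugate] at h1
  simp only [Matrix.smul_mul, Matrix.one_mul, Matrix.mul_smul, Matrix.mul_one] at h1
  exact h1.symm

/-- `D⁻¹ J = Ψ (X - Z)⁻¹`, and the resolvent is strictly proper because the entries of `adj (X - Z)`
have degree below `card κ`. -/
theorem strictlyProper_of_mul_eq (hD : D.det ≠ 0) (h : D * Ψ.map C = J * Z.charmatrix) :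
    StrictlyProper D J := by
  intro a b
  have h1 := congrFun (congrFun (charpoly_smul_adjugate_mul h) a) b
  rw [Matrix.smul_apply, Matrix.smul_apply, smul_eq_mul, smul_eq_mul] at h1
  have h2 : ((Ψ.map C * Z.charmatrix.adjugate) a b).degree < Z.charpoly.degree := by
    rw [Matrix.charpoly_degree_eq_dim, degree_lt_iff_coeff_zero]
    intro m hm
    rw [Matrix.mul_apply, finsetSum_coeff]
    refine Finset.sum_eq_zero fun c _ => ?_
    rw [Matrix.map_apply, coeff_C_mul]
    have := congrFun (congrFun (adjCoeff_eq_zero Z hm) c) b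
    rw [adjCoeff, Matrix.map_apply] at this
    rw [this, Matrix.zero_apply, mul_zero]
  have hχ : Z.charpoly ≠ 0 := Z.charpoly_monic.ne_zero
  by_contra hcon
  rw [not_lt] at hcon
  have h3 := congrArg degree h1
  rw [degree_mul, degree_mul] at h3
  rw [degree_eq_natDegree hD] at hcon h3
  rw [degree_eq_natDegree hχ] at h2 h3
  have hne : (D.adjugate * J) a b ≠ 0 := by
    intro h0; rw [h0, degree_zero] at hcon; exact absurd hcon (by simp)
  rw [degree_eq_natDegree hne] at hcon h3
  have hne' : (Ψ.map C * Z.charmatrix.adjugate) a b ≠ 0 := by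
    intro h0; rw [h0, degree_zero, WithBot.add_bot] at h3
    exact absurd h3 (by norm_cast)
  rw [degree_eq_natDegree hne'] at h2 h3
  norm_cast at *
  omega

theorem charmatrix_mul_right_cancel {M N : Matrix β κ ℂ[X]}
    (h : M * Z.charmatrix = N * Z.charmatrix) : M = N := by
  have h1 : M * Z.charmatrix * Z.charmatrix.adjugate = N * Z.charmatrix * Z.charmatrix.adjugate := by
    rw [h]
  rw [Matrix.mul_assoc, Matrix.mul_assoc, Matrix.mul_adjugate, Matrix.mul_smul, Matrix.mul_smul,
    Matrix.mul_one, Matrix.mul_one] at h1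
  ext1 a b
  have := congrFun (congrFun h1 a) b
  exact mul_left_cancel₀ (Z.charpoly_monic.ne_zero) this

theorem mul_right_cancel_of_det {M N : Matrix β α ℂ[X]} (hD : D.det ≠ 0)
    (h : M * D = N * D) : M = N := by
  have h1 : M * D * D.adjugate = N * D * D.adjugate := by rw [h]
  rw [Matrix.mul_assoc, Matrix.mul_assoc, Matrix.mul_adjugate, Matrix.mul_smul, Matrix.mul_smul,
    Matrix.mul_one, Matrix.mul_one] at h1
  ext1 a b
  exact mul_left_cancel₀ hD (congrFun (congrFun h1 a) b)

/-- If all `Ψ Z ^ j v` vanish, then `D⁻¹ J v = Ψ (X - Z)⁻¹ v = 0`, and the columns of `J` are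
independent. -/
theorem IsSolutionBasis.observable (hJ : IsSolutionBasis D J) (hD : D.det ≠ 0)
    (h : D * Ψ.map C = J * Z.charmatrix) : Observable Ψ Z := by
  intro v hv
  rw [← mul_adjugate_mulVec_eq_zero_iff] at hv
  apply hJ.independent
  have h1 : (Z.charpoly • (D.adjugate * J)).mulVec (fun c => C (v c)) = 0 := by
    rw [charpoly_smul_adjugate_mul h, Matrix.smul_mulVec, hv, smul_zero]
  have h2 : (Z.charpoly • (D * (D.adjugate * J))).mulVec (fun c => C (v c)) = 0 := by
    rw [← Matrix.mul_smul, ← Matrix.mulVec_mulVec, h1, Matrix.mulVec_zero]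
  rw [← Matrix.mul_assoc, Matrix.mul_adjugate, Matrix.smul_mul, Matrix.one_mul, smul_smul,
    Matrix.smul_mulVec] at h2
  funext a
  have := congrFun h2 a
  exact (mul_eq_zero.1 this).resolve_left (mul_ne_zero Z.charpoly_monic.ne_zero hD)

/-- The rows `p` for which `p Ψ (X - Z)⁻¹` is polynomial are the combinations of the rows of `D`. -/
theorem IsSolutionBasis.exists_eq_mul (hJ : IsSolutionBasis D J) (hD : D.det ≠ 0)
    (h : D * Ψ.map C = J * Z.charmatrix) {P : Matrix β α ℂ[X]} {T : Matrix β κ ℂ[X]}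
    (hP : P * Ψ.map C = T * Z.charmatrix) : ∃ S : Matrix β α ℂ[X], P = S * D ∧ T = S * J := by
  have h1 : P * D.adjugate * J = D.det • T := by
    apply charmatrix_mul_right_cancel (Z := Z)
    rw [Matrix.mul_assoc, ← h, Matrix.mul_assoc, ← Matrix.mul_assoc D.adjugate,
      Matrix.adjugate_mul, Matrix.smul_mul, Matrix.one_mul, Matrix.mul_smul, hP, Matrix.smul_mul]
  -- Dividing the identity matrix by `D` gives a Bézout identity `1 = D Q + J B`. Since `P D⁻¹ J = P
  -- Ψ (X - Z)⁻¹ = T`, it turns `P D⁻¹` into the polynomial matrix `P Q + T B`.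
  obtain ⟨B, hB⟩ := hJ.exists_eq hD (exists_eq_mul_add_strictlyProper hD (1 : Matrix α α ℂ[X]))
  set Q := (D.adjugate * (1 : Matrix α α ℂ[X])).map (· / D.det)
  have h2 : P * D.adjugate = D.det • (P * Q + T * B.map C) := by
    have : (1 : Matrix α α ℂ[X]) = D * Q + J * B.map C := by rw [← hB]; abel
    calc P * D.adjugate = P * D.adjugate * 1 := (Matrix.mul_one _).symm
      _ = P * D.adjugate * (D * Q + J * B.map C) := by rw [← this]
      _ = P * (D.adjugate * D) * Q + P * D.adjugate * J * B.map C := by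
        simp only [Matrix.mul_add, Matrix.mul_assoc]
      _ = _ := by
        rw [h1, Matrix.adjugate_mul]
        simp only [Matrix.mul_smul, Matrix.smul_mul, Matrix.mul_one, smul_add]
  have h3 : P = (P * Q + T * B.map C) * D := by
    have h4 : P * D.adjugate * D = (D.det • (P * Q + T * B.map C)) * D := by rw [h2]
    rw [Matrix.mul_assoc, Matrix.adjugate_mul, Matrix.mul_smul, Matrix.mul_one,
      Matrix.smul_mul] at h4
    ext1 a b
    exact mul_left_cancel₀ hD (congrFun (congrFun h4 a) b)
  refine ⟨_, h3, ?_⟩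
  apply charmatrix_mul_right_cancel (Z := Z)
  rw [← hP, Matrix.mul_assoc, ← h, ← Matrix.mul_assoc, ← h3]

/-- The pair `(Ψ, Z)` determines `D` up to a unimodular left factor: by
`IsSolutionBasis.exists_eq_mul`, `D` and `D'` are left multiples of each other. -/
theorem IsSolutionBasis.exists_generalLinear (hJ : IsSolutionBasis D J) (hD : D.det ≠ 0)
    (h : D * Ψ.map C = J * Z.charmatrix) {D' : Matrix α α ℂ[X]} {J' : Matrix α κ ℂ[X]}
    (hJ' : IsSolutionBasis D' J') (hD' : D'.det ≠ 0)
    (h' : D' * Ψ.map C = J' * Z.charmatrix) :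
    ∃ V : Matrix.GeneralLinearGroup α ℂ[X], D' = V.val * D ∧ J' = V.val * J := by
  obtain ⟨V, h1, h2⟩ := hJ.exists_eq_mul hD h h'
  obtain ⟨V', h3, -⟩ := hJ'.exists_eq_mul hD' h' h
  refine ⟨⟨V, V', ?_, ?_⟩, h1, h2⟩
  · apply mul_right_cancel_of_det hD'
    rw [Matrix.mul_assoc, ← h3, ← h1, Matrix.one_mul]
  · apply mul_right_cancel_of_det hD
    rw [Matrix.mul_assoc, ← h1, ← h3, Matrix.one_mul]

/-- `Z` is multiplication by `X` on the solutions modulo `D`, and `Ψ` is the quotient in the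
division of `X • J` by `D`. -/
theorem IsSolutionBasis.exists_mul_eq (hJ : IsSolutionBasis D J) (hD : D.det ≠ 0) :
    ∃ (Z : Matrix κ κ ℂ) (Ψ : Matrix α κ ℂ), D * Ψ.map C = J * Z.charmatrix := by
  have hsp := exists_eq_mul_add_strictlyProper hD ((X : ℂ[X]) • J)
  obtain ⟨Z, hZ⟩ := hJ.exists_eq hD hsp
  set Q := (D.adjugate * ((X : ℂ[X]) • J)).map (· / D.det) with hQ
  -- `D⁻¹ J` decays, so `D⁻¹ (X J)` is bounded and its polynomial part is constant.
  have hdeg : ∀ a b, (Q a b).degree ≤ 0 := by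
    intro a b
    have h1 := hJ.strictlyProper hD a b
    rw [hQ, Matrix.map_apply, Matrix.mul_smul, Matrix.smul_apply, smul_eq_mul]
    rw [degree_le_iff_coeff_zero]
    by_cases h0 : (D.adjugate * J) a b = 0
    · intro m _; rw [h0, mul_zero, EuclideanDomain.zero_div, coeff_zero]
    rw [← degree_le_iff_coeff_zero]
    by_cases hlt : (X * (D.adjugate * J) a b).degree < D.det.degree
    · rw [(Polynomial.div_eq_zero_iff hD).2 hlt]; simp
    · have := degree_add_div hD (not_lt.1 hlt)
      rw [degree_mul, degree_X] at this
      by_contra hc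
      rw [not_le] at hc
      have hne : X * (D.adjugate * J) a b / D.det ≠ 0 := by
        intro h; rw [h, degree_zero] at hc; exact absurd hc (by simp)
      rw [degree_eq_natDegree hne, degree_eq_natDegree hD, degree_eq_natDegree h0] at *
      norm_cast at *
      omega
  refine ⟨Z, Q.map (fun p => p.coeff 0), ?_⟩
  have hQC : (Q.map (fun p => p.coeff 0)).map C = Q := by
    ext1 a b
    exact (eq_C_of_degree_le_zero (hdeg a b)).symm
  rw [hQC, mul_charmatrix, ← hZ]
  abel

variable (D) in
/-- Every nondegenerate polynomial matrix has a solution basis. -/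
theorem exists_isSolutionBasis (hD : D.det ≠ 0) :
    ∃ (s : ℕ) (J : Matrix α (Fin s) ℂ[X]), IsSolutionBasis D J := by
  let adjL : (α → ℂ[X]) →ₗ[ℂ] (α → ℂ[X]) := (Matrix.mulVecLin D.adjugate).restrictScalars ℂ
  have hinj : Function.Injective adjL := by
    rw [injective_iff_map_eq_zero]
    intro f hf
    have h1 : D.adjugate.mulVec f = 0 := hf
    have h2 : D.mulVec (D.adjugate.mulVec f) = 0 := by rw [h1, Matrix.mulVec_zero]
    rw [Matrix.mulVec_mulVec, Matrix.mul_adjugate, Matrix.smul_mulVec, Matrix.one_mulVec] at h2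
    funext a
    exact (mul_eq_zero.1 (congrFun h2 a)).resolve_left hD
  -- The solution space is the preimage of this finite-dimensional space of low-degree vectors under
  -- multiplication by `adj D`, which is injective.
  let B : Submodule ℂ (α → ℂ[X]) := Submodule.pi Set.univ fun _ => degreeLT ℂ D.det.natDegree
  let S : Submodule ℂ (α → ℂ[X]) := B.comap adjL
  have hBfin : FiniteDimensional ℂ B := by
    let φ : B →ₗ[ℂ] (α → degreeLT ℂ D.det.natDegree) :=
      LinearMap.pi fun a => LinearMap.codRestrict _ ((LinearMap.proj a).comp B.subtype)
        (fun x => x.2 a (Set.mem_univ _))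
    have : FiniteDimensional ℂ (degreeLT ℂ D.det.natDegree) :=
      Module.Finite.equiv (degreeLTEquiv ℂ _).symm
    refine FiniteDimensional.of_injective φ ?_
    intro x y hxy
    ext1
    funext a
    exact congrArg Subtype.val (congrFun hxy a)
  have hSfin : FiniteDimensional ℂ S := by
    refine FiniteDimensional.of_injective (adjL.restrict (p := S) (q := B) fun x hx => hx) ?_
    intro x y hxy
    exact Subtype.ext (hinj (congrArg Subtype.val hxy))
  let b := Module.finBasis ℂ S
  have hmem : ∀ f : α → ℂ[X], f ∈ S ↔ ∀ a, (D.adjugate.mulVec f a).degree < D.det.degree := by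
    intro f
    simp only [S, B, Submodule.mem_comap, Submodule.mem_pi, Set.mem_univ, forall_true_left,
      mem_degreeLT, degree_eq_natDegree hD]
    rfl
  let J : Matrix α (Fin (Module.finrank ℂ S)) ℂ[X] := Matrix.of fun a c => (b c).1 a
  have hsum : ∀ v : Fin (Module.finrank ℂ S) → ℂ,
      J.mulVec (fun c => C (v c)) = (∑ c, v c • b c : S).1 := by
    intro v
    funext a
    simp [J, Matrix.mulVec, dotProduct, smul_eq_C_mul, mul_comm]
  refine ⟨_, J, (invMulIsBigO_iff hD _).2 fun a c => (hmem _).1 (b c).2 a, fun v hv => ?_,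
    fun f hf => ?_⟩
  · rw [hsum] at hv
    have h0 : ∑ c, v c • b c = 0 := Subtype.ext hv
    have := Fintype.linearIndependent_iff.1 b.linearIndependent v h0
    exact funext this
  · have hf' : f ∈ S := by
      rw [hmem]
      exact fun a => (invMulIsBigO_iff hD _).1 hf a ()
    refine ⟨b.repr ⟨f, hf'⟩, ?_⟩
    rw [hsum, b.sum_repr]

end Node

end VortexQuiver
end

noncomputable section

namespace VortexQuiver

/-! ### Column reduced matrices -/

theorem coeff_prod_of_natDegree_le_sum {R ι : Type*} [CommRing R] (s : Finset ι) (f : ι → R[X])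
    (l : ι → ℕ) (h : ∀ i ∈ s, (f i).natDegree ≤ l i) :
    (∏ i ∈ s, f i).natDegree ≤ ∑ i ∈ s, l i ∧
      (∏ i ∈ s, f i).coeff (∑ i ∈ s, l i) = ∏ i ∈ s, (f i).coeff (l i) := by
  classical
  induction s using Finset.induction_on with
  | empty => simp
  | insert a s ha ih =>
    obtain ⟨h1, h2⟩ := ih fun i hi => h i (Finset.mem_insert_of_mem hi)
    have h3 := h a (Finset.mem_insert_self a s)
    rw [Finset.prod_insert ha, Finset.sum_insert ha, Finset.prod_insert ha]
    exact ⟨natDegree_mul_le.trans (add_le_add h3 h1),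
      by rw [coeff_mul_add_eq_of_natDegree_le h3 h1, h2]⟩

/-- Every Leibniz term takes one entry from each column, so column degree bounds add up and the top
coefficients assemble into the determinant of the leading column coefficients. -/
theorem coeff_det_of_natDegree_le {R α : Type*} [CommRing R] [Fintype α] [DecidableEq α]
    (M : Matrix α α R[X]) (l : α → ℕ) (h : ∀ a b, (M a b).natDegree ≤ l b) :
    M.det.natDegree ≤ ∑ b, l b ∧
      M.det.coeff (∑ b, l b) = (Matrix.of fun a b => (M a b).coeff (l b)).det := by
  rw [Matrix.det_apply, Matrix.det_apply]
  have key := fun σ : Equiv.Perm α =>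
    coeff_prod_of_natDegree_le_sum Finset.univ (fun b => M (σ b) b) l (fun b _ => h _ b)
  constructor
  · refine natDegree_sum_le_of_forall_le _ _ fun σ _ => ?_
    exact (natDegree_smul_le _ _).trans (key σ).1
  · rw [finsetSum_coeff]
    refine Finset.sum_congr rfl fun σ _ => ?_
    rw [coeff_smul, (key σ).2]
    rfl

/-! ### The normal form of an observable pair -/

section NormalForm

variable {α κ : Type} [Fintype α] [DecidableEq α] [Fintype κ] [DecidableEq κ]

/-- The matrix with rows `(Ψ Z ^ a)_s` for the pairs `(s, a)` in the image of `e`. -/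
def rowMat (e : κ → α × ℕ) (Ψ : Matrix α κ ℂ) (Z : Matrix κ κ ℂ) : Matrix κ κ ℂ :=
  Matrix.of fun c => (Ψ * Z ^ (e c).2) (e c).1

variable {l : α → ℕ} (e : κ ≃ (s : α) × Fin (l s))

/-- The rows selected by an enumeration of the pairs `(s, a)` with `a < l s`. -/
def stair : κ → α × ℕ := fun c => ((e c).1, (e c).2)

/-- The matrix whose `r`-th row is the relation expressing `(Ψ Z ^ l r)_r` through the rows
`(Ψ Z ^ a)_s`, `a < l s`, when these form the standard basis. -/
def normalForm (Ψ : Matrix α κ ℂ) (Z : Matrix κ κ ℂ) : Matrix α α ℂ[X] := Matrix.of fun r s =>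
  (if r = s then X ^ l r else 0) - ∑ a : Fin (l s), C ((Ψ * Z ^ l r) r (e.symm ⟨s, a⟩)) * X ^ (a : ℕ)

theorem stair_symm (s : α) (a : Fin (l s)) : stair e (e.symm ⟨s, a⟩) = (s, (a : ℕ)) := by
  change (fun x : (s : α) × Fin (l s) => (x.1, (x.2 : ℕ))) (e (e.symm ⟨s, a⟩)) = _
  rw [e.apply_symm_apply]

theorem normalForm_natDegree_coeff (Ψ : Matrix α κ ℂ) (Z : Matrix κ κ ℂ) (r s : α) :
    (normalForm e Ψ Z r s).natDegree ≤ l s ∧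
      (normalForm e Ψ Z r s).coeff (l s) = if r = s then 1 else 0 := by
  constructor
  · refine (natDegree_sub_le _ _).trans (max_le ?_ ?_)
    · split_ifs with h
      · subst h; exact natDegree_X_pow_le _
      · simp
    · refine natDegree_sum_le_of_forall_le _ _ fun a _ => ?_
      exact (natDegree_C_mul_X_pow_le _ _).trans a.2.le
  · rw [normalForm, Matrix.of_apply, coeff_sub, finsetSum_coeff, Finset.sum_eq_zero, sub_zero]
    · split_ifs with h
      · subst h; simp
      · simp
    · intro a _
      rw [coeff_C_mul_X_pow, if_neg (by have := a.2; omega)]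

theorem sum_stair_eq {l : α → ℕ} (e : κ ≃ (s : α) × Fin (l s)) : ∑ s, l s = Fintype.card κ := by
  rw [Fintype.card_congr e, Fintype.card_sigma]; simp

/-- The leading column coefficients form the identity matrix, and the column degrees `l s` add up to
`card κ`. -/
theorem normalForm_det (Ψ : Matrix α κ ℂ) (Z : Matrix κ κ ℂ) :
    (normalForm e Ψ Z).det.Monic ∧ (normalForm e Ψ Z).det.natDegree = Fintype.card κ := by
  obtain ⟨h1, h2⟩ := coeff_det_of_natDegree_le (normalForm e Ψ Z) l
    fun a b => (normalForm_natDegree_coeff e Ψ Z a b).1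
  have h3 : (Matrix.of fun a b => (normalForm e Ψ Z a b).coeff (l b)) = 1 := by
    ext1 a b
    rw [Matrix.of_apply, (normalForm_natDegree_coeff e Ψ Z a b).2, Matrix.one_apply]
  rw [h3, Matrix.det_one] at h2
  have h4 := monic_of_natDegree_le_of_coeff_eq_one _ h1 h2
  refine ⟨h4, ?_⟩
  rw [← sum_stair_eq e]
  refine le_antisymm h1 (le_natDegree_of_ne_zero ?_)
  rw [h2]; exact one_ne_zero

/-- The geometric sum for the commuting matrices `X • 1` and `Z`. -/
theorem exists_mul_charmatrix_eq (Z : Matrix κ κ ℂ) (n : ℕ) :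
    ∃ G : Matrix κ κ ℂ[X], G * Z.charmatrix = (X : ℂ[X]) ^ n • 1 - (Z ^ n).map C := by
  have hc : Commute ((X : ℂ[X]) • (1 : Matrix κ κ ℂ[X])) (Z.map C) := by
    rw [commute_iff_eq, Matrix.smul_mul, Matrix.mul_smul, Matrix.one_mul, Matrix.mul_one]
  refine ⟨_, (charmatrix_eq Z ▸ hc.geom_sum₂_mul n).trans ?_⟩
  rw [_root_.smul_pow, one_pow]
  congr 1
  exact (map_pow (C.mapMatrix) Z n).symm

variable {e} {Ψ : Matrix α κ ℂ} {Z : Matrix κ κ ℂ}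

/-- Modulo left multiples of `X - Z` one has `X ^ a Ψ_s ≡ (Ψ Z ^ a)_s`. The `r`-th row of the
product is therefore congruent to `(Ψ Z ^ l r)_r` minus its own expansion in the standard basis,
that is, to zero. -/
theorem exists_normalForm_mul_eq (h : rowMat (stair e) Ψ Z = 1) :
    ∃ J : Matrix α κ ℂ[X], normalForm e Ψ Z * Ψ.map C = J * Z.charmatrix := by
  choose G hG using exists_mul_charmatrix_eq Z
  have hrow : ∀ (s : α) (n : ℕ), Matrix.vecMul (Matrix.vecMul (fun c => C (Ψ s c)) (G n)) Z.charmatrix =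
      fun c => X ^ n * C (Ψ s c) - C ((Ψ * Z ^ n) s c) := by
    intro s n
    rw [Matrix.vecMul_vecMul, hG, Matrix.vecMul_sub, Matrix.vecMul_smul, Matrix.vecMul_one]
    funext c
    simp [Matrix.vecMul, dotProduct, Matrix.mul_apply]
  -- The normalization of the frame: the selected rows are the unit vectors.
  have hstd : ∀ s (a : Fin (l s)) c, (Ψ * Z ^ (a : ℕ)) s c = if e.symm ⟨s, a⟩ = c then 1 else 0 := by
    intro s a c
    have := congrFun (congrFun h (e.symm ⟨s, a⟩)) c
    rw [Matrix.one_apply] at this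
    rw [← this, rowMat, Matrix.of_apply, stair_symm]
  refine ⟨Matrix.of fun r => Matrix.vecMul (fun c => C (Ψ r c)) (G (l r)) -
    ∑ s, ∑ a : Fin (l s), C ((Ψ * Z ^ l r) r (e.symm ⟨s, a⟩)) •
      Matrix.vecMul (fun c => C (Ψ s c)) (G a), ?_⟩
  ext1 r c
  have hR : (Matrix.of fun r => Matrix.vecMul (fun c => C (Ψ r c)) (G (l r)) -
    ∑ s, ∑ a : Fin (l s), C ((Ψ * Z ^ l r) r (e.symm ⟨s, a⟩)) •
      Matrix.vecMul (fun c => C (Ψ s c)) (G a)) * Z.charmatrix = Matrix.of fun r =>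
        Matrix.vecMul (Matrix.vecMul (fun c => C (Ψ r c)) (G (l r)) -
    ∑ s, ∑ a : Fin (l s), C ((Ψ * Z ^ l r) r (e.symm ⟨s, a⟩)) •
      Matrix.vecMul (fun c => C (Ψ s c)) (G a)) Z.charmatrix := rfl
  rw [hR, Matrix.of_apply, Matrix.sub_vecMul, Matrix.sum_vecMul]
  simp only [Matrix.sum_vecMul, Matrix.smul_vecMul, hrow, Pi.sub_apply, Finset.sum_apply,
    Pi.smul_apply, smul_eq_mul, hstd]
  have hs : ∑ s, ∑ a : Fin (l s), C ((Ψ * Z ^ l r) r (e.symm ⟨s, a⟩)) *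
      C (if e.symm ⟨s, a⟩ = c then (1 : ℂ) else 0) = C ((Ψ * Z ^ l r) r c) := by
    rw [← Fintype.sum_sigma (f := fun x : (s : α) × Fin (l s) =>
      C ((Ψ * Z ^ l r) r (e.symm x)) * C (if e.symm x = c then (1 : ℂ) else 0)),
      Equiv.sum_comp e.symm (fun x => C ((Ψ * Z ^ l r) r x) * C (if x = c then (1 : ℂ) else 0))]
    simp [apply_ite C]
  simp only [mul_sub, Finset.sum_sub_distrib, hs]
  rw [sub_sub_sub_cancel_right]
  simp only [normalForm, Matrix.mul_apply, Matrix.of_apply, sub_mul, Finset.sum_sub_distrib,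
    Matrix.map_apply, ite_mul, zero_mul, Finset.sum_ite_eq, Finset.mem_univ, if_true]
  simp only [Finset.sum_mul, mul_assoc]

theorem observable_of_rowMat (e' : κ → α × ℕ) (h : IsUnit (rowMat e' Ψ Z).det) : Observable Ψ Z := by
  intro v hv
  have h1 : (rowMat e' Ψ Z).mulVec v = 0 := by
    funext c
    exact congrFun (hv (e' c).2) (e' c).1
  rw [← Matrix.isUnit_iff_isUnit_det] at h
  exact (Matrix.mulVec_injective_iff_isUnit.2 h) (by rw [h1, Matrix.mulVec_zero])

/-- Only spanning needs an argument, and it is a dimension count. For a solution `f` put `g = adj D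
f`, so that `D g = det D • f`. If `g_s` has no coefficients in the top `l s` degrees below `card κ`,
then the column degrees force `D g` to have degree below `det D`, whence `f = 0`. So a solution is
determined by `∑ l s = card κ` coefficients, and the independent columns of `J` already exhaust
them. -/
theorem normalForm_isSolutionBasis (h : rowMat (stair e) Ψ Z = 1) {J : Matrix α κ ℂ[X]}
    (hJ : normalForm e Ψ Z * Ψ.map C = J * Z.charmatrix) :
    IsSolutionBasis (normalForm e Ψ Z) J := by
  set D := normalForm e Ψ Z with hDdef
  obtain ⟨hmonic, hdeg⟩ := normalForm_det e Ψ Z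
  rw [← hDdef] at hmonic hdeg
  have hD : D.det ≠ 0 := hmonic.ne_zero
  have hobs : Observable Ψ Z := observable_of_rowMat (stair e) (by rw [h, Matrix.det_one]; exact isUnit_one)
  have hind : ∀ v : κ → ℂ, J.mulVec (fun c => C (v c)) = 0 → v = 0 := by
    intro v hv
    apply hobs
    rw [← mul_adjugate_mulVec_eq_zero_iff]
    have h1 : (Z.charpoly • (D.adjugate * J)).mulVec (fun c => C (v c)) = 0 := by
      rw [Matrix.smul_mulVec, ← Matrix.mulVec_mulVec, hv, Matrix.mulVec_zero, smul_zero]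
    rw [charpoly_smul_adjugate_mul hJ, Matrix.smul_mulVec] at h1
    funext a
    exact (mul_eq_zero.1 (congrFun h1 a)).resolve_left hD
  have hsp := strictlyProper_of_mul_eq hD hJ
  refine ⟨(invMulIsBigO_iff hD _).2 hsp, hind, fun f hf => ?_⟩
  rw [invMulIsBigO_iff hD] at hf
  -- the leading coefficients of a solution determine it
  let lead : (α → ℂ[X]) → κ → ℂ := fun f c =>
    (D.adjugate.mulVec f (stair e c).1).coeff (Fintype.card κ - 1 - (stair e c).2)
  have hlead : ∀ f : α → ℂ[X], (∀ a, (D.adjugate.mulVec f a).degree < D.det.degree) →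
      lead f = 0 → f = 0 := by
    intro f hf hl
    have hcoeff : ∀ s m, Fintype.card κ ≤ m + l s → (D.adjugate.mulVec f s).coeff m = 0 := by
      intro s m hm
      by_cases hmk : Fintype.card κ ≤ m
      · have := hf s
        rw [degree_eq_natDegree hD, degree_lt_iff_coeff_zero] at this
        exact this m (hdeg ▸ hmk)
      · have := congrFun hl (e.symm ⟨s, ⟨Fintype.card κ - 1 - m, by omega⟩⟩)
        simp only [lead, stair_symm, Pi.zero_apply] at this
        rwa [show Fintype.card κ - 1 - (Fintype.card κ - 1 - m) = m by omega] at this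
    have hfD : D.mulVec (D.adjugate.mulVec f) = D.det • f := by
      rw [Matrix.mulVec_mulVec, Matrix.mul_adjugate, Matrix.smul_mulVec, Matrix.one_mulVec]
    funext r
    have h1 : (D.det * f r).degree < (D.det).degree := by
      rw [degree_eq_natDegree hD, hdeg, degree_lt_iff_coeff_zero]
      intro m hm
      have := congrFun hfD r
      rw [Pi.smul_apply, smul_eq_mul] at this
      rw [← this, Matrix.mulVec, dotProduct, finsetSum_coeff]
      refine Finset.sum_eq_zero fun s _ => ?_
      rw [coeff_mul]
      refine Finset.sum_eq_zero fun x hx => ?_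
      rw [Finset.HasAntidiagonal.mem_antidiagonal] at hx
      by_cases hxl : x.1 ≤ l s
      · rw [hcoeff s x.2 (by omega), mul_zero]
      · rw [coeff_eq_zero_of_natDegree_lt (p := D r s), zero_mul]
        exact lt_of_le_of_lt (normalForm_natDegree_coeff e Ψ Z r s).1 (by omega)
    by_contra hne
    rw [degree_mul] at h1
    have h0 : 0 ≤ (f r).degree := zero_le_degree_iff.2 hne
    exact absurd h1 (not_lt.2 (le_add_of_nonneg_right h0))
  let Λ : (κ → ℂ) →ₗ[ℂ] (κ → ℂ) :=
    { toFun := fun v => lead (J.mulVec (fun c => C (v c)))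
      map_add' := fun v w => by
        funext c
        simp only [lead, Pi.add_apply, C_add]
        rw [← coeff_add, ← Pi.add_apply, ← Matrix.mulVec_add, ← Matrix.mulVec_add]; rfl
      map_smul' := fun t v => by
        funext c
        simp only [lead, Pi.smul_apply, smul_eq_mul, C_mul, RingHom.id_apply]
        rw [← coeff_C_mul]
        have : (fun c => C t * C (v c)) = C t • fun c => C (v c) := rfl
        rw [this, Matrix.mulVec_smul, Matrix.mulVec_smul]; rfl }
  have hspv : ∀ v : κ → ℂ, ∀ a,
      (D.adjugate.mulVec (J.mulVec (fun c => C (v c))) a).degree < D.det.degree := by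
    intro v a
    have := hsp.mul_const (Matrix.of fun c (_ : Unit) => v c) hD a ()
    rwa [← mulVec_C_eq] at this
  have hΛ : Function.Injective Λ := by
    rw [injective_iff_map_eq_zero]
    intro v hv
    exact hind v (hlead _ (hspv v) hv)
  obtain ⟨v, hv⟩ := LinearMap.injective_iff_surjective.1 hΛ (lead f)
  refine ⟨v, ?_⟩
  rw [← sub_eq_zero]
  apply hlead
  · intro a
    rw [Matrix.mulVec_sub, Pi.sub_apply]
    exact lt_of_le_of_lt (degree_sub_le _ _) (max_lt (hf a ()) (hspv v a))
  · funext c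
    have := congrFun hv c
    simp only [lead, Matrix.mulVec_sub, Pi.sub_apply, coeff_sub, Pi.zero_apply]
    rw [sub_eq_zero]
    exact this.symm

/-- An observable pair has a staircase of rows forming a basis. -/
theorem Observable.exists_stair (hobs : Observable Ψ Z) :
    ∃ (l : α → ℕ) (e : κ ≃ (s : α) × Fin (l s)), IsUnit (rowMat (stair e) Ψ Z).det := by
  let f : α × ℕ → (κ → ℂ) := fun p => (Ψ * Z ^ p.2) p.1
  let S : (α → ℕ) → Set (α × ℕ) := fun l => {p | p.2 < l p.1}
  let eS : ∀ l : α → ℕ, S l ≃ (s : α) × Fin (l s) := fun l =>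
    { toFun := fun p => ⟨p.1.1, ⟨p.1.2, p.2⟩⟩
      invFun := fun x => ⟨(x.1, x.2), x.2.2⟩
      left_inv := fun _ => rfl
      right_inv := fun _ => rfl }
  have hcard : ∀ l, LinearIndepOn ℂ f (S l) → ∑ s, l s ≤ Fintype.card κ := by
    intro l hl
    have : Fintype (S l) := Fintype.ofEquiv _ (eS l).symm
    have h1 := LinearIndependent.fintype_card_le_finrank hl
    rw [Fintype.card_congr (eS l), Fintype.card_sigma] at h1
    simpa using h1
  -- An independent staircase of maximal size; sizes are bounded by `card κ`.
  obtain ⟨l, hl, hmax⟩ : ∃ l, LinearIndepOn ℂ f (S l) ∧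
      ∀ l', LinearIndepOn ℂ f (S l') → ∑ s, l' s ≤ ∑ s, l s := by
    let T : Set ℕ := {n | ∃ l, LinearIndepOn ℂ f (S l) ∧ ∑ s, l s = n}
    have hT : T.Nonempty := ⟨_, 0, by
      have : S 0 = ∅ := by ext p; simp [S]
      rw [this]; exact linearIndepOn_empty ℂ f, rfl⟩
    have hb : BddAbove T := ⟨Fintype.card κ, by rintro _ ⟨l, hl, rfl⟩; exact hcard l hl⟩
    obtain ⟨l, hl, hs⟩ := Nat.sSup_mem hT hb
    exact ⟨l, hl, fun l' hl' => hs ▸ le_csSup hb ⟨l', hl', rfl⟩⟩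
  set W := Submodule.span ℂ (f '' S l) with hW
  -- Otherwise the step at `s` could be lengthened by one, against maximality.
  have hnext : ∀ s, f (s, l s) ∈ W := by
    intro s
    by_contra hs
    have h1 := hl.insert hs
    have h2 : insert (s, l s) (S l) = S (Function.update l s (l s + 1)) := by
      ext ⟨t, a⟩
      by_cases hts : t = s
      · subst hts
        simp only [S, Set.mem_insert_iff, Prod.mk.injEq, true_and, Set.mem_ofPred_eq,
          Function.update_self]
        omega
      · simp [S, hts]
    rw [h2] at h1
    have h3 := hmax _ h1
    rw [Finset.sum_update_of_mem (Finset.mem_univ s)] at h3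
    have h4 := Finset.add_sum_erase Finset.univ l (Finset.mem_univ s)
    rw [Finset.sdiff_singleton_eq_erase] at h3
    omega
  have hstep : ∀ s a, f (s, a + 1) = Matrix.vecMul (f (s, a)) Z := by
    intro s a
    have : Ψ * Z ^ (a + 1) = Ψ * Z ^ a * Z := by rw [pow_succ, Matrix.mul_assoc]
    simp only [f, this]; rfl
  -- Multiplication by `Z` moves a selected row to the next one, which is selected or just past the
  -- end of its step.
  have hinv : ∀ w ∈ W, Matrix.vecMul w Z ∈ W := by
    intro w hw
    induction hw using Submodule.span_induction with
    | mem x hx =>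
      obtain ⟨⟨s, a⟩, ha, rfl⟩ := hx
      rw [← hstep]
      by_cases h : a + 1 < l s
      · exact Submodule.subset_span ⟨(s, a + 1), h, rfl⟩
      · have ha' : a < l s := ha
        have : a + 1 = l s := by omega
        rw [this]; exact hnext s
    | zero => simp
    | add x y _ _ hx hy => rw [Matrix.add_vecMul]; exact W.add_mem hx hy
    | smul t x _ hx => rw [Matrix.smul_vecMul]; exact W.smul_mem t hx
  have hall : ∀ s a, f (s, a) ∈ W := by
    intro s a
    induction a with
    | zero =>
      by_cases h : 0 < l s
      · exact Submodule.subset_span ⟨(s, 0), h, rfl⟩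
      · have : l s = 0 := by omega
        rw [← this]; exact hnext s
    | succ a ih => rw [hstep]; exact hinv _ ih
  have htop : W = ⊤ := by
    by_contra hne
    obtain ⟨φ, hφ, hφW⟩ := Submodule.exists_le_ker_of_lt_top W (lt_top_iff_ne_top.2 hne)
    apply hφ
    -- A functional vanishing on all rows `Ψ Z ^ j` is a vector excluded by observability.
    have hv : (fun c => φ (Pi.single c 1)) = 0 := by
      apply hobs
      intro j
      funext s
      have h1 : φ (f (s, j)) = 0 := hφW (hall s j)
      rw [LinearMap.pi_apply_eq_sum_univ] at h1
      have h2 : ∀ i : κ, (fun j : κ => if i = j then (1 : ℂ) else 0) = Pi.single i 1 := by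
        intro i; funext j; simp [Pi.single_apply, eq_comm]
      simpa [Matrix.mulVec, dotProduct, f, h2] using h1
    ext c
    simpa using congrFun hv c
  have : Fintype (S l) := Fintype.ofEquiv _ (eS l).symm
  have hbas : Fintype.card κ = Fintype.card (S l) := by
    have h1 := Module.finrank_eq_card_basis (Module.Basis.mk hl (by
      rw [← htop, hW]
      exact Submodule.span_mono (by rintro _ ⟨p, hp, rfl⟩; exact ⟨⟨p, hp⟩, rfl⟩)))
    rw [← h1, Module.finrank_fintype_fun_eq_card]
  let e0 := Fintype.equivOfCardEq hbas
  refine ⟨l, e0.trans (eS l), ?_⟩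
  rw [← Matrix.isUnit_iff_isUnit_det, ← Matrix.linearIndependent_rows_iff_isUnit]
  exact hl.comp e0 e0.injective

theorem rowMat_conj (e' : κ → α × ℕ) (Ψ : Matrix α κ ℂ) (Z : Matrix κ κ ℂ) {A B : Matrix κ κ ℂ}
    (h : A * B = 1) : rowMat e' (Ψ * A) (B * Z * A) = rowMat e' Ψ Z * A := by
  have hpow : ∀ n : ℕ, A * (B * Z * A) ^ n = Z ^ n * A := by
    intro n
    induction n with
    | zero => simp
    | succ n ih =>
      rw [pow_succ, ← Matrix.mul_assoc, ih, pow_succ, Matrix.mul_assoc, ← Matrix.mul_assoc A,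
        ← Matrix.mul_assoc A, h, Matrix.one_mul, Matrix.mul_assoc]
  ext1 c d
  have : Ψ * A * (B * Z * A) ^ (e' c).2 = Ψ * Z ^ (e' c).2 * A := by
    rw [Matrix.mul_assoc, hpow, Matrix.mul_assoc]
  simp only [rowMat, Matrix.of_apply, this]
  rw [Matrix.mul_apply, Matrix.mul_apply]
  rfl

theorem mul_map_conj {D : Matrix α α ℂ[X]} {J : Matrix α κ ℂ[X]} {Ψ : Matrix α κ ℂ}
    {Z : Matrix κ κ ℂ} (hZ : D * Ψ.map C = J * Z.charmatrix) {A B : Matrix κ κ ℂ} (h : A * B = 1) :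
    D * (Ψ * A).map C = J * A.map C * (B * Z * A).charmatrix := by
  have hC : A.map C * B.map C = 1 := by
    rw [← Matrix.map_mul, h, Matrix.map_one _ C.map_zero C.map_one]
  rw [mul_charmatrix, Matrix.map_mul, ← Matrix.mul_assoc, hZ, mul_charmatrix, Matrix.sub_mul,
    Matrix.smul_mul, Matrix.map_mul, Matrix.map_mul, Matrix.mul_assoc (B.map C), Matrix.mul_assoc J,
    Matrix.mul_assoc J, ← Matrix.mul_assoc (A.map C), hC, Matrix.one_mul]

/-- The size of a solution basis is the degree of the determinant. -/
theorem IsSolutionBasis.degree_det {D : Matrix α α ℂ[X]} {J : Matrix α κ ℂ[X]} (hD : D.det ≠ 0)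
    (hJ : IsSolutionBasis D J) : D.det.degree = Fintype.card κ := by
  -- The pair of `D` is brought to normal form by a change of basis. The resulting normal form has
  -- determinant of degree `card κ` and differs from `D` by a unimodular factor.
  obtain ⟨Z, Ψ, hZ⟩ := hJ.exists_mul_eq hD
  obtain ⟨l, e, hu⟩ := (hJ.observable hD hZ).exists_stair
  rw [← Matrix.isUnit_iff_isUnit_det] at hu
  obtain ⟨g, hg⟩ := hu
  have hgg : g⁻¹.val * g.val = 1 := by rw [← Units.val_mul, inv_mul_cancel, Units.val_one]
  have h1 : rowMat (stair e) (Ψ * g⁻¹.val) (g.val * Z * g⁻¹.val) = 1 := by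
    rw [rowMat_conj _ _ _ hgg, ← hg, ← Units.val_mul, mul_inv_cancel, Units.val_one]
  obtain ⟨J', hJ'⟩ := exists_normalForm_mul_eq h1
  have hb := normalForm_isSolutionBasis h1 hJ'
  obtain ⟨hm, hd⟩ := normalForm_det e (Ψ * g⁻¹.val) (g.val * Z * g⁻¹.val)
  obtain ⟨V, hV, -⟩ := (hJ.mul_right hD g⁻¹).exists_generalLinear hD (mul_map_conj hZ hgg)
    hb hm.ne_zero hJ'
  have hV' : IsUnit V.val.det := (Matrix.isUnit_iff_isUnit_det _).1 V.isUnit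
  rw [← hd, ← degree_eq_natDegree hm.ne_zero, hV, Matrix.det_mul, degree_mul,
    degree_eq_zero_of_isUnit hV', zero_add]

end NormalForm

end VortexQuiver
end

noncomputable section

namespace VortexQuiver

/-! ### Blocks -/

/-- The first `m` of `m + 1` blocks. -/
def Col.castSucc {n : ℕ → ℕ} {m : ℕ} (c : Col n m) : Col n (m + 1) := ⟨⟨c.1, by omega⟩, c.2⟩

/-- The last of `m + 1` blocks. -/
def Col.last {n : ℕ → ℕ} {m : ℕ} (b : Fin (n m)) : Col n (m + 1) := ⟨⟨m, by omega⟩, b⟩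

theorem Col.cases {n : ℕ → ℕ} {m : ℕ} {p : Col n (m + 1) → Prop} (h1 : ∀ c, p (Col.castSucc c))
    (h2 : ∀ b, p (Col.last b)) (c : Col n (m + 1)) : p c := by
  obtain ⟨⟨j, hj⟩, b⟩ := c
  rcases Nat.lt_succ_iff_lt_or_eq.1 hj with h | h
  · exact h1 ⟨⟨j, h⟩, b⟩
  · subst h; exact h2 b

theorem Col.sum_univ {n : ℕ → ℕ} {m : ℕ} {R : Type*} [AddCommMonoid R] (f : Col n (m + 1) → R) :
    ∑ c, f c = ∑ c, f (Col.castSucc c) + ∑ b, f (Col.last b) := by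
  rw [Fintype.sum_sigma, Fin.sum_univ_castSucc, Fintype.sum_sigma]
  rfl

theorem Col.mul_eq {n : ℕ → ℕ} {m : ℕ} {R α β : Type*} [CommRing R]
    (A : Matrix α (Col n (m + 1)) R) (B : Matrix (Col n (m + 1)) β R) :
    A * B = A.submatrix id Col.castSucc * B.submatrix Col.castSucc id +
      A.submatrix id Col.last * B.submatrix Col.last id := by
  ext a b
  simp only [Matrix.mul_apply, Matrix.add_apply, Matrix.submatrix_apply, id]
  exact Col.sum_univ _

/-- The block `i` of the blocks `i, …, L - 1`. -/
def CoCol.first {n : ℕ → ℕ} {L i : ℕ} (hi : i < L) (b : Fin (n (i + 1))) : CoCol n L i :=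
  ⟨⟨⟨i, hi⟩, le_rfl⟩, b⟩

/-- The blocks `i + 1, …, L - 1` of the blocks `i, …, L - 1`. -/
def CoCol.next {n : ℕ → ℕ} {L i : ℕ} (c : CoCol n L (i + 1)) : CoCol n L i :=
  ⟨⟨c.1.1, (Nat.le_succ i).trans c.1.2⟩, c.2⟩

theorem CoCol.cases {n : ℕ → ℕ} {L i : ℕ} (hi : i < L) {p : CoCol n L i → Prop}
    (h1 : ∀ b, p (CoCol.first hi b)) (h2 : ∀ c, p (CoCol.next c)) (c : CoCol n L i) : p c := by
  obtain ⟨⟨⟨j, hj⟩, hij⟩, b⟩ := c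
  rcases Nat.eq_or_lt_of_le hij with h | h
  · have h' : i = j := h
    subst h'; exact h1 b
  · exact h2 ⟨⟨⟨j, hj⟩, h⟩, b⟩

variable {n k : ℕ → ℕ} {L : ℕ}

/-! ### The products `ξ` -/

theorem xi_self (q : QTuple n L) : xi q L le_rfl = 1 :=
  Nat.decreasingInduction_self _ _

theorem xi_eq_mul (q : QTuple n L) {m : ℕ} (h : m < L) :
    xi q m h.le = q ⟨m, h⟩ * xi q (m + 1) h :=
  Nat.decreasingInduction_succ_left _ _ h _

/-- The square part of `ξ_m` for `m ≤ L`. -/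
def sqPart (q : QTuple n L) (m : ℕ) (hm : m ≤ L) : Matrix (Col n (m + 1)) (Col n (m + 1)) ℂ[X] :=
  (xi q m hm).submatrix id (fun c => ⟨⟨c.1, by omega⟩, c.2⟩)

theorem sqPart_self (q : QTuple n L) : sqPart q L le_rfl = 1 := by
  rw [sqPart, xi_self]; rfl

/-- The square part of `ξ_{i+1}` has one block of columns more than that of `ξ_i = q_i ξ_{i+1}`. So
`q_i 𝔇_{i+1}` consists of `𝔇_i` and the first block of `𝔇̃_i`; working with `sqPart` includes the
last node, where the square part is the identity. -/
theorem mul_sqPart_left (q : QTuple n L) {i : ℕ} (h : i < L) :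
    (q ⟨i, h⟩ * sqPart q (i + 1) h).submatrix id Col.castSucc = frakD q ⟨i, h⟩ := by
  ext1 a b
  rw [frakD, xi_eq_mul q h]
  rfl

theorem mul_sqPart_right (q : QTuple n L) {i : ℕ} (h : i < L) :
    (q ⟨i, h⟩ * sqPart q (i + 1) h).submatrix id Col.last =
      (frakDt q ⟨i, h⟩).submatrix id (CoCol.first h) := by
  ext1 a b
  rw [frakDt, xi_eq_mul q h]
  rfl

theorem mul_frakDt (q : QTuple n L) {i : ℕ} (h : i + 1 < L) :
    q ⟨i, by omega⟩ * frakDt q ⟨i + 1, h⟩ =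
      (frakDt q ⟨i, by omega⟩).submatrix id CoCol.next := by
  ext1 a b
  rw [frakDt, frakDt, xi_eq_mul q (show i < L by omega)]
  rfl

theorem det_sqPart_ne_zero {q : QTuple n L} (hq : ∀ i, (frakD q i).det ≠ 0) (m : ℕ) (hm : m ≤ L) :
    (sqPart q m hm).det ≠ 0 := by
  rcases Nat.eq_or_lt_of_le hm with h | h
  · subst h; rw [sqPart_self, Matrix.det_one]; exact one_ne_zero
  · exact hq ⟨m, h⟩

theorem IsModuliMatrix.det_ne_zero {q : QTuple n L} (hq : IsModuliMatrix k q) (i : Fin L) :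
    (frakD q i).det ≠ 0 := by
  intro h
  have := hq.degree_det i
  rw [h, degree_zero] at this
  exact absurd this (by simp)

/-! ### The matrices `Ψ` and `Ψ̃` -/

namespace Data

theorem chain_self (d : Data n k L) {j : ℕ} (hj : j < L) : d.chain (le_refl j) hj = 1 := by
  rw [chain, Nat.leRec_self]

theorem chain_succ (d : Data n k L) {j i : ℕ} (h : j ≤ i) (hi : i + 1 < L) :
    d.chain (Nat.le_succ_of_le h) hi = d.chain h (by omega) * d.W ⟨i, by omega⟩ := by
  rw [chain, Nat.leRec_succ]
  rfl

theorem chain_eq_mul (d : Data n k L) {j i : ℕ} (h : j + 1 ≤ i) (hi : i < L) :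
    d.chain ((Nat.le_succ j).trans h) hi = d.W ⟨j, by omega⟩ * d.chain h hi := by
  induction i, h using Nat.le_induction with
  | base => rw [chain_succ d le_rfl, chain_self, chain_self, Matrix.one_mul, Matrix.mul_one]
  | succ i h ih =>
    rw [chain_succ d ((Nat.le_succ j).trans h), chain_succ d h, ih, Matrix.mul_assoc]

theorem Psi_last (d : Data n k L) {i : ℕ} (hi : i < L) :
    (d.Psi ⟨i, hi⟩).submatrix Col.last id = d.U ⟨i, hi⟩ := by
  ext a b
  change (d.U ⟨i, hi⟩ * d.chain (le_refl i) hi) a b = _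
  rw [chain_self, Matrix.mul_one]

theorem Psi_castSucc (d : Data n k L) {i : ℕ} (hi : i + 1 < L) :
    (d.Psi ⟨i + 1, hi⟩).submatrix Col.castSucc id =
      d.Psi ⟨i, by omega⟩ * d.W ⟨i, by omega⟩ := by
  ext a b
  have h : (a.1 : ℕ) ≤ i := Nat.lt_succ_iff.1 a.1.2
  change (d.U ⟨a.1, by omega⟩ * d.chain (Nat.le_succ_of_le h) hi) a.2 b = _
  rw [chain_succ d h, ← Matrix.mul_assoc]
  rfl

theorem Psit_first (d : Data n k L) {i : ℕ} (hi : i < L) :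
    (d.Psit ⟨i, hi⟩).submatrix id (CoCol.first hi) = d.Ut ⟨i, hi⟩ := by
  ext a b
  change (d.chain (le_refl i) hi * d.Ut ⟨i, hi⟩) a b = _
  rw [chain_self, Matrix.one_mul]

theorem Psit_next (d : Data n k L) {i : ℕ} (hi : i + 1 < L) :
    (d.Psit ⟨i, by omega⟩).submatrix id CoCol.next =
      d.W ⟨i, by omega⟩ * d.Psit ⟨i + 1, hi⟩ := by
  ext a b
  change (d.chain ((Nat.le_succ i).trans b.1.2) b.1.1.2 * d.Ut b.1.1) a b.2 = _
  rw [chain_eq_mul d b.1.2, Matrix.mul_assoc]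
  rfl

theorem constraint_nat {d : Data n k L} (h : d.Constraint) {i : ℕ} (hi : i + 1 < L) :
    d.Z ⟨i, by omega⟩ * d.W ⟨i, by omega⟩ - d.W ⟨i, by omega⟩ * d.Z ⟨i + 1, hi⟩ =
      d.Ut ⟨i, by omega⟩ * d.U ⟨i + 1, hi⟩ :=
  h ⟨i, by omega⟩

end Data

/-! ### The free condition -/

/-- Away from the eigenvalues the resolvent is `adj (z - Z) / χ_Z(z)`, so the condition concerns the
vanishing of a polynomial vector. -/
theorem forall_inv_mulVec_iff {α κ : Type} [Fintype κ] [DecidableEq κ] (Ψ : Matrix α κ ℂ)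
    (Z : Matrix κ κ ℂ) (v : κ → ℂ) :
    (∀ z : ℂ, IsUnit (Matrix.scalar κ z - Z).det →
      (Ψ * (Matrix.scalar κ z - Z)⁻¹).mulVec v = 0) ↔ ∀ j : ℕ, (Ψ * Z ^ j).mulVec v = 0 := by
  rw [← mul_adjugate_mulVec_eq_zero_iff]
  have hmap : ∀ z : ℂ, evalAt z Z.charmatrix = Matrix.scalar κ z - Z := by
    intro z
    ext a b
    rw [charmatrix_eq]
    by_cases h : a = b
    · subst h; simp [evalAt]
    · simp [evalAt, h]
  have hdet : ∀ z : ℂ, Z.charpoly.eval z = (Matrix.scalar κ z - Z).det := by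
    intro z
    rw [← hmap]
    exact (evalRingHom z).map_det _
  have hadj : ∀ z : ℂ, evalAt z Z.charmatrix.adjugate = (Matrix.scalar κ z - Z).adjugate := by
    intro z
    rw [← hmap]
    exact (evalRingHom z).map_adjugate _
  have key : ∀ z : ℂ, IsUnit (Matrix.scalar κ z - Z).det → ∀ a,
      ((Ψ.map C * Z.charmatrix.adjugate).mulVec (fun c => C (v c)) a).eval z =
        (Matrix.scalar κ z - Z).det * (Ψ * (Matrix.scalar κ z - Z)⁻¹).mulVec v a := by
    intro z hz a
    have h1 : (Matrix.scalar κ z - Z).adjugate =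
        (Matrix.scalar κ z - Z).det • (Matrix.scalar κ z - Z)⁻¹ := by
      rw [Matrix.inv_def, smul_smul, Ring.mul_inverse_cancel _ hz, one_smul]
    have h2 : ((Ψ.map C * Z.charmatrix.adjugate).mulVec (fun c => C (v c)) a).eval z =
        (Ψ * (Matrix.scalar κ z - Z).adjugate).mulVec v a := by
      rw [← hadj]
      simp [Matrix.mulVec, dotProduct, Matrix.mul_apply, eval_finsetSum, evalAt]
    rw [h2, h1, Matrix.mul_smul, Matrix.smul_mulVec]
    rfl
  constructor
  · intro h
    funext a
    -- The factor `χ_Z` makes the product vanish at the eigenvalues too, where nothing is assumed.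
    have h0 : Z.charpoly * ((Ψ.map C * Z.charmatrix.adjugate).mulVec (fun c => C (v c)) a) = 0 := by
      apply Polynomial.funext
      intro z
      rw [eval_mul, eval_zero, hdet]
      by_cases hz : (Matrix.scalar κ z - Z).det = 0
      · rw [hz, zero_mul]
      · rw [key z (isUnit_iff_ne_zero.2 hz), h z (isUnit_iff_ne_zero.2 hz)]; simp
    exact (mul_eq_zero.1 h0).resolve_left Z.charpoly_monic.ne_zero
  · intro h z hz
    funext a
    have := key z hz a
    rw [h, Pi.zero_apply, eval_zero] at this
    exact (mul_eq_zero.1 this.symm).resolve_left hz.ne_zero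

theorem Data.free_iff (d : Data n k L) : d.Free ↔ ∀ i, Observable (d.Psi i) (d.Z i) := by
  refine forall_congr' fun i => forall_congr' fun v => ?_
  rw [← forall_inv_mulVec_iff]
  refine imp_congr_left ⟨fun h z hz => ?_, fun h j hj z hz => ?_⟩
  · funext r
    exact congrFun (h r.1 (Nat.lt_succ_iff.1 r.1.2) z hz) r.2
  · funext r
    exact congrFun (h z hz) ⟨⟨j, Nat.lt_succ_iff.2 hj⟩, r⟩

/-! ### The mapping relation -/

namespace MappingRelation

variable {q : QTuple n L} {d : Data n k L}
  {J : (i : Fin L) → Matrix (Col n (i + 1)) (Fin (k i)) ℂ[X]}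

theorem mul_eq (h : MappingRelation q d J) (i : Fin L) :
    frakD q i * (d.Psi i).map C = J i * (d.Z i).charmatrix := h.square i

theorem map_submatrix_C {α β γ δ : Type} (M : Matrix α β ℂ) (f : γ → α) (g : δ → β) :
    (M.map C).submatrix f g = (M.submatrix f g).map C := rfl

/-- The intertwining relation `q_i J_{i+1} = J_i W_i`. -/
theorem mul_solutions (h : MappingRelation q d J) (hd : d.Constraint) {i : ℕ} (hi : i + 1 < L) :
    q ⟨i, by omega⟩ * J ⟨i + 1, hi⟩ = J ⟨i, by omega⟩ * (d.W ⟨i, by omega⟩).map C := by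
  -- After multiplication by `X - Z_{i+1}` the left side is `q_i 𝔇_{i+1} Ψ_{i+1} = 𝔇_i Ψ_i W_i + J_i
  -- Υ̃_i Υ_{i+1}`; the mapping relation and the constraint turn it into `J_i W_i (X - Z_{i+1})`.
  apply charmatrix_mul_right_cancel (Z := d.Z ⟨i + 1, hi⟩)
  have hi' : i < L := Nat.lt_of_succ_lt hi
  have e1 := mul_sqPart_left q hi'
  have e2 := mul_sqPart_right q hi'
  have e3 := h.mul_eq ⟨i, hi'⟩
  have e4 : (J ⟨i, hi'⟩ * (d.Psit ⟨i, hi'⟩).map C).submatrix id (CoCol.first hi') =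
      J ⟨i, hi'⟩ * ((d.Psit ⟨i, hi'⟩).submatrix id (CoCol.first hi')).map C := rfl
  rw [Matrix.mul_assoc, ← h.mul_eq, ← Matrix.mul_assoc,
    show frakD q ⟨i + 1, hi⟩ = sqPart q (i + 1) hi.le from rfl, Col.mul_eq, e1, e2,
    map_submatrix_C, map_submatrix_C, Data.Psi_last, Data.Psi_castSucc,
    Matrix.map_mul, ← Matrix.mul_assoc, e3, h.rest, e4,
    Data.Psit_first, Matrix.mul_assoc (J _) (Matrix.map _ _) (Matrix.map _ _), ← Matrix.map_mul,
    ← Data.constraint_nat hd hi, mul_charmatrix, mul_charmatrix, map_C_sub, Matrix.map_mul,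
    Matrix.map_mul, Matrix.sub_mul, Matrix.smul_mul, Matrix.mul_sub]
  simp only [Matrix.mul_assoc]
  abel

end MappingRelation

end VortexQuiver
end

noncomputable section

namespace VortexQuiver

variable {n k : ℕ → ℕ} {L : ℕ}

/-! ### From moduli matrices to half-ADHM data -/

/-- `𝔇_i⁻¹ q_i J = (𝔇_i⁻¹ q_i 𝔇_{i+1}) (𝔇_{i+1}⁻¹ J)` is a bounded factor times a strictly proper
one. -/
theorem strictlyProper_mul_solutions {q : QTuple n L} (hq : IsModuliMatrix k q) {i : ℕ}
    (hi : i + 1 < L) {κ : Type} [Fintype κ] {J : Matrix (Col n (i + 1 + 1)) κ ℂ[X]}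
    (hJ : StrictlyProper (frakD q ⟨i + 1, hi⟩) J) :
    StrictlyProper (frakD q ⟨i, Nat.lt_of_succ_lt hi⟩) (q ⟨i, Nat.lt_of_succ_lt hi⟩ * J) := by
  have hi' : i < L := Nat.lt_of_succ_lt hi
  set D := frakD q ⟨i, hi'⟩ with hDdef
  set D' := frakD q ⟨i + 1, hi⟩ with hD'def
  have hD : D.det ≠ 0 := hq.det_ne_zero _
  have hD' : D'.det ≠ 0 := hq.det_ne_zero _
  -- `𝔇_i⁻¹ q_i 𝔇_{i+1}` consists of the identity and a block of `𝔇_i⁻¹ 𝔇̃_i`, which decays by the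
  -- boundary condition.
  have hle : ∀ a c, ((D.adjugate * (q ⟨i, hi'⟩ * D')) a c).natDegree ≤ D.det.natDegree := by
    intro a c
    revert c
    refine Col.cases (fun c => ?_) (fun b => ?_)
    · have h1 : (D.adjugate * (q ⟨i, hi'⟩ * D')) a (Col.castSucc c) =
          (D.adjugate * (q ⟨i, hi'⟩ * sqPart q (i + 1) hi.le).submatrix id Col.castSucc) a c := rfl
      rw [h1, mul_sqPart_left, ← hDdef, Matrix.adjugate_mul, Matrix.smul_apply, Matrix.one_apply]
      split_ifs <;> simp
    · have h1 : (D.adjugate * (q ⟨i, hi'⟩ * D')) a (Col.last b) =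
          (D.adjugate * (q ⟨i, hi'⟩ * sqPart q (i + 1) hi.le).submatrix id Col.last) a b := rfl
      rw [h1, mul_sqPart_right]
      have h2 := (invMulIsBigO_iff hD _).1 (hq.asymptotic ⟨i, hi'⟩) a (CoCol.first hi' b)
      exact natDegree_le_natDegree h2.le
  have hprod : D'.det • (D.adjugate * (q ⟨i, hi'⟩ * J)) =
      (D.adjugate * (q ⟨i, hi'⟩ * D')) * (D'.adjugate * J) := by
    rw [Matrix.mul_assoc, Matrix.mul_assoc, ← Matrix.mul_assoc D', Matrix.mul_adjugate,
      Matrix.smul_mul, Matrix.one_mul, Matrix.mul_smul, Matrix.mul_smul]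
  rw [strictlyProper_iff_coeff hD'] at hJ
  intro a b
  have h1 : (D'.det * (D.adjugate * (q ⟨i, hi'⟩ * J)) a b).degree <
      (D'.det * D.det).degree := by
    have h2 := congrFun (congrFun hprod a) b
    rw [Matrix.smul_apply, smul_eq_mul] at h2
    rw [h2, degree_eq_natDegree (mul_ne_zero hD' hD), natDegree_mul hD' hD,
      degree_lt_iff_coeff_zero]
    intro m hm
    rw [Matrix.mul_apply, finsetSum_coeff]
    refine Finset.sum_eq_zero fun c _ => ?_
    rw [coeff_mul]
    refine Finset.sum_eq_zero fun x hx => ?_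
    rw [Finset.HasAntidiagonal.mem_antidiagonal] at hx
    by_cases hx1 : x.1 ≤ D.det.natDegree
    · rw [hJ c b x.2 (by omega), mul_zero]
    · rw [coeff_eq_zero_of_natDegree_lt (lt_of_le_of_lt (hle a c) (not_le.1 hx1)), zero_mul]
  rw [degree_mul, degree_mul] at h1
  exact lt_of_add_lt_add_left h1

/-- The mapping relation follows from the defining relations of the individual matrices. -/
theorem MappingRelation.of_relations {q : QTuple n L} (hq : ∀ i, (frakD q i).det ≠ 0)
    {d : Data n k L} {J : (i : Fin L) → Matrix (Col n (i + 1)) (Fin (k i)) ℂ[X]}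
    {Ψ : (i : Fin L) → Matrix (Col n (i + 1)) (Fin (k i)) ℂ}
    {Ψt : (i : Fin L) → Matrix (Fin (k i)) (CoCol n L i) ℂ}
    (hJ : ∀ i, IsSolutionBasis (frakD q i) (J i))
    (hΨ : ∀ i, frakD q i * (Ψ i).map C = J i * (d.Z i).charmatrix)
    (hΨt : ∀ i, frakDt q i = J i * (Ψt i).map C)
    (hU : ∀ i, d.U i = (Ψ i).submatrix Col.last id)
    (hUt : ∀ i : Fin L, d.Ut i = (Ψt i).submatrix id (CoCol.first i.2))
    (hW : ∀ i (hi : i + 1 < L), q ⟨i, Nat.lt_of_succ_lt hi⟩ * J ⟨i + 1, hi⟩ =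
      J ⟨i, Nat.lt_of_succ_lt hi⟩ * (d.W ⟨i, by omega⟩).map C) :
    MappingRelation q d J ∧ d.Constraint ∧ d.Free := by
  -- Both expressions for `q_i 𝔇_{i+1} Ψ_{i+1}` are compared. The strictly proper part is the
  -- constraint; the multiple of `𝔇_i` says that the upper blocks of `Ψ_{i+1}` are `Ψ_i W_i`.
  have key : ∀ i (hi : i + 1 < L),
      d.Z ⟨i, Nat.lt_of_succ_lt hi⟩ * d.W ⟨i, by omega⟩ - d.W ⟨i, by omega⟩ * d.Z ⟨i + 1, hi⟩ -
        d.Ut ⟨i, Nat.lt_of_succ_lt hi⟩ * d.U ⟨i + 1, hi⟩ = 0 ∧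
      ((Ψ ⟨i + 1, hi⟩).submatrix Col.castSucc id -
        Ψ ⟨i, Nat.lt_of_succ_lt hi⟩ * d.W ⟨i, by omega⟩).map C = 0 := by
    intro i hi
    have hi' : i < L := Nat.lt_of_succ_lt hi
    apply (hJ ⟨i, hi'⟩).eq_zero_of_eq (hq _)
    have h1 : q ⟨i, hi'⟩ * (frakD q ⟨i + 1, hi⟩ * (Ψ ⟨i + 1, hi⟩).map C) =
        q ⟨i, hi'⟩ * (J ⟨i + 1, hi⟩ * (d.Z ⟨i + 1, hi⟩).charmatrix) := by rw [hΨ]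
    have e4 : (J ⟨i, hi'⟩ * (Ψt ⟨i, hi'⟩).map C).submatrix id (CoCol.first hi') =
        J ⟨i, hi'⟩ * ((Ψt ⟨i, hi'⟩).submatrix id (CoCol.first hi')).map C := rfl
    rw [← Matrix.mul_assoc, ← Matrix.mul_assoc, hW i hi,
      show frakD q ⟨i + 1, hi⟩ = sqPart q (i + 1) hi.le from rfl, Col.mul_eq,
      mul_sqPart_left q hi', mul_sqPart_right q hi', hΨt, e4, MappingRelation.map_submatrix_C,
      MappingRelation.map_submatrix_C, mul_charmatrix] at h1
    have h2 := hΨ ⟨i, hi'⟩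
    rw [mul_charmatrix] at h2
    have hiW : i < L - 1 := by omega
    have h3 : frakD q ⟨i, hi'⟩ * (Ψ ⟨i, hi'⟩).map C * (d.W ⟨i, hiW⟩).map C =
        ((X : ℂ[X]) • J ⟨i, hi'⟩ - J ⟨i, hi'⟩ * (d.Z ⟨i, hi'⟩).map C) *
          (d.W ⟨i, hiW⟩).map C := by
      rw [h2]
    rw [map_C_sub, Matrix.mul_sub, map_C_sub, map_C_sub, Matrix.mul_sub, Matrix.mul_sub,
      Matrix.map_mul, Matrix.map_mul, Matrix.map_mul, Matrix.map_mul, hU, hUt]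
    rw [Matrix.sub_mul, Matrix.smul_mul] at h3
    rw [← eq_sub_iff_add_eq] at h1
    rw [h1]
    simp only [Matrix.mul_assoc] at h3 ⊢
    rw [h3]
    abel
  -- The blocks of `Ψ` are built up from the first node, those of `Ψ̃` down from the last one.
  have hPsi : ∀ i (hi : i < L), d.Psi ⟨i, hi⟩ = Ψ ⟨i, hi⟩ := by
    intro i
    induction i with
    | zero =>
      intro hi
      ext1 c b
      revert c
      refine Col.cases (fun c => absurd c.1.2 (by simp)) fun b' => ?_
      have := congrFun (congrFun (d.Psi_last hi) b') b
      rw [hU] at this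
      exact this
    | succ i ih =>
      intro hi
      ext1 c b
      revert c
      refine Col.cases (fun c => ?_) fun b' => ?_
      · have h1 := congrFun (congrFun (d.Psi_castSucc hi) c) b
        rw [ih] at h1
        have h2 := congrFun (congrFun (key i hi).2 c) b
        rw [Matrix.map_apply, Matrix.zero_apply, C_eq_zero, Matrix.sub_apply, sub_eq_zero] at h2
        exact h1.trans h2.symm
      · have := congrFun (congrFun (d.Psi_last hi) b') b
        rw [hU] at this
        exact this
  have hPsit : ∀ m i (hi : i < L), L ≤ i + m → d.Psit ⟨i, hi⟩ = Ψt ⟨i, hi⟩ := by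
    intro m
    induction m with
    | zero => intro i hi h; omega
    | succ m ih =>
      intro i hi h
      ext1 a c
      revert c
      refine CoCol.cases hi (fun b => ?_) fun c => ?_
      · have := congrFun (congrFun (d.Psit_first hi) a) b
        rw [hUt] at this
        exact this
      · have hi1 : i + 1 < L := lt_of_le_of_lt c.1.2 c.1.1.2
        have h1 := congrFun (congrFun (d.Psit_next hi1) a) c
        have h2 := mul_frakDt q hi1
        rw [hΨt, hΨt, ← Matrix.mul_assoc, hW i hi1, ← ih (i + 1) hi1 (by omega), Matrix.mul_assoc,
          ← Matrix.map_mul] at h2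
        have h3 : d.W ⟨i, by omega⟩ * d.Psit ⟨i + 1, hi1⟩ =
            (Ψt ⟨i, hi⟩).submatrix id CoCol.next := (hJ ⟨i, hi⟩).cancel h2
        rw [h3] at h1
        exact h1
  refine ⟨⟨hJ, fun i => ?_, fun i => ?_⟩, fun i => ?_, d.free_iff.2 fun i => ?_⟩
  · have := hΨ i
    rw [← hPsi i i.2] at this
    exact this
  · rw [hΨt i, ← hPsit L i i.2 (by omega)]
  · exact sub_eq_zero.1 (key i (by omega)).1
  · have := (hJ i).observable (hq i) (hΨ i)
    rwa [← hPsi i i.2] at this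

theorem IsModuliMatrix.exists_basis {q : QTuple n L} (hq : IsModuliMatrix k q) (i : Fin L) :
    ∃ J : Matrix (Col n (i + 1)) (Fin (k i)) ℂ[X], IsSolutionBasis (frakD q i) J := by
  obtain ⟨s, J, hJ⟩ := exists_isSolutionBasis (frakD q i) (hq.det_ne_zero i)
  have h := hJ.degree_det (hq.det_ne_zero i)
  rw [hq.degree_det, Fintype.card_fin] at h
  have hs : k i = s := by exact_mod_cast h
  subst hs
  exact ⟨J, hJ⟩

theorem IsModuliMatrix.exists_data {q : QTuple n L} (hq : IsModuliMatrix k q) :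
    ∃ (d : HalfADHM n k L) (J : _), MappingRelation q d.1 J := by
  choose J hJ using hq.exists_basis
  choose Z Ψ hΨ using fun i => (hJ i).exists_mul_eq (hq.det_ne_zero i)
  choose Ψt hΨt using fun i => (hJ i).exists_eq (hq.det_ne_zero i)
    ((invMulIsBigO_iff (hq.det_ne_zero i) _).1 (hq.asymptotic i))
  have hW' : ∀ i : Fin (L - 1), ∃ W : Matrix (Fin (k i)) (Fin (k (i + 1))) ℂ,
      q ⟨i, by omega⟩ * J ⟨i + 1, by omega⟩ = J ⟨i, by omega⟩ * W.map C := fun i =>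
    (hJ ⟨i, by omega⟩).exists_eq (hq.det_ne_zero _) (strictlyProper_mul_solutions hq (by omega)
      ((hJ ⟨i + 1, by omega⟩).strictlyProper (hq.det_ne_zero _)))
  choose W hW using hW'
  let d : Data n k L := ⟨Z, fun i => (Ψ i).submatrix Col.last id,
    fun i => (Ψt i).submatrix id (CoCol.first i.2), W⟩
  obtain ⟨h1, h2, h3⟩ := MappingRelation.of_relations hq.det_ne_zero (d := d) hJ hΨ hΨt
    (fun _ => rfl) (fun _ => rfl) (fun i hi => hW ⟨i, by omega⟩)
  exact ⟨⟨d, h2, h3⟩, J, h1⟩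

/-! ### Invariance -/

namespace Data

theorem inv_mul_val (g : Gauge k L) (i : Fin L) : (g i)⁻¹.val * (g i).val = 1 := by
  rw [← Units.val_mul, inv_mul_cancel, Units.val_one]

theorem mul_inv_val (g : Gauge k L) (i : Fin L) : (g i).val * (g i)⁻¹.val = 1 := by
  rw [← Units.val_mul, mul_inv_cancel, Units.val_one]

theorem conj_mul_conj {α β γ δ ε : Type} [Fintype β] [Fintype γ] [DecidableEq γ] [Fintype δ]
    {A A' : Matrix γ γ ℂ} (h : A * A' = 1) (B : Matrix α β ℂ) (P : Matrix β γ ℂ)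
    (Q : Matrix γ δ ℂ) (R : Matrix δ ε ℂ) : B * P * A * (A' * Q * R) = B * (P * Q) * R := by
  rw [Matrix.mul_assoc (B * P), ← Matrix.mul_assoc A, ← Matrix.mul_assoc A, h, Matrix.one_mul]
  simp only [Matrix.mul_assoc]

theorem act_chain (d : Data n k L) (g : Gauge k L) {j i : ℕ} (h : j ≤ i) (hi : i < L) :
    (d.act g).chain h hi =
      (g ⟨j, lt_of_le_of_lt h hi⟩)⁻¹.val * d.chain h hi * (g ⟨i, hi⟩).val := by
  induction i, h using Nat.le_induction with
  | base => rw [chain_self, chain_self, Matrix.mul_one, inv_mul_val]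
  | succ i h ih =>
    rw [chain_succ _ h, chain_succ _ h, ih (Nat.lt_of_succ_lt hi)]
    exact conj_mul_conj (mul_inv_val g ⟨i, Nat.lt_of_succ_lt hi⟩) _ _ _ _

theorem act_Psi (d : Data n k L) (g : Gauge k L) (i : Fin L) :
    (d.act g).Psi i = d.Psi i * (g i).val := by
  ext r c
  have h : (r.1 : ℕ) ≤ i := Nat.lt_succ_iff.1 r.1.2
  have hr : (r.1 : ℕ) < L := lt_of_le_of_lt h i.2
  change (d.U ⟨r.1, hr⟩ * (g ⟨r.1, hr⟩).val * (d.act g).chain h i.2) r.2 c =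
    (d.U ⟨r.1, hr⟩ * d.chain h i.2 * (g i).val) r.2 c
  rw [act_chain, Matrix.mul_assoc (d.U _), ← Matrix.mul_assoc (g _).val,
    ← Matrix.mul_assoc (g _).val, mul_inv_val, Matrix.one_mul, Matrix.mul_assoc (d.U _)]

theorem act_Psit (d : Data n k L) (g : Gauge k L) (i : Fin L) :
    (d.act g).Psit i = (g i)⁻¹.val * d.Psit i := by
  ext r c
  change ((d.act g).chain c.1.2 c.1.1.2 * ((g c.1.1)⁻¹.val * d.Ut c.1.1)) r c.2 =
    ((g i)⁻¹.val * (d.chain c.1.2 c.1.1.2 * d.Ut c.1.1)) r c.2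
  rw [act_chain, Matrix.mul_assoc _ (g _).val, ← Matrix.mul_assoc (g _).val, mul_inv_val,
    Matrix.one_mul, Matrix.mul_assoc]

theorem Constraint.act {d : Data n k L} (h : d.Constraint) (g : Gauge k L) :
    (d.act g).Constraint := by
  intro i
  have h1 := h i
  have hi : (i : ℕ) < L := by omega
  have hi' : (i : ℕ) + 1 < L := by omega
  have e1 : (d.act g).Z ⟨i, hi⟩ * (d.act g).W i =
      (g ⟨i, hi⟩)⁻¹.val * (d.Z ⟨i, hi⟩ * d.W i) * (g ⟨i + 1, hi'⟩).val :=
    conj_mul_conj (mul_inv_val g ⟨i, hi⟩) _ _ _ _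
  have e2 : (d.act g).W i * (d.act g).Z ⟨i + 1, hi'⟩ =
      (g ⟨i, hi⟩)⁻¹.val * (d.W i * d.Z ⟨i + 1, hi'⟩) * (g ⟨i + 1, hi'⟩).val :=
    conj_mul_conj (mul_inv_val g ⟨i + 1, hi'⟩) _ _ _ _
  rw [e1, e2, ← Matrix.sub_mul, ← Matrix.mul_sub, h1]
  change _ = ((g ⟨i, hi⟩)⁻¹.val * d.Ut ⟨i, hi⟩) * (d.U ⟨i + 1, hi'⟩ * (g ⟨i + 1, hi'⟩).val)
  simp only [Matrix.mul_assoc]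

end Data

theorem Observable.conj {α κ : Type} [Fintype κ] [DecidableEq κ] {Ψ : Matrix α κ ℂ}
    {Z : Matrix κ κ ℂ} (h : Observable Ψ Z) {A B : Matrix κ κ ℂ} (hAB : A * B = 1)
    (hBA : B * A = 1) : Observable (Ψ * A) (B * Z * A) := by
  have hpow : ∀ n : ℕ, A * (B * Z * A) ^ n = Z ^ n * A := by
    intro n
    induction n with
    | zero => simp
    | succ n ih =>
      rw [pow_succ, ← Matrix.mul_assoc, ih, pow_succ, Matrix.mul_assoc, ← Matrix.mul_assoc A,
        ← Matrix.mul_assoc A, hAB, Matrix.one_mul, Matrix.mul_assoc]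
  intro v hv
  have h1 : A.mulVec v = 0 := h _ fun j => by
    have := hv j
    rwa [Matrix.mul_assoc, hpow, ← Matrix.mul_assoc, ← Matrix.mulVec_mulVec] at this
  have h2 : (B * A).mulVec v = 0 := by rw [← Matrix.mulVec_mulVec, h1, Matrix.mulVec_zero]
  rwa [hBA, Matrix.one_mulVec] at h2

theorem Data.Free.act {d : Data n k L} (h : d.Free) (g : Data.Gauge k L) : (d.act g).Free := by
  rw [Data.free_iff] at *
  intro i
  rw [Data.act_Psi]
  exact (h i).conj (Data.mul_inv_val g i) (Data.inv_mul_val g i)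

/-- The gauge action on half-ADHM data. -/
def HalfADHM.act (d : HalfADHM n k L) (g : Data.Gauge k L) : HalfADHM n k L :=
  ⟨d.1.act g, d.2.1.act g, d.2.2.act g⟩

theorem MappingRelation.act {q : QTuple n L} (hq : ∀ i, (frakD q i).det ≠ 0) {d : Data n k L}
    {J : (i : Fin L) → Matrix (Col n (i + 1)) (Fin (k i)) ℂ[X]} (h : MappingRelation q d J)
    (g : Data.Gauge k L) : MappingRelation q (d.act g) (fun i => J i * (g i).val.map C) := by
  refine ⟨fun i => (h.basis i).mul_right (hq i) (g i), fun i => ?_, fun i => ?_⟩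
  · rw [Data.act_Psi]
    exact mul_map_conj (h.mul_eq i) (Data.mul_inv_val g i)
  · rw [h.rest, Data.act_Psit, Matrix.mul_assoc, ← Matrix.map_mul, ← Matrix.mul_assoc,
      Data.mul_inv_val, Matrix.one_mul]

theorem xi_vAct (V : VGroup n L) (q : QTuple n L) (m : ℕ) (hm : m ≤ L) :
    xi (vAct V q) m hm = (vExt V m).val * xi q m hm := by
  induction hm using Nat.decreasingInduction with
  | self => rw [xi_self, xi_self]; simp [vExt]
  | of_succ m hm ih =>
    rw [xi_eq_mul _ hm, xi_eq_mul _ hm, ih]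
    change (vExt V m).val * q ⟨m, hm⟩ * ((vExt V (m + 1))⁻¹).val * _ = _
    rw [Matrix.mul_assoc, ← Matrix.mul_assoc ((vExt V (m + 1))⁻¹).val, ← Units.val_mul, inv_mul_cancel,
      Units.val_one, Matrix.one_mul, Matrix.mul_assoc]

theorem vExt_fin (V : VGroup n L) (i : Fin L) : vExt V i = V i := by
  rw [vExt, dif_pos i.2]

theorem frakD_vAct (V : VGroup n L) (q : QTuple n L) (i : Fin L) :
    frakD (vAct V q) i = (V i).val * frakD q i := by
  rw [frakD, xi_vAct, vExt_fin]; rfl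

theorem frakDt_vAct (V : VGroup n L) (q : QTuple n L) (i : Fin L) :
    frakDt (vAct V q) i = (V i).val * frakDt q i := by
  rw [frakDt, xi_vAct, vExt_fin]; rfl

theorem MappingRelation.vAct {q : QTuple n L} (hq : ∀ i, (frakD q i).det ≠ 0) {d : Data n k L}
    {J : (i : Fin L) → Matrix (Col n (i + 1)) (Fin (k i)) ℂ[X]} (h : MappingRelation q d J)
    (V : VGroup n L) : MappingRelation (vAct V q) d (fun i => (V i).val * J i) := by
  refine ⟨fun i => ?_, fun i => ?_, fun i => ?_⟩
  · rw [frakD_vAct]; exact (h.basis i).mul_left (hq i) (V i)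
  · rw [frakD_vAct, Matrix.mul_assoc, h.square, Matrix.mul_assoc]
  · rw [frakDt_vAct, h.rest, Matrix.mul_assoc]

/-! ### Uniqueness -/

/-- The two solution bases differ by some `g`. Once they coincide, `Z` and `Ψ` are fixed by
uniqueness of division, `Ψ̃` by independence of the columns, and `W` by the intertwining relation;
`Υ` and `Υ̃` are blocks of `Ψ` and `Ψ̃`. -/
theorem MappingRelation.exists_gauge {q : QTuple n L} (hq : ∀ i, (frakD q i).det ≠ 0)
    {d d' : Data n k L} {J J' : (i : Fin L) → Matrix (Col n (i + 1)) (Fin (k i)) ℂ[X]}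
    (h : MappingRelation q d J) (h' : MappingRelation q d' J') (hd : d.Constraint)
    (hd' : d'.Constraint) : ∃ g : Data.Gauge k L, d' = d.act g := by
  choose g hg using fun i => (h.basis i).exists_mul_invertible (h'.basis i) (hq i)
  have h1 := h.act hq g
  have hJ : (fun i => J i * (g i).val.map C) = J' := funext fun i => (hg i).symm
  rw [hJ] at h1
  have hsq : ∀ i, d'.Z i = (d.act g).Z i ∧ d'.Psi i = (d.act g).Psi i := by
    intro i
    have e1 := h1.mul_eq i
    have e2 := h'.mul_eq i
    rw [mul_charmatrix] at e1 e2
    have e3 : J' i * (d'.Z i - (d.act g).Z i).map C =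
        frakD q i * ((d.act g).Psi i - d'.Psi i).map C := by
      rw [map_C_sub, map_C_sub, Matrix.mul_sub, Matrix.mul_sub, e1, e2]; abel
    obtain ⟨e4, e5⟩ := (h'.basis i).eq_zero_of_eq (hq i) e3
    refine ⟨sub_eq_zero.1 e4, ?_⟩
    ext a b
    have := congrFun (congrFun e5 a) b
    rw [Matrix.map_apply, Matrix.zero_apply, C_eq_zero, Matrix.sub_apply, sub_eq_zero] at this
    exact this.symm
  have hre : ∀ i, d'.Psit i = (d.act g).Psit i := fun i =>
    (h'.basis i).cancel (by rw [← h'.rest, ← h1.rest])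
  refine ⟨g, ?_⟩
  ext1
  · exact funext fun i => (hsq i).1
  · funext i
    rw [← Data.Psi_last d' i.2, ← Data.Psi_last (d.act g) i.2, (hsq _).2]
  · funext i
    rw [← Data.Psit_first d' i.2, ← Data.Psit_first (d.act g) i.2, hre]
  · funext i
    apply (h'.basis ⟨i, by omega⟩).cancel
    have e1 := h'.mul_solutions hd' (i := i) (by omega)
    have e2 := h1.mul_solutions (hd.act g) (i := i) (by omega)
    exact e1.symm.trans e2

/-- The common pair `(Ψ_i, Z_i)` gives `𝔇'_i = V_i 𝔇_i` and `J'_i = V_i J_i`, hence `𝔇̃'_i = V_i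
𝔇̃_i`. The equation `q'_i V_{i+1} = V_i q_i` can be tested after right multiplication by the square
part of `ξ_{i+1}`, where it reduces to these identities. -/
theorem MappingRelation.exists_vAct {q q' : QTuple n L} (hq : ∀ i, (frakD q i).det ≠ 0)
    (hq' : ∀ i, (frakD q' i).det ≠ 0)
    {d : Data n k L} {J J' : (i : Fin L) → Matrix (Col n (i + 1)) (Fin (k i)) ℂ[X]}
    (h : MappingRelation q d J) (h' : MappingRelation q' d J') :
    ∃ V : VGroup n L, q' = VortexQuiver.vAct V q := by
  choose V hV hVJ using fun i => (h.basis i).exists_generalLinear (hq i) (h.mul_eq i)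
    (h'.basis i) (hq' i) (h'.mul_eq i)
  have hrest : ∀ i, frakDt q' i = (V i).val * frakDt q i := by
    intro i
    rw [h'.rest, h.rest, hVJ, Matrix.mul_assoc]
  have hsq : ∀ m (hm : m ≤ L), sqPart q' m hm = (vExt V m).val * sqPart q m hm := by
    intro m hm
    rcases Nat.eq_or_lt_of_le hm with h | h
    · subst h; rw [sqPart_self, sqPart_self]; simp [vExt]
    · have := hV ⟨m, h⟩
      rwa [← vExt_fin V] at this
  refine ⟨V, funext fun i => ?_⟩
  have h0 := det_sqPart_ne_zero hq (i + 1) i.2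
  have h1 : q' i * (vExt V (i + 1)).val = (vExt V i).val * q i := by
    apply mul_right_cancel_of_det h0
    rw [Matrix.mul_assoc, ← hsq, Matrix.mul_assoc]
    ext1 a c
    revert c
    refine Col.cases (fun c => ?_) (fun b => ?_)
    · have e1 := congrFun (congrFun (mul_sqPart_left q' i.2) a) c
      have e2 : ((V i).val * (q i * sqPart q (i + 1) i.2).submatrix id Col.castSucc) a c =
          ((V i).val * frakD q i) a c := by rw [mul_sqPart_left q i.2]
      rw [vExt_fin]
      have e3 := congrFun (congrFun (hV i) a) c
      exact e1.trans (e3.trans e2.symm)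
    · have e1 := congrFun (congrFun (mul_sqPart_right q' i.2) a) b
      have e2 : ((V i).val * (q i * sqPart q (i + 1) i.2).submatrix id Col.last) a b =
          ((V i).val * (frakDt q i).submatrix id (CoCol.first i.2)) a b := by
        rw [mul_sqPart_right q i.2]
      rw [vExt_fin]
      have e3 := congrFun (congrFun (hrest i) a) (CoCol.first i.2 b)
      exact e1.trans (e3.trans e2.symm)
  change q' i = (vExt V i).val * q i * ((vExt V (i + 1))⁻¹).val
  rw [← h1, Matrix.mul_assoc, ← Units.val_mul, mul_inv_cancel, Units.val_one, Matrix.mul_one]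

end VortexQuiver
end

noncomputable section

namespace VortexQuiver

variable {n k : ℕ → ℕ} {L : ℕ}

/-! ### From half-ADHM data to moduli matrices -/

/-- The quotient `P Q⁻¹`, when it is polynomial and `det Q` is monic. -/
def rightDiv {α β : Type} [Fintype β] [DecidableEq β] (P : Matrix α β ℂ[X]) (Q : Matrix β β ℂ[X]) :
    Matrix α β ℂ[X] :=
  (P * Q.adjugate).map (· /ₘ Q.det)

theorem rightDiv_mul {α β : Type} [Fintype β] [DecidableEq β] (T : Matrix α β ℂ[X])
    {Q : Matrix β β ℂ[X]} (hQ : Q.det.Monic) : rightDiv (T * Q) Q = T := by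
  ext1 a b
  rw [rightDiv, Matrix.map_apply, Matrix.mul_assoc, Matrix.mul_adjugate, Matrix.mul_smul,
    Matrix.mul_one, Matrix.smul_apply, smul_eq_mul, mul_divByMonic_cancel_left _ hQ]

/-- A choice, at every node, of a staircase of rows of `Ψ_i, Ψ_i Z_i, Ψ_i Z_i ^ 2, …`. -/
abbrev Staircase (n k : ℕ → ℕ) (L : ℕ) : Type :=
  (i : Fin L) → (l : Col n (i + 1) → ℕ) × (Fin (k i) ≃ (s : Col n (i + 1)) × Fin (l s))

/-- The rows selected by a staircase at the node `i`. -/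
def Staircase.rows (S : Staircase n k L) (i : Fin L) : Fin (k i) → Col n (i + 1) × ℕ :=
  stair (S i).2

namespace Data

/-- The frame at the node `i` formed by selected rows of `Ψ_i Z_i ^ a`. -/
def frame (d : Data n k L) (e : (i : Fin L) → Fin (k i) → Col n (i + 1) × ℕ) (i : Fin L) :
    Matrix (Fin (k i)) (Fin (k i)) ℂ :=
  rowMat (e i) (d.Psi i) (d.Z i)

theorem frame_act (d : Data n k L) (e : (i : Fin L) → Fin (k i) → Col n (i + 1) × ℕ)
    (g : Gauge k L) (i : Fin L) : (d.act g).frame e i = d.frame e i * (g i).val := by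
  rw [frame, act_Psi]
  exact rowMat_conj _ _ _ (mul_inv_val g i)

variable (S : Staircase n k L) (d : Data n k L)

/-- The matrix `𝔇_i` determined by data that are normalized with respect to a staircase. -/
def dMat (i : Fin L) : Matrix (Col n (i + 1)) (Col n (i + 1)) ℂ[X] :=
  normalForm (S i).2 (d.Psi i) (d.Z i)

/-- The solutions belonging to `dMat`. -/
def jMat (i : Fin L) : Matrix (Col n (i + 1)) (Fin (k i)) ℂ[X] :=
  rightDiv (d.dMat S i * (d.Psi i).map C) (d.Z i).charmatrix

/-- The matrices `dMat` completed by the identity matrix. -/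
def dMatExt (m : ℕ) : Matrix (Col n (m + 1)) (Col n (m + 1)) ℂ[X] :=
  if h : m < L then d.dMat S ⟨m, h⟩ else 1

/-- The matrix `(𝔇_i, 𝔍_i Υ̃_i)`. -/
def dExtMat (i : Fin L) : Matrix (Col n (i + 1)) (Col n (i + 2)) ℂ[X] := fun r c =>
  if h : (c.1 : ℕ) < i + 1 then d.dMat S i r ⟨⟨c.1, h⟩, c.2⟩ else
    -- Here the block index can only be `i + 1`, which justifies the cast.
    (d.jMat S i * (d.Ut i).map C) r (Fin.cast (by congr; omega) c.2)

/-- The tuple of matrices determined by normalized data. -/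
def toQ : QTuple n L := fun i => rightDiv (d.dExtMat S i) (d.dMatExt S (i + 1))

theorem dExtMat_castSucc (i : Fin L) :
    (d.dExtMat S i).submatrix id Col.castSucc = d.dMat S i := by
  ext1 r c
  have h : ((Col.castSucc c).1 : ℕ) < i + 1 := c.1.2
  rw [Matrix.submatrix_apply, dExtMat, dif_pos h]
  rfl

theorem dExtMat_last (i : Fin L) :
    (d.dExtMat S i).submatrix id Col.last = d.jMat S i * (d.Ut i).map C := by
  ext1 r b
  have h : ¬ ((Col.last b : Col n (i + 1 + 1)).1 : ℕ) < i + 1 := lt_irrefl _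
  rw [Matrix.submatrix_apply, dExtMat, dif_neg h]
  rfl

variable {S d}

theorem dMat_det (i : Fin L) :
    (d.dMat S i).det.Monic ∧ (d.dMat S i).det.natDegree = k i := by
  have := normalForm_det (S i).2 (d.Psi i) (d.Z i)
  rwa [Fintype.card_fin] at this

theorem dMatExt_det (m : ℕ) : (d.dMatExt S m).det.Monic := by
  rw [dMatExt]
  split_ifs with h
  · exact (dMat_det _).1
  · rw [Matrix.det_one]; exact monic_one

theorem dMat_mul (h : ∀ i, d.frame S.rows i = 1) (i : Fin L) :
    d.dMat S i * (d.Psi i).map C = d.jMat S i * (d.Z i).charmatrix := by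
  obtain ⟨J, hJ⟩ := exists_normalForm_mul_eq (h i)
  have h1 : d.jMat S i = J := by
    rw [jMat, dMat, hJ, rightDiv_mul _ (d.Z i).charpoly_monic]
  rw [h1, dMat, hJ]

theorem dMat_basis (h : ∀ i, d.frame S.rows i = 1) (i : Fin L) :
    IsSolutionBasis (d.dMat S i) (d.jMat S i) :=
  normalForm_isSolutionBasis (h i) (dMat_mul h i)

/-- By the constraint, `(𝔇_i, J_i Υ̃_i) Ψ_{i+1} = J_i W_i (X - Z_{i+1})`. The divisibility criterion
then supplies `T` with `T 𝔇_{i+1} = (𝔇_i, J_i Υ̃_i)` and `T J_{i+1} = J_i W_i`, and the explicit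
right division recovers this `T`. At the last node the divisor is the identity. -/
theorem toQ_mul (h : ∀ i, d.frame S.rows i = 1) (hd : d.Constraint) (i : Fin L) :
    d.toQ S i * d.dMatExt S (i + 1) = d.dExtMat S i ∧
      ∀ hi : (i : ℕ) + 1 < L, d.toQ S i * d.jMat S ⟨i + 1, hi⟩ =
        d.jMat S i * (d.W ⟨i, by omega⟩).map C := by
  by_cases hi : (i : ℕ) + 1 < L
  · have hiW : (i : ℕ) < L - 1 := by omega
    have h1 : d.dMatExt S (i + 1) = d.dMat S ⟨i + 1, hi⟩ := dif_pos hi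
    have h2 : d.dExtMat S i * (d.Psi ⟨i + 1, hi⟩).map C =
        d.jMat S i * (d.W ⟨i, hiW⟩).map C * (d.Z ⟨i + 1, hi⟩).charmatrix := by
      rw [Col.mul_eq, dExtMat_castSucc, dExtMat_last, MappingRelation.map_submatrix_C,
        MappingRelation.map_submatrix_C, Psi_last d hi, Psi_castSucc d hi]
      have h4 := dMat_mul h i
      have h5 : d.dMat S i * (d.Psi i * d.W ⟨i, hiW⟩).map C =
          d.jMat S i * (d.Z i).charmatrix * (d.W ⟨i, hiW⟩).map C := by
        rw [Matrix.map_mul, ← Matrix.mul_assoc, h4]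
      refine (congrArg (· + _) h5).trans ?_
      have h6 := congrArg (fun M => d.jMat S i * M.map C) (constraint_nat hd hi)
      simp only [map_C_sub, Matrix.map_mul] at h6
      rw [Matrix.mul_assoc (d.jMat S i) ((d.Ut i).map C)]
      refine (congrArg (_ + ·) h6.symm).trans ?_
      rw [mul_charmatrix, mul_charmatrix, Matrix.sub_mul, Matrix.smul_mul, Matrix.mul_sub]
      simp only [Matrix.mul_assoc]
      abel
    obtain ⟨T, hT, hT'⟩ := (dMat_basis h ⟨i + 1, hi⟩).exists_eq_mul (dMat_det _).1.ne_zero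
      (dMat_mul h ⟨i + 1, hi⟩) h2
    have h3 : d.toQ S i = T := by
      rw [toQ, h1, hT]; exact rightDiv_mul _ (dMat_det _).1
    rw [h3, h1]
    exact ⟨hT.symm, fun _ => hT'.symm⟩
  · refine ⟨?_, fun hi' => absurd hi' hi⟩
    have h1 : d.dMatExt S (i + 1) = 1 := dif_neg hi
    rw [toQ, h1, Matrix.mul_one]
    have := rightDiv_mul (d.dExtMat S i) (Q := 1) (by rw [Matrix.det_one]; exact monic_one)
    rwa [Matrix.mul_one] at this

theorem sqPart_toQ (h : ∀ i, d.frame S.rows i = 1) (hd : d.Constraint) (m : ℕ) (hm : m ≤ L) :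
    sqPart (d.toQ S) m hm = d.dMatExt S m ∧
      ∀ h : m < L, frakDt (d.toQ S) ⟨m, h⟩ = d.jMat S ⟨m, h⟩ * (d.Psit ⟨m, h⟩).map C := by
  induction hm using Nat.decreasingInduction with
  | self =>
    refine ⟨?_, fun h => absurd h (lt_irrefl _)⟩
    rw [sqPart_self, dMatExt, dif_neg (lt_irrefl _)]
  | of_succ m hm ih =>
    have h1 := (toQ_mul h hd ⟨m, hm⟩).1
    have h2 := mul_sqPart_left (d.toQ S) hm
    have h3 := mul_sqPart_right (d.toQ S) hm
    rw [ih.1] at h2 h3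
    refine ⟨?_, fun _ => ?_⟩
    · rw [dMatExt, dif_pos hm, ← dExtMat_castSucc, ← h1]
      exact h2.symm
    · ext1 r c
      revert c
      refine CoCol.cases hm (fun b => ?_) fun c => ?_
      · have h4 := congrFun (congrFun h3 r) b
        refine h4.symm.trans ?_
        have h5 := congrFun (congrFun (dExtMat_last S d ⟨m, hm⟩) r) b
        rw [← h1, ← Psit_first d hm] at h5
        exact h5
      · have hm1 : m + 1 < L := lt_of_le_of_lt c.1.2 c.1.1.2
        have h4 := congrFun (congrFun (mul_frakDt (d.toQ S) hm1) r) c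
        rw [ih.2 hm1, ← Matrix.mul_assoc, (toQ_mul h hd ⟨m, hm⟩).2 hm1, Matrix.mul_assoc,
          ← Matrix.map_mul] at h4
        refine h4.symm.trans ?_
        have h5 := Psit_next d hm1
        change (d.jMat S ⟨m, hm⟩ * (d.W ⟨m, _⟩ * d.Psit ⟨m + 1, hm1⟩).map C) r c = _
        rw [← h5]
        rfl

theorem frakD_toQ (h : ∀ i, d.frame S.rows i = 1) (hd : d.Constraint) (i : Fin L) :
    frakD (d.toQ S) i = d.dMat S i := by
  have := (sqPart_toQ h hd i i.2.le).1
  rw [dMatExt, dif_pos i.2] at this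
  exact this

theorem frakDt_toQ (h : ∀ i, d.frame S.rows i = 1) (hd : d.Constraint) (i : Fin L) :
    frakDt (d.toQ S) i = d.jMat S i * (d.Psit i).map C :=
  (sqPart_toQ h hd i i.2.le).2 i.2

theorem mappingRelation_toQ (h : ∀ i, d.frame S.rows i = 1) (hd : d.Constraint) :
    MappingRelation (d.toQ S) d (d.jMat S) := by
  refine ⟨fun i => ?_, fun i => ?_, fun i => frakDt_toQ h hd i⟩
  · rw [frakD_toQ h hd]; exact dMat_basis h i
  · rw [frakD_toQ h hd]; exact dMat_mul h i

theorem isModuliMatrix_toQ (h : ∀ i, d.frame S.rows i = 1) (hd : d.Constraint) :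
    IsModuliMatrix k (d.toQ S) := by
  refine ⟨fun i => ?_, fun i => ?_⟩
  · rw [frakD_toQ h hd, degree_eq_natDegree (dMat_det i).1.ne_zero, (dMat_det i).2]
  · rw [frakD_toQ h hd, frakDt_toQ h hd, invMulIsBigO_iff (dMat_det i).1.ne_zero]
    exact ((dMat_basis h i).strictlyProper (dMat_det i).1.ne_zero).mul_const _
      (dMat_det i).1.ne_zero

theorem Free.exists_staircase (h : d.Free) :
    ∃ S : Staircase n k L, ∀ i, IsUnit (d.frame S.rows i).det := by
  have h1 := fun i => (d.free_iff.1 h i).exists_stair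
  choose l e he using h1
  exact ⟨fun i => ⟨l i, e i⟩, he⟩

theorem free_of_frame {e : (i : Fin L) → Fin (k i) → Col n (i + 1) × ℕ}
    (h : ∀ i, IsUnit (d.frame e i).det) : d.Free :=
  d.free_iff.2 fun i => observable_of_rowMat (e i) (h i)

/-- The gauge transformation that makes a given invertible frame standard. -/
theorem exists_gauge_frame {e : (i : Fin L) → Fin (k i) → Col n (i + 1) × ℕ}
    (h : ∀ i, IsUnit (d.frame e i).det) :
    ∃ g : Gauge k L, (∀ i, (g i)⁻¹.val = d.frame e i) ∧ ∀ i, (d.act g).frame e i = 1 := by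
  have h1 := fun i => (Matrix.isUnit_iff_isUnit_det _).2 (h i)
  choose g hg using h1
  have h2 : ∀ i, (g⁻¹ i)⁻¹.val = d.frame e i := fun i => by
    rw [Pi.inv_apply, inv_inv, hg]
  refine ⟨g⁻¹, h2, fun i => ?_⟩
  rw [frame_act, ← h2, inv_mul_val]

end Data

theorem HalfADHM.exists_moduliMatrix (d : HalfADHM n k L) :
    ∃ (q : ModuliMatrix n k L) (J : _), MappingRelation q.1 d.1 J := by
  obtain ⟨S, hS⟩ := d.2.2.exists_staircase
  obtain ⟨g, -, hg⟩ := Data.exists_gauge_frame hS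
  have hd := d.2.1.act g
  have hq := Data.isModuliMatrix_toQ hg hd
  have h := (Data.mappingRelation_toQ hg hd).act hq.det_ne_zero g⁻¹
  rw [← Data.act_mul, mul_inv_cancel, Data.act_one] at h
  exact ⟨⟨_, hq⟩, _, h⟩

/-! ### The bijection -/

/-- The mapping relation is total on both sides, invariant under both groups, and determines each
side up to its group; such a relation is the graph of a bijection of the quotients. -/
theorem exists_mapping_equiv (n k : ℕ → ℕ) (L : ℕ) :
    ∃ Φ : VortexModuli n k L ≃ HalfADHMQuotient n k L,
      ∀ (q : ModuliMatrix n k L) (d : HalfADHM n k L),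
        Φ (Quotient.mk _ q) = Quotient.mk _ d ↔ ∃ J, MappingRelation q.1 d.1 J := by
  choose F hF using fun q : ModuliMatrix n k L => q.2.exists_data
  choose G hG using fun d : HalfADHM n k L => d.exists_moduliMatrix
  have hFeq : ∀ (q : ModuliMatrix n k L) (d : HalfADHM n k L), (∃ J, MappingRelation q.1 d.1 J) →
      (Quotient.mk (gaugeSetoid n k L) (F q)) = Quotient.mk _ d := by
    rintro q d ⟨J, hJ⟩
    obtain ⟨J', hJ'⟩ := hF q
    exact Quotient.sound (hJ'.exists_gauge q.2.det_ne_zero hJ (F q).2.1 d.2.1)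
  have hGeq : ∀ (q : ModuliMatrix n k L) (d : HalfADHM n k L), (∃ J, MappingRelation q.1 d.1 J) →
      (Quotient.mk (vSetoid n k L) (G d)) = Quotient.mk _ q := by
    rintro q d ⟨J, hJ⟩
    obtain ⟨J', hJ'⟩ := hG d
    exact Quotient.sound (hJ'.exists_vAct (G d).2.det_ne_zero q.2.det_ne_zero hJ)
  let Φ : VortexModuli n k L ≃ HalfADHMQuotient n k L :=
    { toFun := Quotient.lift (fun q => Quotient.mk _ (F q)) (by
        rintro q q' ⟨V, hV⟩
        symm
        apply hFeq
        obtain ⟨J, hJ⟩ := hF q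
        rw [hV]
        exact ⟨_, hJ.vAct q.2.det_ne_zero V⟩)
      invFun := Quotient.lift (fun d => Quotient.mk _ (G d)) (by
        rintro d d' ⟨g, hg⟩
        symm
        apply hGeq
        obtain ⟨J, hJ⟩ := hG d
        rw [hg]
        exact ⟨_, hJ.act (G d).2.det_ne_zero g⟩)
      left_inv := by
        rintro ⟨q⟩
        exact hGeq q (F q) (hF q)
      right_inv := by
        rintro ⟨d⟩
        exact hFeq (G d) d (hG d) }
  refine ⟨Φ, fun q d => ⟨fun h => ?_, fun h => hFeq q d h⟩⟩
  obtain ⟨g, hg⟩ := Quotient.exact (s := gaugeSetoid n k L) h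
  obtain ⟨J, hJ⟩ := hF q
  rw [hg]
  exact ⟨_, hJ.act q.2.det_ne_zero g⟩

end VortexQuiver
end

noncomputable section

namespace VortexQuiver

/-! ### Analytic families of matrices -/

section ContDiffMat

variable {E : Type} [NormedAddCommGroup E] [NormedSpace ℂ E] {α β γ : Type}
  {s : Set E}

/-- All entries are analytic on `s`. -/
def ContDiffMat (s : Set E) (M : E → Matrix α β ℂ) : Prop :=
  ∀ a b, ContDiffOn ℂ ω (fun v => M v a b) s

theorem ContDiffMat.mul [Fintype β] {M : E → Matrix α β ℂ} {N : E → Matrix β γ ℂ}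
    (hM : ContDiffMat s M) (hN : ContDiffMat s N) : ContDiffMat s (fun v => M v * N v) := by
  intro a c
  simp only [Matrix.mul_apply]
  exact ContDiffOn.sum fun b _ => (hM a b).mul (hN b c)

theorem ContDiffMat.sub {M N : E → Matrix α β ℂ}
    (hM : ContDiffMat s M) (hN : ContDiffMat s N) : ContDiffMat s (fun v => M v - N v) :=
  fun a b => (hM a b).sub (hN a b)

theorem contDiffMat_const (M : Matrix α β ℂ) : ContDiffMat s (fun _ : E => M) :=
  fun _ _ => contDiffOn_const

theorem ContDiffMat.pow [Fintype α] [DecidableEq α] {M : E → Matrix α α ℂ} (hM : ContDiffMat s M)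
    (m : ℕ) : ContDiffMat s (fun v => M v ^ m) := by
  induction m with
  | zero => simpa only [pow_zero] using contDiffMat_const _
  | succ m ih => simpa only [pow_succ] using ih.mul hM

theorem ContDiffMat.det [Fintype α] [DecidableEq α] {M : E → Matrix α α ℂ} (hM : ContDiffMat s M) :
    ContDiffOn ℂ ω (fun v => (M v).det) s := by
  simp only [Matrix.det_apply]
  exact ContDiffOn.sum fun σ _ => (contDiffOn_prod fun i _ => hM _ _).const_smul _

theorem ContDiffMat.adjugate [Fintype α] [DecidableEq α] {M : E → Matrix α α ℂ}
    (hM : ContDiffMat s M) : ContDiffMat s (fun v => (M v).adjugate) := by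
  intro a b
  simp only [Matrix.adjugate_apply]
  refine ContDiffMat.det fun c d => ?_
  by_cases h : c = b
  · subst h; simp only [Matrix.updateRow_self]; exact contDiffOn_const
  · simp only [Matrix.updateRow_ne h]; exact hM c d

theorem ContDiffMat.inv [Fintype α] [DecidableEq α] {M : E → Matrix α α ℂ}
    (hM : ContDiffMat s M) (h : ∀ v ∈ s, (M v).det ≠ 0) : ContDiffMat s (fun v => (M v)⁻¹) := by
  intro a b
  simp only [Matrix.inv_def, Ring.inverse_eq_inv', Matrix.smul_apply, smul_eq_mul]
  exact (hM.det.inv h).mul (hM.adjugate a b)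

end ContDiffMat

variable {n k : ℕ → ℕ} {L : ℕ}

/-! ### The space of all matrix entries -/

/-- The normed space of all matrix entries. -/
abbrev DataSpace (n k : ℕ → ℕ) (L : ℕ) : Type :=
  ((i : Fin L) → Fin (k i) → Fin (k i) → ℂ) ×
  ((i : Fin L) → Fin (n i) → Fin (k i) → ℂ) ×
  ((i : Fin L) → Fin (k i) → Fin (n (i + 1)) → ℂ) ×
  ((i : Fin (L - 1)) → Fin (k i) → Fin (k (i + 1)) → ℂ)

namespace Data

/-- The matrix entries of a tuple. -/
def toSpace (d : Data n k L) : DataSpace n k L := (d.Z, d.U, d.Ut, d.W)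

/-- The tuple with given matrix entries. -/
def ofSpace (v : DataSpace n k L) : Data n k L := ⟨v.1, v.2.1, v.2.2.1, v.2.2.2⟩

theorem ofSpace_toSpace (d : Data n k L) : ofSpace d.toSpace = d := rfl

theorem toSpace_ofSpace (v : DataSpace n k L) : (ofSpace v).toSpace = v := rfl

theorem continuous_toSpace : Continuous (toSpace : Data n k L → DataSpace n k L) :=
  continuous_induced_dom

theorem continuous_ofSpace : Continuous (ofSpace : DataSpace n k L → Data n k L) :=
  continuous_induced_rng.2 continuous_id

theorem isEmbedding_toSpace :
    Topology.IsEmbedding (toSpace : Data n k L → DataSpace n k L) :=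
  ⟨⟨rfl⟩, fun d d' h => by rw [← ofSpace_toSpace d, h, ofSpace_toSpace]⟩

variable {E : Type} [NormedAddCommGroup E] [NormedSpace ℂ E] {s : Set E}

/-- A family of tuples with analytic entries. -/
structure IsAnalytic (s : Set E) (d : E → Data n k L) : Prop where
  Z : ∀ i, ContDiffMat s (fun v => (d v).Z i)
  U : ∀ i, ContDiffMat s (fun v => (d v).U i)
  Ut : ∀ i, ContDiffMat s (fun v => (d v).Ut i)
  W : ∀ i, ContDiffMat s (fun v => (d v).W i)

theorem isAnalytic_ofSpace (s : Set (DataSpace n k L)) : IsAnalytic s ofSpace := by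
  have h2 : ContDiffOn ℂ ω (fun v : DataSpace n k L => v.2) s := contDiffOn_snd
  have h3 : ContDiffOn ℂ ω (fun v : DataSpace n k L => v.2.2) s := 
    contDiff_snd.comp_contDiffOn h2
  exact ⟨fun i a b => contDiffOn_pi.1 (contDiffOn_pi.1 (contDiffOn_pi.1 contDiffOn_fst i) a) b,
    fun i a b => contDiffOn_pi.1 (contDiffOn_pi.1 (contDiffOn_pi.1
      (contDiff_fst.comp_contDiffOn h2) i) a) b,
    fun i a b => contDiffOn_pi.1 (contDiffOn_pi.1 (contDiffOn_pi.1
      (contDiff_fst.comp_contDiffOn h3) i) a) b,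
    fun i a b => contDiffOn_pi.1 (contDiffOn_pi.1 (contDiffOn_pi.1
      (contDiff_snd.comp_contDiffOn h3) i) a) b⟩

namespace IsAnalytic

variable {d : E → Data n k L}

theorem chain (hd : IsAnalytic s d) {j i : ℕ} (h : j ≤ i) (hi : i < L) :
    ContDiffMat s (fun v => (d v).chain h hi) := by
  induction i, h using Nat.le_induction with
  | base => simp only [chain_self]; exact contDiffMat_const _
  | succ i h ih =>
    simp only [chain_succ _ h]
    exact (ih _).mul (hd.W _)

theorem Psi (hd : IsAnalytic s d) (i : Fin L) : ContDiffMat s (fun v => (d v).Psi i) :=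
  fun a b => by
    have h : (a.1 : ℕ) ≤ i := Nat.lt_succ_iff.1 a.1.2
    exact ((hd.U ⟨a.1, lt_of_le_of_lt h i.2⟩).mul (hd.chain h i.2)) a.2 b

theorem frame (hd : IsAnalytic s d) (e : (i : Fin L) → Fin (k i) → Col n (i + 1) × ℕ) (i : Fin L) :
    ContDiffMat s (fun v => (d v).frame e i) :=
  fun a b => ((hd.Psi i).mul ((hd.Z i).pow (e i a).2)) (e i a).1 b

theorem toSpace (hd : IsAnalytic s d) : ContDiffOn ℂ ω (fun v => (d v).toSpace) s := by
  have h1 : ContDiffOn ℂ ω (fun v => (d v).toSpace.1) s :=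
    contDiffOn_pi.2 fun i => contDiffOn_pi.2 fun a => contDiffOn_pi.2 fun b => hd.Z i a b
  have h2 : ContDiffOn ℂ ω (fun v => (d v).toSpace.2.1) s :=
    contDiffOn_pi.2 fun i => contDiffOn_pi.2 fun a => contDiffOn_pi.2 fun b => hd.U i a b
  have h3 : ContDiffOn ℂ ω (fun v => (d v).toSpace.2.2.1) s :=
    contDiffOn_pi.2 fun i => contDiffOn_pi.2 fun a => contDiffOn_pi.2 fun b => hd.Ut i a b
  have h4 : ContDiffOn ℂ ω (fun v => (d v).toSpace.2.2.2) s :=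
    contDiffOn_pi.2 fun i => contDiffOn_pi.2 fun a => contDiffOn_pi.2 fun b => hd.W i a b
  exact h1.prodMk (h2.prodMk (h3.prodMk h4))

end IsAnalytic

theorem continuous_frame (e : (i : Fin L) → Fin (k i) → Col n (i + 1) × ℕ) (i : Fin L) :
    Continuous (fun d : Data n k L => d.frame e i) := by
  refine continuous_matrix fun a b => ?_
  have h : Continuous (fun v : DataSpace n k L => (ofSpace v).frame e i a b) :=
    continuousOn_univ.1 ((isAnalytic_ofSpace Set.univ).frame e i a b).continuousOn
  exact Continuous.comp (f := toSpace) h continuous_toSpace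

theorem continuous_Z (i : Fin L) : Continuous (fun d : Data n k L => d.Z i) :=
  (continuous_apply i).comp (continuous_fst.comp continuous_toSpace)

theorem continuous_U (i : Fin L) : Continuous (fun d : Data n k L => d.U i) :=
  (continuous_apply i).comp (continuous_fst.comp (continuous_snd.comp continuous_toSpace))

theorem continuous_Ut (i : Fin L) : Continuous (fun d : Data n k L => d.Ut i) :=
  (continuous_apply i).comp (continuous_fst.comp (continuous_snd.comp
    (continuous_snd.comp continuous_toSpace)))

theorem continuous_W (i : Fin (L - 1)) : Continuous (fun d : Data n k L => d.W i) :=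
  (continuous_apply i).comp (continuous_snd.comp (continuous_snd.comp
    (continuous_snd.comp continuous_toSpace)))

theorem continuous_mk {T : Type*} [TopologicalSpace T] {d : T → Data n k L}
    (hZ : ∀ i, Continuous fun t => (d t).Z i) (hU : ∀ i, Continuous fun t => (d t).U i)
    (hUt : ∀ i, Continuous fun t => (d t).Ut i) (hW : ∀ i, Continuous fun t => (d t).W i) :
    Continuous d :=
  continuous_induced_rng.2 ((continuous_pi hZ).prodMk ((continuous_pi hU).prodMk
    ((continuous_pi hUt).prodMk (continuous_pi hW))))

theorem continuous_act (g : Gauge k L) : Continuous (fun d : Data n k L => d.act g) :=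
  continuous_mk
    (fun i => (continuous_const.matrix_mul (continuous_Z i)).matrix_mul continuous_const)
    (fun i => (continuous_U i).matrix_mul continuous_const)
    (fun i => continuous_const.matrix_mul (continuous_Ut i))
    (fun i => (continuous_const.matrix_mul (continuous_W i)).matrix_mul continuous_const)

end Data

/-! ### The topology of the quotient -/

theorem HalfADHM.continuous_act (g : Data.Gauge k L) :
    Continuous (fun d : HalfADHM n k L => d.act g) :=
  ((Data.continuous_act g).comp continuous_subtype_val).subtype_mk _

/-- The saturation of an open set is the union of its gauge translates. -/
theorem isOpenQuotientMap_mk :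
    IsOpenQuotientMap (Quotient.mk (gaugeSetoid n k L)) := by
  refine ⟨Quotient.mk_surjective, continuous_quotient_mk', fun U hU => ?_⟩
  rw [← isQuotientMap_quotient_mk'.isOpen_preimage]
  have : Quotient.mk (gaugeSetoid n k L) ⁻¹' (Quotient.mk (gaugeSetoid n k L) '' U) =
      ⋃ g : Data.Gauge k L, (fun d : HalfADHM n k L => d.act g) ⁻¹' U := by
    ext d
    simp only [Set.mem_preimage, Set.mem_image, Set.mem_iUnion]
    constructor
    · rintro ⟨d', hd', h⟩
      obtain ⟨g, hg⟩ := Quotient.exact (s := gaugeSetoid n k L) h.symm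
      refine ⟨g, ?_⟩
      have : d.act g = d' := Subtype.ext hg.symm
      rwa [this]
    · rintro ⟨g, hg⟩
      refine ⟨_, hg, (Quotient.sound (s := gaugeSetoid n k L) ?_).symm⟩
      exact ⟨g, rfl⟩
  exact this ▸ isOpen_iUnion fun g => hU.preimage (HalfADHM.continuous_act g)

theorem secondCountableTopology_quotient : SecondCountableTopology (HalfADHMQuotient n k L) := by
  have : SecondCountableTopology (Data n k L) :=
    Data.isEmbedding_toSpace.isInducing.secondCountableTopology
  have : SecondCountableTopology (HalfADHM n k L) :=
    Topology.IsEmbedding.subtypeVal.isInducing.secondCountableTopology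
  exact isOpenQuotientMap_mk.isQuotientMap.secondCountableTopology isOpenQuotientMap_mk.isOpenMap

/-- Polynomial equations that characterize gauge equivalence. -/
def Data.Compatible (d d' : Data n k L) (e e' : (i : Fin L) → Fin (k i) → Col n (i + 1) × ℕ) :
    Prop :=
  (∀ i, d.frame e' i * ((d.frame e i).adjugate * d'.frame e i) =
      (d.frame e i).det • d'.frame e' i) ∧
  (∀ i, d.Z i * ((d.frame e i).adjugate * d'.frame e i) =
      (d.frame e i).adjugate * d'.frame e i * d'.Z i) ∧
  (∀ i, d.U i * ((d.frame e i).adjugate * d'.frame e i) = (d.frame e i).det • d'.U i) ∧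
  (∀ i, (d.frame e i).det • d.Ut i = (d.frame e i).adjugate * d'.frame e i * d'.Ut i) ∧
  (∀ (i : Fin (L - 1)) (hi : (i : ℕ) < L) (hi' : (i : ℕ) + 1 < L),
    (d.frame e ⟨i, hi⟩).det • (d.W i *
      ((d.frame e ⟨i + 1, hi'⟩).adjugate * d'.frame e ⟨i + 1, hi'⟩)) =
    (d.frame e ⟨i + 1, hi'⟩).det •
      ((d.frame e ⟨i, hi⟩).adjugate * d'.frame e ⟨i, hi⟩ * d'.W i))

/-- If `d' = d · g`, every frame satisfies `adj F * F' = det F • g`, so clearing denominators in the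
equivalence gives equations valid for all frames, even singular ones. Conversely, a nonsingular
frame of `d` recovers a candidate for `g`. -/
theorem exists_gauge_iff_compatible (d d' : HalfADHM n k L) :
    (∃ g : Data.Gauge k L, d'.1 = d.1.act g) ↔ ∀ e e', d.1.Compatible d'.1 e e' := by
  constructor
  · rintro ⟨g, hg⟩ e e'
    have h1 : ∀ e i, d'.1.frame e i = d.1.frame e i * (g i).val := by
      intro e i; rw [hg, Data.frame_act]
    have h2 : ∀ i, (d.1.frame e i).adjugate * d'.1.frame e i =
        (d.1.frame e i).det • (g i).val := by
      intro i
      rw [h1, ← Matrix.mul_assoc, Matrix.adjugate_mul, Matrix.smul_mul, Matrix.one_mul]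
    simp only [Data.Compatible, h2]
    rw [hg]
    refine ⟨fun i => ?_, fun i => ?_, fun i => ?_, fun i => ?_, fun i hi hi' => ?_⟩
    · rw [Data.frame_act, Matrix.mul_smul]
    · change _ = _ * ((g i)⁻¹.val * d.1.Z i * (g i).val)
      rw [Matrix.smul_mul, ← Matrix.mul_assoc, ← Matrix.mul_assoc, Data.mul_inv_val, Matrix.one_mul,
        Matrix.mul_smul]
    · change _ = _ • (d.1.U i * (g i).val)
      rw [Matrix.mul_smul]
    · change _ = _ * ((g i)⁻¹.val * d.1.Ut i)
      rw [Matrix.smul_mul, ← Matrix.mul_assoc, Data.mul_inv_val, Matrix.one_mul]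
    · change _ = _ • (_ * ((g ⟨i, hi⟩)⁻¹.val * d.1.W i * (g ⟨i + 1, hi'⟩).val))
      rw [Matrix.smul_mul, ← Matrix.mul_assoc, ← Matrix.mul_assoc, Data.mul_inv_val, Matrix.one_mul,
        Matrix.mul_smul, smul_comm]
  · intro h
    obtain ⟨S, hS⟩ := d.2.2.exists_staircase
    obtain ⟨S', hS'⟩ := d'.2.2.exists_staircase
    obtain ⟨h1, h2, h3, h4, h5⟩ := h S.rows S'.rows
    set δ := fun i => (d.1.frame S.rows i).det with hδ
    have hδ0 : ∀ i, δ i ≠ 0 := fun i => (hS i).ne_zero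
    set H := fun i => (δ i)⁻¹ • ((d.1.frame S.rows i).adjugate * d'.1.frame S.rows i) with hH
    have hadj : ∀ i, (d.1.frame S.rows i).adjugate * d'.1.frame S.rows i = δ i • H i := by
      intro i; rw [hH, smul_smul, mul_inv_cancel₀ (hδ0 i), one_smul]
    simp only [hadj] at h1 h2 h3 h4 h5
    have h1' : ∀ i, d.1.frame S'.rows i * H i = d'.1.frame S'.rows i := by
      intro i
      have := h1 i
      rw [Matrix.mul_smul] at this
      exact (smul_right_injective _ (hδ0 i)) this
    -- The second staircase serves only here: it selects a nonsingular frame of `d'`, whose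
    -- factorization through `H` makes `H` invertible.
    have hunit : ∀ i, IsUnit (H i) := by
      intro i
      rw [Matrix.isUnit_iff_isUnit_det]
      have := hS' i
      rw [← h1' i, Matrix.det_mul] at this
      exact (IsUnit.mul_iff.1 this).2
    choose g hg using hunit
    refine ⟨g, ?_⟩
    simp only [← hg] at h2 h3 h4 h5
    ext1
    · funext i
      have := h2 i
      rw [Matrix.mul_smul, Matrix.smul_mul] at this
      have h6 := smul_right_injective _ (hδ0 i) this
      change _ = (g i)⁻¹.val * d.1.Z i * (g i).val
      rw [Matrix.mul_assoc, h6, ← Matrix.mul_assoc, Data.inv_mul_val, Matrix.one_mul]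
    · funext i
      have := h3 i
      rw [Matrix.mul_smul] at this
      exact (smul_right_injective _ (hδ0 i) this).symm
    · funext i
      have := h4 i
      rw [Matrix.smul_mul] at this
      have h6 := smul_right_injective _ (hδ0 i) this
      change _ = (g i)⁻¹.val * d.1.Ut i
      rw [h6, ← Matrix.mul_assoc, Data.inv_mul_val, Matrix.one_mul]
    · funext i
      have hi : (i : ℕ) < L := by omega
      have hi' : (i : ℕ) + 1 < L := by omega
      have := h5 i hi hi'
      rw [Matrix.smul_mul, Matrix.mul_smul, smul_smul, smul_smul, mul_comm] at this
      have h6 := smul_right_injective _ (mul_ne_zero (hδ0 ⟨i + 1, hi'⟩) (hδ0 ⟨i, hi⟩)) this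
      change _ = (g ⟨i, hi⟩)⁻¹.val * d.1.W i * (g ⟨i + 1, hi'⟩).val
      rw [Matrix.mul_assoc, h6, ← Matrix.mul_assoc, Data.inv_mul_val, Matrix.one_mul]

/-- The projection is open, so it suffices that gauge equivalence is a closed relation, and the
equations `Data.Compatible` are continuous. -/
theorem t2Space_quotient : T2Space (HalfADHMQuotient n k L) := by
  rw [t2_iff_isClosed_diagonal]
  rw [← (isOpenQuotientMap_mk.prodMap isOpenQuotientMap_mk).isQuotientMap.isClosed_preimage]
  have : Prod.map (Quotient.mk (gaugeSetoid n k L)) (Quotient.mk (gaugeSetoid n k L)) ⁻¹'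
      Set.diagonal (HalfADHMQuotient n k L) =
      ⋂ e, ⋂ e', {p : HalfADHM n k L × HalfADHM n k L | p.1.1.Compatible p.2.1 e e'} := by
    ext ⟨d, d'⟩
    simp only [Set.mem_preimage, Prod.map_apply, Set.mem_diagonal_iff, Set.mem_iInter,
      Set.mem_ofPred_eq]
    rw [← exists_gauge_iff_compatible]
    exact Quotient.eq
  rw [this]
  refine isClosed_iInter fun e => isClosed_iInter fun e' => ?_
  have c1 : Continuous fun p : HalfADHM n k L × HalfADHM n k L => p.1.1 :=
    continuous_subtype_val.comp continuous_fst
  have c2 : Continuous fun p : HalfADHM n k L × HalfADHM n k L => p.2.1 :=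
    continuous_subtype_val.comp continuous_snd
  have f1 := fun e i => (Data.continuous_frame (n := n) (k := k) (L := L) e i).comp c1
  have f2 := fun e i => (Data.continuous_frame (n := n) (k := k) (L := L) e i).comp c2
  have a1 := fun i => (f1 e i).matrix_adjugate.matrix_mul (f2 e i)
  simp only [Data.Compatible, Set.ofPred_and, Set.ofPred_forall]
  refine IsClosed.inter (isClosed_iInter fun i => ?_) (IsClosed.inter (isClosed_iInter fun i => ?_)
    (IsClosed.inter (isClosed_iInter fun i => ?_) (IsClosed.inter (isClosed_iInter fun i => ?_)
      (isClosed_iInter fun i => isClosed_iInter fun hi => isClosed_iInter fun hi' => ?_))))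
  · exact isClosed_eq ((f1 e' i).matrix_mul (a1 i)) ((f1 e i).matrix_det.smul (f2 e' i))
  · exact isClosed_eq (((Data.continuous_Z i).comp c1).matrix_mul (a1 i))
      ((a1 i).matrix_mul ((Data.continuous_Z i).comp c2))
  · exact isClosed_eq (((Data.continuous_U i).comp c1).matrix_mul (a1 i))
      ((f1 e i).matrix_det.smul ((Data.continuous_U i).comp c2))
  · exact isClosed_eq ((f1 e i).matrix_det.smul ((Data.continuous_Ut i).comp c1))
      ((a1 i).matrix_mul ((Data.continuous_Ut i).comp c2))
  · exact isClosed_eq ((f1 e _).matrix_det.smul (((Data.continuous_W i).comp c1).matrix_mul (a1 _)))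
      ((f1 e _).matrix_det.smul ((a1 _).matrix_mul ((Data.continuous_W i).comp c2)))

/-! ### Existence of half-ADHM data -/

/-- With `Υ̃ = W = 0` the constraints are trivial. `Z_i` is a nilpotent shift and the first row of
`Υ_i` is the first unit covector, so the rows `Υ_i Z_i ^ m` run through all unit covectors. -/
theorem nonempty_halfADHM (hn : ∀ j, j ≤ L → 0 < n j) : Nonempty (HalfADHM n k L) := by
  let d : Data n k L :=
    { Z := fun i => Matrix.of fun a b => if (a : ℕ) + 1 = b then 1 else 0
      U := fun i => Matrix.of fun a b => if (a : ℕ) = 0 ∧ (b : ℕ) = 0 then 1 else 0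
      Ut := fun i => 0
      W := fun i => 0 }
  refine ⟨d, fun i => by simp [d], d.free_iff.2 fun i v hv => ?_⟩
  have hpow : ∀ m : ℕ, d.U i * d.Z i ^ m =
      Matrix.of fun (a : Fin (n i)) (b : Fin (k i)) =>
        if (a : ℕ) = 0 ∧ (b : ℕ) = m then (1 : ℂ) else 0 := by
    intro m
    induction m with
    | zero => simp [d]
    | succ m ih =>
      rw [pow_succ, ← Matrix.mul_assoc, ih]
      ext a b
      simp only [Matrix.mul_apply, Matrix.of_apply, d]
      by_cases ha : (a : ℕ) = 0
      · simp only [ha, true_and, ite_mul, one_mul, zero_mul]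
        by_cases hm : m < k i
        · rw [Finset.sum_eq_single ⟨m, hm⟩]
          · simp [eq_comm]
          · intro c _ hc
            rw [if_neg]
            intro h; exact hc (Fin.ext h)
          · simp
        · rw [Finset.sum_eq_zero, if_neg (by have := b.2; omega)]
          intro c _
          rw [if_neg (by have := c.2; omega)]
      · simp [ha]
  funext b
  have h1 := congrFun (hv b) (Col.last ⟨0, hn i i.2.le⟩)
  have h2 : (d.Psi i * d.Z i ^ (b : ℕ)).mulVec v (Col.last ⟨0, hn i i.2.le⟩) =
      (d.U i * d.Z i ^ (b : ℕ)).mulVec v ⟨0, hn i i.2.le⟩ := by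
    rw [← Data.Psi_last d i.2]; rfl
  rw [h2, hpow] at h1
  simpa [Matrix.mulVec, dotProduct, Fin.val_inj] using h1

end VortexQuiver
end

noncomputable section

namespace VortexQuiver

/-! ### Analytic submersions -/

/-- A submersion is, locally, the first component of an analytic isomorphism whose second component
is linear. -/
theorem exists_openPartialHomeomorph_of_surjective {E F : Type} [NormedAddCommGroup E]
    [NormedSpace ℂ E] [FiniteDimensional ℂ E] [NormedAddCommGroup F] [NormedSpace ℂ F]
    [FiniteDimensional ℂ F] {m : ℕ} {f : E → F} {x : E} (hf : ContDiff ℂ ω f)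
    (hs : Function.Surjective (fderiv ℂ f x))
    (hm : Module.finrank ℂ E = Module.finrank ℂ F + m) :
    ∃ (p : E →L[ℂ] (Fin m → ℂ)) (Θ : OpenPartialHomeomorph E (F × (Fin m → ℂ))),
      x ∈ Θ.source ∧ (∀ v, Θ v = (f v, p v)) ∧ ContDiffOn ℂ ω Θ.symm Θ.target := by
  have : CompleteSpace E := FiniteDimensional.complete ℂ E
  set f' := fderiv ℂ f x with hf'
  have hrn := LinearMap.finrank_range_add_finrank_ker (f' : E →ₗ[ℂ] F)
  have hr : LinearMap.range (f' : E →ₗ[ℂ] F) = ⊤ := LinearMap.range_eq_top.2 hs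
  rw [hr, finrank_top] at hrn
  have hk : Module.finrank ℂ (LinearMap.ker (f' : E →ₗ[ℂ] F)) = m := by omega
  -- A projection onto the kernel of the derivative supplies the complementary coordinates `p`: the
  -- pair `(f', p)` is injective, hence bijective by dimensions.
  obtain ⟨g, hg⟩ := LinearMap.exists_leftInverse_of_injective
    (LinearMap.ker (f' : E →ₗ[ℂ] F)).subtype (Submodule.ker_subtype _)
  let e : LinearMap.ker (f' : E →ₗ[ℂ] F) ≃ₗ[ℂ] (Fin m → ℂ) :=
    LinearEquiv.ofFinrankEq _ _ (by rw [hk, Module.finrank_fin_fun])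
  let p : E →L[ℂ] (Fin m → ℂ) := LinearMap.toContinuousLinearMap (e.toLinearMap ∘ₗ g)
  let l : E →L[ℂ] F × (Fin m → ℂ) := f'.prod p
  have hinj : Function.Injective l := by
    rw [injective_iff_map_eq_zero]
    intro v hv
    have h1 : f' v = 0 := congrArg Prod.fst hv
    have h2 : e (g v) = 0 := congrArg Prod.snd hv
    have h3 : g v = 0 := by simpa using h2
    have h4 := LinearMap.congr_fun hg (⟨v, h1⟩ : LinearMap.ker (f' : E →ₗ[ℂ] F))
    have h5 : g v = (⟨v, h1⟩ : LinearMap.ker (f' : E →ₗ[ℂ] F)) := h4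
    rw [h3] at h5
    exact (congrArg Subtype.val h5).symm
  have hfin : Module.finrank ℂ E = Module.finrank ℂ (F × (Fin m → ℂ)) := by
    rw [Module.finrank_prod, Module.finrank_fin_fun, hm]
  let l' : E ≃L[ℂ] F × (Fin m → ℂ) :=
    (LinearEquiv.ofInjectiveOfFinrankEq (l : E →ₗ[ℂ] F × (Fin m → ℂ)) hinj hfin).toContinuousLinearEquiv
  have hl : (l' : E →L[ℂ] F × (Fin m → ℂ)) = l := rfl
  let Hf : E → F × (Fin m → ℂ) := fun v => (f v, p v)
  have hH : ContDiff ℂ ω Hf := hf.prodMk p.contDiff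
  have hH' : HasFDerivAt Hf (l' : E →L[ℂ] F × (Fin m → ℂ)) x := by
    rw [hl]
    exact ((hf.differentiable (by simp)) x).hasFDerivAt.prodMk p.hasFDerivAt
  have hω : (ω : WithTop ℕ∞) ≠ 0 := by simp
  let Θ := hH.contDiffAt.toOpenPartialHomeomorph Hf hH' hω
  have hΘ : ContDiffAt ℂ ω Θ.symm (Hf x) := hH.contDiffAt.to_localInverse hH' hω
  -- The inverse is analytic at one point, hence near it; the target is shrunk accordingly.
  obtain ⟨u, hu, huo, hxu⟩ := eventually_nhds_iff.1 (hΘ.eventually (by simp))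
  refine ⟨p, (Θ.symm.restrOpen u huo).symm, ?_, fun v => rfl, ?_⟩
  · have h1 : x ∈ Θ.source := hH.contDiffAt.mem_toOpenPartialHomeomorph_source hH' hω
    change x ∈ (Θ.symm.restrOpen u huo).target
    rw [← (Θ.symm.restrOpen u huo).symm_source]
    have h2 : Hf x ∈ (Θ.symm.restrOpen u huo).source :=
      ⟨Θ.map_source h1, hxu⟩
    have h3 := (Θ.symm.restrOpen u huo).map_source h2
    have h4 : Θ.symm (Hf x) = x := Θ.left_inv h1
    change Θ.symm (Hf x) ∈ _ at h3
    rwa [h4] at h3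
  · intro y hy
    exact (hu y hy.2).contDiffWithinAt

variable {n k : ℕ → ℕ} {L : ℕ}

/-! ### The derivative of the constraints and of the frame -/

namespace Data

/-- The defect of the constraints. -/
def constr (d : Data n k L) (i : Fin (L - 1)) : Matrix (Fin (k i)) (Fin (k (i + 1))) ℂ :=
  have h : (i : ℕ) < L := by omega
  have h' : (i : ℕ) + 1 < L := by omega
  d.Z ⟨i, h⟩ * d.W i - d.W i * d.Z ⟨i + 1, h'⟩ - d.Ut ⟨i, h⟩ * d.U ⟨i + 1, h'⟩

theorem constraint_iff (d : Data n k L) : d.Constraint ↔ d.constr = 0 := by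
  rw [funext_iff]
  exact forall_congr' fun i => sub_eq_zero.symm

/-- The derivative of the constraints at `d`. -/
def linConstr (d : Data n k L) :
    DataSpace n k L →ₗ[ℂ] ((i : Fin (L - 1)) → Matrix (Fin (k i)) (Fin (k (i + 1))) ℂ) where
  toFun v i :=
    have h : (i : ℕ) < L := by omega
    have h' : (i : ℕ) + 1 < L := by omega
    (ofSpace v).Z ⟨i, h⟩ * d.W i + d.Z ⟨i, h⟩ * (ofSpace v).W i
      - (ofSpace v).W i * d.Z ⟨i + 1, h'⟩ - d.W i * (ofSpace v).Z ⟨i + 1, h'⟩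
      - (ofSpace v).Ut ⟨i, h⟩ * d.U ⟨i + 1, h'⟩ - d.Ut ⟨i, h⟩ * (ofSpace v).U ⟨i + 1, h'⟩
  map_add' v w := by
    funext i
    have h : (i : ℕ) < L := by omega
    have h' : (i : ℕ) + 1 < L := by omega
    have hZ : ∀ j, (ofSpace (v + w)).Z j = (ofSpace v).Z j + (ofSpace w).Z j := fun _ => rfl
    have hU : ∀ j, (ofSpace (v + w)).U j = (ofSpace v).U j + (ofSpace w).U j := fun _ => rfl
    have hUt : ∀ j, (ofSpace (v + w)).Ut j = (ofSpace v).Ut j + (ofSpace w).Ut j := fun _ => rfl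
    have hW : ∀ j, (ofSpace (v + w)).W j = (ofSpace v).W j + (ofSpace w).W j := fun _ => rfl
    simp only [hZ, hU, hUt, hW, Pi.add_apply, Matrix.add_mul, Matrix.mul_add]
    abel
  map_smul' c v := by
    funext i
    have hZ : ∀ j, (ofSpace (c • v)).Z j = c • (ofSpace v).Z j := fun _ => rfl
    have hU : ∀ j, (ofSpace (c • v)).U j = c • (ofSpace v).U j := fun _ => rfl
    have hUt : ∀ j, (ofSpace (c • v)).Ut j = c • (ofSpace v).Ut j := fun _ => rfl
    have hW : ∀ j, (ofSpace (c • v)).W j = c • (ofSpace v).W j := fun _ => rfl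
    simp only [hZ, hU, hUt, hW, Pi.smul_apply, Matrix.smul_mul, Matrix.mul_smul, smul_sub, smul_add,
      RingHom.id_apply]

theorem linConstr_apply (d w : Data n k L) (i : Fin (L - 1)) (h : (i : ℕ) < L)
    (h' : (i : ℕ) + 1 < L) :
    d.linConstr w.toSpace i = w.Z ⟨i, h⟩ * d.W i + d.Z ⟨i, h⟩ * w.W i
      - w.W i * d.Z ⟨i + 1, h'⟩ - d.W i * w.Z ⟨i + 1, h'⟩
      - w.Ut ⟨i, h⟩ * d.U ⟨i + 1, h'⟩ - d.Ut ⟨i, h⟩ * w.U ⟨i + 1, h'⟩ := rfl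

/-- The constraints are quadratic, so the expansion along a line is exact and identifies `linConstr`
as the derivative. -/
theorem constr_add_smul (d : Data n k L) (w : DataSpace n k L) (t : ℂ) :
    (ofSpace (d.toSpace + t • w)).constr =
      d.constr + t • (d.linConstr w + t • (ofSpace w).constr) := by
  funext i
  have h : (i : ℕ) < L := by omega
  have h' : (i : ℕ) + 1 < L := by omega
  change (d.Z ⟨i, h⟩ + t • (ofSpace w).Z ⟨i, h⟩) * (d.W i + t • (ofSpace w).W i) -
    (d.W i + t • (ofSpace w).W i) * (d.Z ⟨i + 1, h'⟩ + t • (ofSpace w).Z ⟨i + 1, h'⟩) -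
    (d.Ut ⟨i, h⟩ + t • (ofSpace w).Ut ⟨i, h⟩) * (d.U ⟨i + 1, h'⟩ + t • (ofSpace w).U ⟨i + 1, h'⟩) =
    (d.Z ⟨i, h⟩ * d.W i - d.W i * d.Z ⟨i + 1, h'⟩ - d.Ut ⟨i, h⟩ * d.U ⟨i + 1, h'⟩) +
    t • (((ofSpace w).Z ⟨i, h⟩ * d.W i + d.Z ⟨i, h⟩ * (ofSpace w).W i
      - (ofSpace w).W i * d.Z ⟨i + 1, h'⟩ - d.W i * (ofSpace w).Z ⟨i + 1, h'⟩
      - (ofSpace w).Ut ⟨i, h⟩ * d.U ⟨i + 1, h'⟩ - d.Ut ⟨i, h⟩ * (ofSpace w).U ⟨i + 1, h'⟩) +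
      t • ((ofSpace w).Z ⟨i, h⟩ * (ofSpace w).W i - (ofSpace w).W i * (ofSpace w).Z ⟨i + 1, h'⟩ -
        (ofSpace w).Ut ⟨i, h⟩ * (ofSpace w).U ⟨i + 1, h'⟩))
  simp only [Matrix.mul_add, Matrix.add_mul, Matrix.smul_mul, Matrix.mul_smul]
  module

theorem linearMap_matrix_eq_trace {α β : Type} [Fintype α] [Fintype β] [DecidableEq α]
    [DecidableEq β] (φ : Matrix α β ℂ →ₗ[ℂ] ℂ) :
    ∃ Y : Matrix β α ℂ, ∀ M, φ M = (Y * M).trace := by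
  refine ⟨Matrix.of fun b a => φ (Matrix.single a b 1), fun M => ?_⟩
  conv_lhs => rw [Matrix.matrix_eq_sum_single M]
  simp only [map_sum, Matrix.trace, Matrix.diag, Matrix.mul_apply, Matrix.of_apply]
  rw [Finset.sum_comm]
  refine Finset.sum_congr rfl fun b _ => Finset.sum_congr rfl fun a _ => ?_
  have : Matrix.single a b (M a b) = M a b • Matrix.single a b (1 : ℂ) := by
    rw [Matrix.smul_single, smul_eq_mul, mul_one]
  rw [this, map_smul, smul_eq_mul, mul_comm]

/-- A functional annihilating the image is `∑ tr (Y_i ·)`. Varying `W_i` gives `Y_i Z_i = Z_{i+1}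
Y_i`, varying `Υ̃_i` gives `Υ_{i+1} Y_i = 0`, and varying `Z_i` gives `W_i Y_i = Y_{i-1} W_{i-1}`.
Inductively `Y_{i-1} = 0`, so `Ψ_{i+1} Y_i = 0`, and the commutation relation extends this to
`Ψ_{i+1} Z_{i+1} ^ a Y_i = 0`. Observability at the node `i+1` gives `Y_i = 0`. -/
theorem linConstr_surjective {d : Data n k L} (hd : d.Free) :
    Function.Surjective d.linConstr := by
  rw [← LinearMap.range_eq_top]
  by_contra hne
  obtain ⟨φ, hφ, hle⟩ := Submodule.exists_le_ker_of_lt_top _ (lt_top_iff_ne_top.2 hne)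
  have hzero : ∀ v, φ (d.linConstr v) = 0 := fun v => hle ⟨v, rfl⟩
  have hY := fun i : Fin (L - 1) => linearMap_matrix_eq_trace (φ ∘ₗ LinearMap.single ℂ
    (fun i : Fin (L - 1) => Matrix (Fin (k i)) (Fin (k (i + 1))) ℂ) i)
  choose Y hY using hY
  have hsum : ∀ y, φ y = ∑ i, (Y i * y i).trace := by
    intro y
    have h : y = ∑ i, LinearMap.single ℂ
        (fun i : Fin (L - 1) => Matrix (Fin (k i)) (Fin (k (i + 1))) ℂ) i (y i) := by
      simp only [LinearMap.coe_single]
      exact (Finset.univ_sum_single y).symm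
    conv_lhs => rw [h, map_sum]
    exact Finset.sum_congr rfl fun i _ => hY i (y i)
  have hcomm : ∀ (i : Fin (L - 1)) (h : (i : ℕ) < L) (h' : (i : ℕ) + 1 < L),
      Y i * d.Z ⟨i, h⟩ = d.Z ⟨i + 1, h'⟩ * Y i := by
    intro i h h'
    rw [Matrix.ext_iff_trace_mul_right]
    intro M
    let s : (j : Fin (L - 1)) → Matrix (Fin (k j)) (Fin (k (j + 1))) ℂ := Pi.single i M
    have hs : s i = M := Pi.single_eq_same (M := fun j : Fin (L - 1) =>
      Matrix (Fin (k j)) (Fin (k (j + 1))) ℂ) i M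
    have h1 := hzero (⟨0, 0, 0, s⟩ : Data n k L).toSpace
    have h4 : ∀ (j : Fin (L - 1)) (hj : (j : ℕ) < L) (hj' : (j : ℕ) + 1 < L),
        d.linConstr (⟨0, 0, 0, s⟩ : Data n k L).toSpace j =
        d.Z ⟨j, hj⟩ * s j - s j * d.Z ⟨j + 1, hj'⟩ := by
      intro j hj hj'
      rw [linConstr_apply d _ j hj hj']
      simp only [Pi.zero_apply, Matrix.zero_mul, Matrix.mul_zero, zero_add, sub_zero]
    rw [hsum, Finset.sum_eq_single i] at h1
    · rw [h4 i h h', hs, Matrix.mul_sub, Matrix.trace_sub, sub_eq_zero] at h1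
      rw [Matrix.mul_assoc]
      refine h1.trans ?_
      rw [← Matrix.mul_assoc, Matrix.trace_mul_comm, ← Matrix.mul_assoc]
    · intro j _ hj
      have hj1 : (j : ℕ) < L := by omega
      have hj2 : (j : ℕ) + 1 < L := by omega
      have h3 : s j = 0 := Pi.single_eq_of_ne (M := fun j : Fin (L - 1) =>
        Matrix (Fin (k j)) (Fin (k (j + 1))) ℂ) hj M
      rw [h4 j hj1 hj2, h3, Matrix.mul_zero, Matrix.zero_mul, sub_zero, Matrix.mul_zero,
        Matrix.trace_zero]
    · exact fun h => absurd (Finset.mem_univ _) h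
  have hU : ∀ (i : Fin (L - 1)) (h' : (i : ℕ) + 1 < L), d.U ⟨i + 1, h'⟩ * Y i = 0 := by
    intro i h'
    have h : (i : ℕ) < L := by omega
    rw [Matrix.ext_iff_trace_mul_right]
    intro M
    let s : (j : Fin L) → Matrix (Fin (k j)) (Fin (n (j + 1))) ℂ := Pi.single ⟨i, h⟩ M
    have hs : s ⟨i, h⟩ = M := Pi.single_eq_same (M := fun j : Fin L =>
      Matrix (Fin (k j)) (Fin (n (j + 1))) ℂ) ⟨i, h⟩ M
    have h1 := hzero (⟨0, 0, s, 0⟩ : Data n k L).toSpace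
    have h4 : ∀ (j : Fin (L - 1)) (hj : (j : ℕ) < L) (hj' : (j : ℕ) + 1 < L),
        d.linConstr (⟨0, 0, s, 0⟩ : Data n k L).toSpace j = - (s ⟨j, hj⟩ * d.U ⟨j + 1, hj'⟩) := by
      intro j hj hj'
      rw [linConstr_apply d _ j hj hj']
      simp only [Pi.zero_apply, Matrix.zero_mul, Matrix.mul_zero, zero_add, sub_zero, zero_sub]
    rw [hsum, Finset.sum_eq_single i] at h1
    · rw [h4 i h h', hs, Matrix.mul_neg, Matrix.trace_neg, neg_eq_zero] at h1
      rw [Matrix.zero_mul, Matrix.trace_zero, Matrix.mul_assoc, Matrix.trace_mul_comm]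
      refine Eq.trans ?_ h1
      rw [Matrix.mul_assoc]
    · intro j _ hj
      have hj1 : (j : ℕ) < L := by omega
      have hj2 : (j : ℕ) + 1 < L := by omega
      have h3 : s ⟨j, hj1⟩ = 0 := Pi.single_eq_of_ne (M := fun j : Fin L =>
        Matrix (Fin (k j)) (Fin (n (j + 1))) ℂ) (fun h => hj (Fin.ext (Fin.mk.inj h))) M
      rw [h4 j hj1 hj2, h3, Matrix.zero_mul, neg_zero, Matrix.mul_zero, Matrix.trace_zero]
    · exact fun h => absurd (Finset.mem_univ _) h
  have hY0 : ∀ (m : ℕ) (i : Fin (L - 1)), (i : ℕ) = m → Y i = 0 := by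
    intro m
    induction m using Nat.strong_induction_on with
    | _ m ih =>
    intro i him
    have h : (i : ℕ) < L := by omega
    have h' : (i : ℕ) + 1 < L := by omega
    -- Only `Z_i` is varied: it enters the constraints `i - 1` and `i`, and the former drops out
    -- since `Y_{i-1} = 0`.
    have hW : d.W i * Y i = 0 := by
      rw [Matrix.ext_iff_trace_mul_right]
      intro M
      let s : (j : Fin L) → Matrix (Fin (k j)) (Fin (k j)) ℂ := Pi.single ⟨i, h⟩ M
      have hs : s ⟨i, h⟩ = M := Pi.single_eq_same (M := fun j : Fin L =>
        Matrix (Fin (k j)) (Fin (k j)) ℂ) ⟨i, h⟩ M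
      have h1 := hzero (⟨s, 0, 0, 0⟩ : Data n k L).toSpace
      have h4 : ∀ (j : Fin (L - 1)) (hj : (j : ℕ) < L) (hj' : (j : ℕ) + 1 < L),
          d.linConstr (⟨s, 0, 0, 0⟩ : Data n k L).toSpace j =
          s ⟨j, hj⟩ * d.W j - d.W j * s ⟨j + 1, hj'⟩ := by
        intro j hj hj'
        rw [linConstr_apply d _ j hj hj']
        simp only [Pi.zero_apply, Matrix.zero_mul, Matrix.mul_zero, add_zero, sub_zero]
      have h5 : ∀ (j : ℕ) (hj : j < L), j ≠ i → s ⟨j, hj⟩ = 0 := fun j hj hne =>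
        Pi.single_eq_of_ne (M := fun j : Fin L => Matrix (Fin (k j)) (Fin (k j)) ℂ)
          (fun h => hne (Fin.mk.inj h)) M
      rw [hsum, Finset.sum_eq_single i] at h1
      · rw [h4 i h h', hs, h5 _ h' (Nat.succ_ne_self _), Matrix.mul_zero, sub_zero] at h1
        rw [Matrix.zero_mul, Matrix.trace_zero, ← h1, Matrix.mul_assoc, Matrix.trace_mul_comm,
          Matrix.mul_assoc]
      · intro j _ hj
        have hne : (j : ℕ) ≠ i := fun h => hj (Fin.ext h)
        rcases lt_or_gt_of_ne hne with hlt | hgt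
        · rw [ih j (him ▸ hlt) j rfl, Matrix.zero_mul, Matrix.trace_zero]
        · have hj1 : (j : ℕ) < L := by omega
          have hj2 : (j : ℕ) + 1 < L := by omega
          rw [h4 j hj1 hj2, h5 _ hj1 hne, h5 _ hj2 (by omega), Matrix.mul_zero, Matrix.zero_mul,
            sub_zero, Matrix.mul_zero, Matrix.trace_zero]
      · exact fun h => absurd (Finset.mem_univ _) h
    have hPsi : d.Psi ⟨i + 1, h'⟩ * Y i = 0 := by
      ext1 a b
      refine Col.cases (p := fun a => (d.Psi ⟨i + 1, h'⟩ * Y i) a b = 0) (fun a => ?_)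
        (fun a => ?_) a
      · have h1 : ((d.Psi ⟨i + 1, h'⟩).submatrix Col.castSucc id * Y i) a b = 0 := by
          rw [Psi_castSucc d h', Matrix.mul_assoc]
          have h2 : d.W ⟨i, i.2⟩ * Y i = 0 := hW
          rw [h2, Matrix.mul_zero, Matrix.zero_apply]
        exact h1
      · have h1 : ((d.Psi ⟨i + 1, h'⟩).submatrix Col.last id * Y i) a b = 0 := by
          rw [Psi_last d h', hU i h', Matrix.zero_apply]
        exact h1
    have hpow : ∀ a, d.Z ⟨i + 1, h'⟩ ^ a * Y i = Y i * d.Z ⟨i, h⟩ ^ a := by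
      intro a
      induction a with
      | zero => rw [pow_zero, pow_zero, Matrix.one_mul, Matrix.mul_one]
      | succ a iha =>
        rw [pow_succ, Matrix.mul_assoc, ← hcomm i h h', ← Matrix.mul_assoc, iha, Matrix.mul_assoc,
          ← pow_succ]
    ext1 b c
    have h6 := d.free_iff.1 hd ⟨i + 1, h'⟩ (fun b => Y i b c) (fun a => by
      have h7 : d.Psi ⟨i + 1, h'⟩ * d.Z ⟨i + 1, h'⟩ ^ a * Y i = 0 := by
        rw [Matrix.mul_assoc, hpow, ← Matrix.mul_assoc, hPsi, Matrix.zero_mul]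
      funext r
      exact congrFun (congrFun h7 r) c)
    exact congrFun h6 b
  refine hφ (LinearMap.ext fun y => ?_)
  rw [hsum]
  exact Finset.sum_eq_zero fun i _ => by rw [hY0 i i rfl, Matrix.zero_mul, Matrix.trace_zero]

/-- The tuple `(G_i⁻¹ Z_i G_i, Υ_i G_i, G_i⁻¹ Υ̃_i, G_i⁻¹ W_i G_{i+1})`. -/
def conj (d : Data n k L) (G : (i : Fin L) → Matrix (Fin (k i)) (Fin (k i)) ℂ) : Data n k L where
  Z i := (G i)⁻¹ * d.Z i * G i
  U i := d.U i * G i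
  Ut i := (G i)⁻¹ * d.Ut i
  W i := (G ⟨i, by omega⟩)⁻¹ * d.W i * G ⟨i + 1, by omega⟩

theorem conj_val (d : Data n k L) (g : Gauge k L) : d.conj (fun i => (g i).val) = d.act g := by
  ext1 <;> funext i <;> simp only [conj, act, Matrix.coe_units_inv]

theorem IsAnalytic.conj {E : Type} [NormedAddCommGroup E] [NormedSpace ℂ E] {s : Set E}
    {d : E → Data n k L} (hd : IsAnalytic s d)
    {G : E → (i : Fin L) → Matrix (Fin (k i)) (Fin (k i)) ℂ}
    (hG : ∀ i, ContDiffMat s (fun v => G v i)) (h : ∀ v ∈ s, ∀ i, (G v i).det ≠ 0) :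
    IsAnalytic s (fun v => (d v).conj (G v)) :=
  have hi := fun i => (hG i).inv (fun v hv => h v hv i)
  ⟨fun i => ((hi i).mul (hd.Z i)).mul (hG i), fun i => (hd.U i).mul (hG i),
    fun i => (hi i).mul (hd.Ut i), fun i => ((hi _).mul (hd.W i)).mul (hG _)⟩

theorem conj_eq_act (d : Data n k L) {G : (i : Fin L) → Matrix (Fin (k i)) (Fin (k i)) ℂ}
    (h : ∀ i, (G i).det ≠ 0) : ∃ g : Gauge k L, (∀ i, (g i).val = G i) ∧ d.conj G = d.act g := by
  have h1 := fun i => (Matrix.isUnit_iff_isUnit_det _).2 (h i).isUnit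
  choose g hg using h1
  refine ⟨g, hg, ?_⟩
  rw [← conj_val]
  exact congrArg _ (funext fun i => (hg i).symm)

/-- The space of defects of the constraints. -/
abbrev ConstrSpace (k : ℕ → ℕ) (L : ℕ) : Type :=
  (i : Fin (L - 1)) → Fin (k i) → Fin (k (i + 1)) → ℂ

/-- The space of frames. -/
abbrev FrameSpace (k : ℕ → ℕ) (L : ℕ) : Type := (i : Fin L) → Fin (k i) → Fin (k i) → ℂ

/-- The defect of the constraints, as a vector. -/
def constrVec (d : Data n k L) : ConstrSpace k L := d.constr

/-- A tuple of square matrices, as a vector. -/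
def frameVec (G : (i : Fin L) → Matrix (Fin (k i)) (Fin (k i)) ℂ) : FrameSpace k L := G

/-- The defect of the constraints together with the selected frame. -/
def sliceMap (e : (i : Fin L) → Fin (k i) → Col n (i + 1) × ℕ) (v : DataSpace n k L) :
    ConstrSpace k L × FrameSpace k L :=
  ((ofSpace v).constrVec, frameVec fun i => (ofSpace v).frame e i)

theorem IsAnalytic.constr {E : Type} [NormedAddCommGroup E] [NormedSpace ℂ E] {s : Set E}
    {d : E → Data n k L} (hd : IsAnalytic s d) (i : Fin (L - 1)) :
    ContDiffMat s (fun v => (d v).constr i) := by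
  have h : (i : ℕ) < L := by omega
  have h' : (i : ℕ) + 1 < L := by omega
  exact (((hd.Z ⟨i, h⟩).mul (hd.W i)).sub ((hd.W i).mul (hd.Z ⟨i + 1, h'⟩))).sub
    ((hd.Ut ⟨i, h⟩).mul (hd.U ⟨i + 1, h'⟩))

theorem contDiff_sliceMap (e : (i : Fin L) → Fin (k i) → Col n (i + 1) × ℕ) :
    ContDiff ℂ ω (sliceMap e) := by
  have h := isAnalytic_ofSpace (n := n) (k := k) (L := L) Set.univ
  have h1 : ContDiff ℂ ω (fun v : DataSpace n k L => (sliceMap e v).1) :=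
    contDiff_pi.2 fun i => contDiff_pi.2 fun a => contDiff_pi.2 fun b =>
      contDiffOn_univ.1 (h.constr i a b)
  have h2 : ContDiff ℂ ω (fun v : DataSpace n k L => (sliceMap e v).2) :=
    contDiff_pi.2 fun i => contDiff_pi.2 fun a => contDiff_pi.2 fun b =>
      contDiffOn_univ.1 (h.frame e i a b)
  exact h1.prodMk h2

/-- The constraint component is onto by `linConstr_surjective`. The frame component is corrected
inside the gauge orbit, where the constraints persist and the frame can be moved in every direction.
-/
theorem fderiv_sliceMap_surjective {d : Data n k L}
    {e : (i : Fin L) → Fin (k i) → Col n (i + 1) × ℕ} (hd : d.Constraint)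
    (h : ∀ i, d.frame e i = 1) : Function.Surjective (fderiv ℂ (sliceMap e) d.toSpace) := by
  have hfree : d.Free := free_of_frame (e := e) fun i => by rw [h i, Matrix.det_one]; exact isUnit_one
  have hf : HasFDerivAt (sliceMap e) (fderiv ℂ (sliceMap e) d.toSpace) d.toSpace :=
    ((contDiff_sliceMap e).differentiable (by simp) d.toSpace).hasFDerivAt
  set f' := fderiv ℂ (sliceMap e) d.toSpace
  have h1 : ∀ w, (f' w).1 = d.linConstr w := by
    intro w
    have h2 : HasDerivAt (fun t : ℂ => sliceMap e (d.toSpace + t • w)) (f' w) 0 :=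
      hf.hasLineDerivAt w
    have h3 : HasDerivAt (fun t : ℂ => (sliceMap e (d.toSpace + t • w)).1) (f' w).1 0 :=
      (ContinuousLinearMap.fst ℂ (ConstrSpace k L) (FrameSpace k L)).hasFDerivAt.comp_hasDerivAt
        (0 : ℂ) h2
    let b : ConstrSpace k L := d.linConstr w
    let c : ConstrSpace k L := (ofSpace w).constrVec
    have h4 : HasDerivAt (fun t : ℂ => d.constrVec + t • (b + t • c)) b 0 := by
      have h5 : HasDerivAt (fun t : ℂ => b + t • c) c 0 := by
        have := ((hasDerivAt_id (0 : ℂ)).smul_const c).const_add b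
        rwa [one_smul] at this
      have h6 := ((hasDerivAt_id (0 : ℂ)).smul h5).const_add d.constrVec
      simpa using h6
    have h7 : (fun t : ℂ => (sliceMap e (d.toSpace + t • w)).1) =
        fun t : ℂ => d.constrVec + t • (b + t • c) :=
      funext fun t => constr_add_smul d w t
    rw [h7] at h3
    exact h3.unique h4
  -- The tangent of the orbit curve of `1 + t B`: along it the frame, initially `1`, is `1 + t B`.
  -- Only the `t` near `0` with invertible `1 + t B` matter.
  have h2 : ∀ B : FrameSpace k L, ∃ w, f' w = (0, B) := by
    intro B
    let G : ℂ → (i : Fin L) → Matrix (Fin (k i)) (Fin (k i)) ℂ := fun t i => 1 + t • Matrix.of (B i)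
    let s : Set ℂ := {t | ∀ i, (G t i).det ≠ 0}
    have hG : ∀ (s : Set ℂ) i, ContDiffMat s (fun t => G t i) := fun s i a b =>
      contDiffOn_const.add (contDiffOn_id.mul contDiffOn_const)
    have hs : IsOpen s := by
      have : s = ⋂ i, {t | (G t i).det ≠ 0} := by ext t; simp [s]
      rw [this]
      refine isOpen_iInter_of_finite fun i => isOpen_ne_fun ?_ continuous_const
      exact continuousOn_univ.1 (hG Set.univ i).det.continuousOn
    have h0 : (0 : ℂ) ∈ s := fun i => by simp [G]
    have hγ : ContDiffOn ℂ ω (fun t => (d.conj (G t)).toSpace) s := by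
      have hdc : IsAnalytic s (fun _ : ℂ => d) :=
        ⟨fun i => contDiffMat_const _, fun i => contDiffMat_const _, fun i => contDiffMat_const _,
          fun i => contDiffMat_const _⟩
      exact (hdc.conj (hG s) fun t ht => ht).toSpace
    have hγ0 : DifferentiableAt ℂ (fun t => (d.conj (G t)).toSpace) 0 :=
      (hγ.contDiffAt (hs.mem_nhds h0)).differentiableAt (by simp)
    have hval : ∀ t ∈ s, sliceMap e (d.conj (G t)).toSpace = (0, frameVec (fun i => 1) + t • B) := by
      intro t ht
      obtain ⟨g, hg, hgG⟩ := d.conj_eq_act ht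
      rw [hgG, sliceMap, ofSpace_toSpace]
      refine Prod.ext ((constraint_iff _).1 (hd.act g)) (funext fun i => ?_)
      change (d.act g).frame e i = _
      rw [frame_act, h, Matrix.one_mul, hg]
      rfl
    have hG0 : d.conj (G 0) = d := by
      have h5 : G 0 = fun i => ((1 : Gauge k L) i).val := by
        funext i
        simp [G]
      rw [h5, conj_val, act_one]
    refine ⟨deriv (fun t => (d.conj (G t)).toSpace) 0, ?_⟩
    have hf0 : HasFDerivAt (sliceMap e) f' (d.conj (G 0)).toSpace := by rwa [hG0]
    have h5 := hf0.comp_hasDerivAt (0 : ℂ) hγ0.hasDerivAt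
    have h6 : HasDerivAt (fun t : ℂ => ((0, frameVec (fun i => 1) + t • B) :
        ConstrSpace k L × FrameSpace k L)) (0, B) 0 := by
      have := ((hasDerivAt_id (0 : ℂ)).smul_const B).const_add (frameVec (k := k) (L := L) fun i => 1)
      rw [one_smul] at this
      exact (hasDerivAt_const _ _).prodMk this
    refine h5.unique (h6.congr_of_eventuallyEq ?_)
    filter_upwards [hs.mem_nhds h0] with t ht using hval t ht
  intro y
  obtain ⟨w, hw⟩ := linConstr_surjective hfree y.1
  obtain ⟨w', hw'⟩ := h2 (y.2 - (f' w).2)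
  refine ⟨w + w', ?_⟩
  rw [map_add, hw']
  refine Prod.ext ?_ ?_
  · change (f' w).1 + 0 = y.1
    rw [add_zero]
    exact (h1 w).trans hw
  · change (f' w).2 + (y.2 - (f' w).2) = y.2
    abel

end Data

end VortexQuiver
end

noncomputable section

namespace VortexQuiver

variable {n k : ℕ → ℕ} {L : ℕ}

/-! ### Slices -/

/-- The dimension of the moduli space. -/
abbrev dimension (n k : ℕ → ℕ) (L : ℕ) : ℕ := ∑ i : Fin L, k i * (n i + n (i + 1))

/-- The entries of `W` cancel against the constraints and those of `Z` against the frames, leaving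
`Υ` and `Υ̃`. -/
theorem finrank_dataSpace : Module.finrank ℂ (DataSpace n k L) =
    Module.finrank ℂ (Data.ConstrSpace k L × Data.FrameSpace k L) + dimension n k L := by
  simp only [Module.finrank_prod, Module.finrank_pi_fintype, Module.finrank_self, Finset.sum_const,
    Finset.card_univ, Fintype.card_fin, smul_eq_mul, mul_one, dimension, mul_add,
    Finset.sum_add_distrib]
  rw [Finset.sum_congr rfl fun (i : Fin L) _ => mul_comm (n i) (k i)]
  ring

/-- A local slice for the gauge action: an invariant open set `O` of data, with an analytic chart
`chart`, constant along the orbits in `O`, and an analytic section `sec`, normalized with respect to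
a staircase. -/
structure Slice (n k : ℕ → ℕ) (L : ℕ) where
  base : HalfADHM n k L
  S : Staircase n k L
  O : Set (Data n k L)
  W : Set (Fin (dimension n k L) → ℂ)
  chart : Data n k L → Fin (dimension n k L) → ℂ
  sec : (Fin (dimension n k L) → ℂ) → Data n k L
  base_mem : base.1 ∈ O
  isOpen_O : IsOpen O
  isOpen_W : IsOpen W
  sec_mem : ∀ w ∈ W, sec w ∈ O
  sec_constraint : ∀ w ∈ W, (sec w).Constraint
  sec_frame : ∀ w ∈ W, ∀ i, (sec w).frame S.rows i = 1
  chart_sec : ∀ w ∈ W, chart (sec w) = w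
  chart_mem : ∀ d ∈ O, d.Constraint → chart d ∈ W
  sec_chart : ∀ d ∈ O, d.Constraint → ∃ g, sec (chart d) = d.act g
  act_mem : ∀ d ∈ O, ∀ g, d.act g ∈ O
  chart_act : ∀ d ∈ O, ∀ g, chart (d.act g) = chart d
  analytic_sec : Data.IsAnalytic W sec
  analytic_chart : ContDiffOn ℂ ω (fun v => chart (Data.ofSpace v)) (Data.ofSpace ⁻¹' O)

/-! ### Normalization of frames and existence of slices. -/

namespace Data

/-- The data normalized with respect to the selected frames. -/
def normalize (e : (i : Fin L) → Fin (k i) → Col n (i + 1) × ℕ) (d : Data n k L) : Data n k L :=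
  d.conj fun i => (d.frame e i)⁻¹

variable {e : (i : Fin L) → Fin (k i) → Col n (i + 1) × ℕ} {d : Data n k L}

theorem exists_normalize (h : ∀ i, (d.frame e i).det ≠ 0) :
    ∃ g : Gauge k L, (∀ i, (g i).val = (d.frame e i)⁻¹) ∧ d.normalize e = d.act g :=
  conj_eq_act d fun i => (Matrix.isUnit_nonsing_inv_det _ (h i).isUnit).ne_zero

theorem normalize_of_frame (h : ∀ i, d.frame e i = 1) : d.normalize e = d := by
  have h5 : (fun i => (d.frame e i)⁻¹) = fun i => ((1 : Gauge k L) i).val := by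
    funext i
    rw [h, inv_one]
    rfl
  rw [normalize, h5, conj_val, act_one]

theorem det_frame_act (h : ∀ i, (d.frame e i).det ≠ 0) (g : Gauge k L) (i : Fin L) :
    ((d.act g).frame e i).det ≠ 0 := by
  rw [frame_act, Matrix.det_mul]
  exact mul_ne_zero (h i) ((Matrix.isUnit_iff_isUnit_det _).1 (g i).isUnit).ne_zero

/-- The frame is multiplied by `g` along the orbit, so its inverse undoes `g`. -/
theorem normalize_act (h : ∀ i, (d.frame e i).det ≠ 0) (g : Gauge k L) :
    (d.act g).normalize e = d.normalize e := by
  obtain ⟨g1, hg1, h1⟩ := exists_normalize h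
  obtain ⟨g2, hg2, h2⟩ := exists_normalize (det_frame_act h g)
  rw [h1, h2, ← act_mul]
  congr 1
  funext i
  refine Units.ext ?_
  rw [Pi.mul_apply, Units.val_mul, hg2, hg1, frame_act, Matrix.mul_inv_rev, ← Matrix.mul_assoc,
    ← Matrix.coe_units_inv, mul_inv_val, Matrix.one_mul]

theorem frame_normalize (h : ∀ i, (d.frame e i).det ≠ 0) (i : Fin L) :
    (d.normalize e).frame e i = 1 := by
  obtain ⟨g1, hg1, h1⟩ := exists_normalize h
  rw [h1, frame_act, hg1, Matrix.mul_nonsing_inv _ (h i).isUnit]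

theorem isAnalytic_ofSpace_comp {E : Type} [NormedAddCommGroup E] [NormedSpace ℂ E] {s : Set E}
    {f : E → DataSpace n k L} (hf : ContDiffOn ℂ ω f s) : IsAnalytic s (fun v => ofSpace (f v)) :=
  have h := isAnalytic_ofSpace (n := n) (k := k) (L := L) Set.univ
  ⟨fun i a b => (h.Z i a b).comp hf (Set.mapsTo_univ _ _),
    fun i a b => (h.U i a b).comp hf (Set.mapsTo_univ _ _),
    fun i a b => (h.Ut i a b).comp hf (Set.mapsTo_univ _ _),
    fun i a b => (h.W i a b).comp hf (Set.mapsTo_univ _ _)⟩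

/-- Near the normalized base point, `Θ` straightens the map (constraints, frame). The normalized
data form the level set over `(0, 1)`, with coordinates `p`: the chart normalizes and applies `p`,
and the section is `Θ⁻¹` on that level. -/
theorem exists_slice (d₀ : HalfADHM n k L) : ∃ s : Slice n k L, s.base = d₀ := by
  obtain ⟨S, hS⟩ := d₀.2.2.exists_staircase
  set e := S.rows with he
  have hS' : ∀ i, (d₀.1.frame e i).det ≠ 0 := fun i => (hS i).ne_zero
  have hc0 : (d₀.1.normalize e).Constraint := by
    obtain ⟨g, -, hg⟩ := exists_normalize hS'
    rw [hg]; exact d₀.2.1.act g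
  obtain ⟨p, Θ, hx, hΘ, hΘs⟩ := exists_openPartialHomeomorph_of_surjective
    (contDiff_sliceMap e) (fderiv_sliceMap_surjective hc0 (frame_normalize hS')) finrank_dataSpace
  set y₀ : ConstrSpace k L × FrameSpace k L := (0, frameVec fun _ => 1)
  have hy₀ : ∀ v, sliceMap e v = y₀ ↔ (ofSpace v).Constraint ∧ ∀ i, (ofSpace v).frame e i = 1 := by
    intro v
    rw [constraint_iff, Prod.ext_iff, ← funext_iff]
    rfl
  let U : Set (Data n k L) := {d | ∀ i, (d.frame e i).det ≠ 0}
  have hU : IsOpen U := by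
    have : U = ⋂ i, {d | (d.frame e i).det ≠ 0} := by ext d; simp [U]
    rw [this]
    exact isOpen_iInter_of_finite fun i =>
      isOpen_ne_fun (continuous_frame e i).matrix_det continuous_const
  have hUs : IsOpen (ofSpace ⁻¹' U) := hU.preimage continuous_ofSpace
  have hN : ContDiffOn ℂ ω (fun v => ((ofSpace v).normalize e).toSpace) (ofSpace ⁻¹' U) := by
    have h1 := isAnalytic_ofSpace (n := n) (k := k) (L := L) (ofSpace ⁻¹' U)
    refine (h1.conj (fun i => (h1.frame e i).inv fun v hv => hv i) fun v hv i => ?_).toSpace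
    exact (Matrix.isUnit_nonsing_inv_det _ (hv i).isUnit).ne_zero
  -- Membership depends on the normalized data only, which makes `O` gauge invariant; the
  -- constraints are not imposed, so that `O` is open.
  let O : Set (Data n k L) := {d | d ∈ U ∧ (d.normalize e).toSpace ∈ Θ.source}
  have hO : IsOpen (ofSpace ⁻¹' O) :=
    hN.continuousOn.isOpen_inter_preimage hUs Θ.open_source
  have hsec : ∀ w, (y₀, w) ∈ Θ.target → ((ofSpace (Θ.symm (y₀, w))).Constraint ∧
      ∀ i, (ofSpace (Θ.symm (y₀, w))).frame e i = 1) ∧ p (Θ.symm (y₀, w)) = w := by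
    intro w hw
    have h1 := Θ.right_inv hw
    rw [hΘ] at h1
    exact ⟨(hy₀ _).1 (congrArg Prod.fst h1), congrArg Prod.snd h1⟩
  have hnorm : ∀ w, (y₀, w) ∈ Θ.target →
      ((ofSpace (Θ.symm (y₀, w))).normalize e).toSpace = Θ.symm (y₀, w) := by
    intro w hw
    rw [normalize_of_frame (hsec w hw).1.2, toSpace_ofSpace]
  have hchart : ∀ d ∈ O, d.Constraint → Θ (d.normalize e).toSpace = (y₀, p (d.normalize e).toSpace) := by
    intro d hd hdc
    obtain ⟨g, -, hg⟩ := exists_normalize hd.1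
    rw [hΘ]
    refine Prod.ext ((hy₀ _).2 ⟨?_, frame_normalize hd.1⟩) rfl
    rw [ofSpace_toSpace, hg]
    exact hdc.act g
  let s : Slice n k L :=
    { base := d₀
      S := S
      O := O
      W := {w | (y₀, w) ∈ Θ.target}
      chart := fun d => p (d.normalize e).toSpace
      sec := fun w => ofSpace (Θ.symm (y₀, w))
      base_mem := ⟨hS', hx⟩
      isOpen_O := hO.preimage continuous_toSpace
      isOpen_W := Θ.open_target.preimage (by fun_prop)
      sec_mem := fun w hw => ⟨fun i => by simp [(hsec w hw).1.2 i], by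
        rw [hnorm w hw]; exact Θ.map_target hw⟩
      sec_constraint := fun w hw => (hsec w hw).1.1
      sec_frame := fun w hw => (hsec w hw).1.2
      chart_sec := fun w hw => by rw [hnorm w hw]; exact (hsec w hw).2
      chart_mem := fun d hd hdc => by
        have := Θ.map_source hd.2
        rwa [hchart d hd hdc] at this
      sec_chart := fun d hd hdc => by
        obtain ⟨g, -, hg⟩ := exists_normalize hd.1
        refine ⟨g, ?_⟩
        rw [← hchart d hd hdc, Θ.left_inv hd.2, ofSpace_toSpace, hg]
      act_mem := fun d hd g => ⟨det_frame_act hd.1 g, by rw [normalize_act hd.1]; exact hd.2⟩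
      chart_act := fun d hd g => by rw [normalize_act hd.1]
      analytic_sec := isAnalytic_ofSpace_comp
        (hΘs.comp (contDiffOn_const.prodMk contDiffOn_id) fun w hw => hw)
      analytic_chart := p.contDiff.comp_contDiffOn (hN.mono fun v hv => hv.1) }
  exact ⟨s, rfl⟩

end Data

/-! ### The chart of the quotient attached to a slice. -/

namespace Slice

theorem free_sec (s : Slice n k L) {w : Fin (dimension n k L) → ℂ} (h : w ∈ s.W) :
    (s.sec w).Free :=
  Data.free_of_frame (e := s.S.rows) fun i => by
    rw [s.sec_frame w h, Matrix.det_one]; exact isUnit_one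

open Classical in
/-- The section of a slice, with values in the quotient. -/
def toQuotient (s : Slice n k L) (w : Fin (dimension n k L) → ℂ) : HalfADHMQuotient n k L :=
  if h : w ∈ s.W then Quotient.mk _ ⟨s.sec w, s.sec_constraint w h, s.free_sec h⟩
  else Quotient.mk _ s.base

theorem toQuotient_eq (s : Slice n k L) {w : Fin (dimension n k L) → ℂ} (h : w ∈ s.W) :
    s.toQuotient w = Quotient.mk _ ⟨s.sec w, s.sec_constraint w h, s.free_sec h⟩ :=
  dif_pos h

/-- The open set of classes covered by a slice. -/
def domain (s : Slice n k L) : Set (HalfADHMQuotient n k L) := {p | p.out.1 ∈ s.O}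

theorem exists_out_eq (d : HalfADHM n k L) :
    ∃ g, (Quotient.mk (gaugeSetoid n k L) d).out.1 = d.1.act g :=
  Quotient.exact (s := gaugeSetoid n k L) (Quotient.out_eq _).symm

/-- `s.O` is gauge invariant, so the arbitrary representative `Quotient.out` may be replaced by any
other. -/
theorem mk_mem_domain (s : Slice n k L) (d : HalfADHM n k L) :
    Quotient.mk _ d ∈ s.domain ↔ d.1 ∈ s.O := by
  obtain ⟨g, hg⟩ := exists_out_eq d
  change (Quotient.mk _ d).out.1 ∈ s.O ↔ _
  rw [hg]
  refine ⟨fun h => ?_, fun h => s.act_mem _ h g⟩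
  have := s.act_mem _ h g⁻¹
  rwa [← Data.act_mul, mul_inv_cancel, Data.act_one] at this

/-- The chart of a slice on the quotient. -/
def quotChart (s : Slice n k L) (p : HalfADHMQuotient n k L) : Fin (dimension n k L) → ℂ :=
  s.chart p.out.1

theorem quotChart_mk (s : Slice n k L) {d : HalfADHM n k L} (h : d.1 ∈ s.O) :
    s.quotChart (Quotient.mk _ d) = s.chart d.1 := by
  obtain ⟨g, hg⟩ := exists_out_eq d
  rw [quotChart, hg, s.chart_act _ h]

theorem isOpen_domain (s : Slice n k L) : IsOpen s.domain := by
  rw [← isOpenQuotientMap_mk.isQuotientMap.isOpen_preimage]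
  have : Quotient.mk (gaugeSetoid n k L) ⁻¹' s.domain = Subtype.val ⁻¹' s.O := by
    ext d; exact s.mk_mem_domain d
  rw [this]
  exact s.isOpen_O.preimage continuous_subtype_val

theorem continuousOn_chart (s : Slice n k L) : ContinuousOn s.chart s.O :=
  s.analytic_chart.continuousOn.comp Data.continuous_toSpace.continuousOn fun _ hd => hd

/-- The chart of the quotient given by a slice. -/
def toChart (s : Slice n k L) :
    OpenPartialHomeomorph (HalfADHMQuotient n k L) (Fin (dimension n k L) → ℂ) where
  toFun := s.quotChart
  invFun := s.toQuotient
  source := s.domain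
  target := s.W
  map_source' := by
    rintro ⟨d⟩ hd
    have h := (s.mk_mem_domain d).1 hd
    exact (s.quotChart_mk h) ▸ s.chart_mem _ h d.2.1
  map_target' w hw := by
    rw [s.toQuotient_eq hw, s.mk_mem_domain]
    exact s.sec_mem w hw
  left_inv' := by
    rintro ⟨d⟩ hd
    have h := (s.mk_mem_domain d).1 hd
    change s.toQuotient (s.quotChart (Quotient.mk _ d)) = Quotient.mk _ d
    rw [s.quotChart_mk h, s.toQuotient_eq (s.chart_mem _ h d.2.1)]
    exact Quotient.sound (s := gaugeSetoid n k L)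
      (Setoid.symm (s.sec_chart _ h d.2.1 : d ≈ _))
  right_inv' w hw := by
    rw [s.toQuotient_eq hw]
    exact (s.quotChart_mk (s.sec_mem w hw)).trans (s.chart_sec w hw)
  open_source := s.isOpen_domain
  open_target := s.isOpen_W
  continuousOn_toFun := by
    have h0 := (isOpenQuotientMap_mk (n := n) (k := k)
      (L := L)).isQuotientMap.continuousOn_isOpen_iff (g := s.quotChart) s.isOpen_domain
    refine h0.2 ?_
    have h : ContinuousOn (fun d : HalfADHM n k L => s.chart d.1)
        (Quotient.mk (gaugeSetoid n k L) ⁻¹' s.domain) :=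
      s.continuousOn_chart.comp continuous_subtype_val.continuousOn fun d hd =>
        (s.mk_mem_domain d).1 hd
    exact h.congr fun d hd => s.quotChart_mk ((s.mk_mem_domain d).1 hd)
  continuousOn_invFun := by
    rw [continuousOn_iff_continuous_domRestrict]
    have h : Continuous fun w : s.W => s.sec w :=
      (Data.continuous_ofSpace.comp_continuousOn
        s.analytic_sec.toSpace.continuousOn).domRestrict
    have h2 : Continuous fun w : s.W =>
        (⟨s.sec w, s.sec_constraint w w.2, s.free_sec w.2⟩ : HalfADHM n k L) := h.subtype_mk _
    exact (continuous_quotient_mk'.comp h2).congr fun w => (s.toQuotient_eq w.2).symm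

end Slice

/-! ### The manifold structure -/

theorem exists_slice_mem_domain (p : HalfADHMQuotient n k L) : ∃ s : Slice n k L, p ∈ s.domain := by
  obtain ⟨d, rfl⟩ := Quotient.mk_surjective p
  obtain ⟨s, rfl⟩ := Data.exists_slice d
  exact ⟨s, (s.mk_mem_domain _).2 s.base_mem⟩

/-- The charts given by all slices. -/
@[reducible] def sliceChartedSpace (n k : ℕ → ℕ) (L : ℕ) :
    ChartedSpace (Fin (dimension n k L) → ℂ) (HalfADHMQuotient n k L) where
  atlas := Set.range Slice.toChart
  chartAt p := (exists_slice_mem_domain p).choose.toChart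
  mem_chart_source p := (exists_slice_mem_domain p).choose_spec
  chart_mem_atlas _ := ⟨_, rfl⟩

/-- The transition map is the analytic section of one slice followed by the analytic chart of the
other. -/
theorem contDiffOn_transition (s s' : Slice n k L) :
    ContDiffOn ℂ ω (s.toChart.symm ≫ₕ s'.toChart) (s.toChart.symm ≫ₕ s'.toChart).source := by
  have hmem : ∀ w ∈ (s.toChart.symm ≫ₕ s'.toChart).source, w ∈ s.W ∧ s.sec w ∈ s'.O := by
    rintro w ⟨hw, hw'⟩
    refine ⟨hw, ?_⟩
    change s.toQuotient w ∈ s'.domain at hw'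
    rwa [s.toQuotient_eq hw, s'.mk_mem_domain] at hw'
  have h : ContDiffOn ℂ ω (fun w => s'.chart (s.sec w)) (s.toChart.symm ≫ₕ s'.toChart).source :=
    s'.analytic_chart.comp (s.analytic_sec.toSpace.mono fun w hw => (hmem w hw).1)
      fun w hw => (hmem w hw).2
  refine h.congr fun w hw => ?_
  change s'.quotChart (s.toQuotient w) = _
  rw [s.toQuotient_eq (hmem w hw).1]
  exact s'.quotChart_mk (hmem w hw).2

theorem isManifold_quotient :
    letI := sliceChartedSpace n k L
    IsManifold 𝓘(ℂ, Fin (dimension n k L) → ℂ) ω (HalfADHMQuotient n k L) := by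
  let := sliceChartedSpace n k L
  refine isManifold_of_contDiffOn _ _ _ ?_
  rintro _ _ ⟨s, rfl⟩ ⟨s', rfl⟩
  refine (contDiffOn_transition s s').congr_mono (fun w hw => rfl) fun w hw => hw.1

end VortexQuiver
end

noncomputable section

namespace VortexQuiver

variable {n k : ℕ → ℕ} {L : ℕ}

/-! ### Holomorphic families of data -/

section

attribute [local instance] sliceChartedSpace

theorem Slice.mem_maximalAtlas (s : Slice n k L) :
    s.toChart ∈ IsManifold.maximalAtlas 𝓘(ℂ, Fin (dimension n k L) → ℂ) ω
      (HalfADHMQuotient n k L) := by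
  have := isManifold_quotient (n := n) (k := k) (L := L)
  exact IsManifold.subset_maximalAtlas (⟨s, rfl⟩ : s.toChart ∈ Set.range Slice.toChart)

theorem Slice.mdifferentiableOn_comp (s : Slice n k L) {g : (Fin (dimension n k L) → ℂ) → ℂ}
    (hg : DifferentiableOn ℂ g s.W) :
    MDifferentiableOn 𝓘(ℂ, Fin (dimension n k L) → ℂ) 𝓘(ℂ, ℂ) (fun x => g (s.quotChart x))
      s.domain := by
  have := isManifold_quotient (n := n) (k := k) (L := L)
  have h : MDifferentiableOn 𝓘(ℂ, Fin (dimension n k L) → ℂ) 𝓘(ℂ, Fin (dimension n k L) → ℂ)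
      s.toChart s.domain :=
    (contMDiffOn_of_mem_maximalAtlas s.mem_maximalAtlas).mdifferentiableOn (by simp)
  exact (mdifferentiableOn_iff_differentiableOn.2 hg).comp h fun x hx => s.toChart.map_source hx

/-- Near `t₀` the data stay in the open set of one slice, so the class is the inverse chart applied
to `s.chart (d t)`. -/
theorem mdifferentiableAt_mk {E : Type} [NormedAddCommGroup E] [NormedSpace ℂ E]
    {d : E → HalfADHM n k L} {t₀ : E}
    (h : DifferentiableAt ℂ (fun t => (d t).1.toSpace) t₀) :
    MDifferentiableAt 𝓘(ℂ, E) 𝓘(ℂ, Fin (dimension n k L) → ℂ)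
      (fun t => (Quotient.mk _ (d t) : HalfADHMQuotient n k L)) t₀ := by
  have := isManifold_quotient (n := n) (k := k) (L := L)
  obtain ⟨s, hs⟩ := exists_slice_mem_domain (Quotient.mk _ (d t₀))
  rw [s.mk_mem_domain] at hs
  have hO : (d t₀).1.toSpace ∈ (Data.ofSpace ⁻¹' s.O : Set (DataSpace n k L)) := hs
  have hOo : IsOpen (Data.ofSpace ⁻¹' s.O : Set (DataSpace n k L)) :=
    s.isOpen_O.preimage Data.continuous_ofSpace
  have hev := h.continuousAt.eventually (hOo.mem_nhds hO)
  have h1 : DifferentiableAt ℂ (fun t => s.chart (d t).1) t₀ :=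
    DifferentiableAt.comp (g := fun v => s.chart (Data.ofSpace v)) t₀
      ((s.analytic_chart.differentiableOn (by simp)).differentiableAt (hOo.mem_nhds hO)) h
  have hW := s.chart_mem _ hs (d t₀).2.1
  have h2 : MDifferentiableAt 𝓘(ℂ, Fin (dimension n k L) → ℂ) 𝓘(ℂ, Fin (dimension n k L) → ℂ)
      s.toChart.symm (s.chart (d t₀).1) :=
    (contMDiffAt_symm_of_mem_maximalAtlas s.mem_maximalAtlas hW).mdifferentiableAt (by simp)
  refine (h2.comp t₀ h1.mdifferentiableAt).congr_of_eventuallyEq ?_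
  filter_upwards [hev] with t ht
  change _ = s.toChart.symm (s.chart (d t).1)
  rw [← s.quotChart_mk ht]
  exact (s.toChart.left_inv ((s.mk_mem_domain _).2 ht)).symm

theorem Data.differentiableAt_toSpace {E : Type} [NormedAddCommGroup E] [NormedSpace ℂ E]
    {d : E → Data n k L} {t₀ : E} (hZ : ∀ i a b, DifferentiableAt ℂ (fun t => (d t).Z i a b) t₀)
    (hU : ∀ i a b, DifferentiableAt ℂ (fun t => (d t).U i a b) t₀)
    (hUt : ∀ i a b, DifferentiableAt ℂ (fun t => (d t).Ut i a b) t₀)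
    (hW : ∀ i a b, DifferentiableAt ℂ (fun t => (d t).W i a b) t₀) :
    DifferentiableAt ℂ (fun t => (d t).toSpace) t₀ := by
  have h1 : DifferentiableAt ℂ (fun t => (d t).toSpace.1) t₀ :=
    differentiableAt_pi.2 fun i => differentiableAt_pi.2 fun a => differentiableAt_pi.2 fun b => hZ i a b
  have h2 : DifferentiableAt ℂ (fun t => (d t).toSpace.2.1) t₀ :=
    differentiableAt_pi.2 fun i => differentiableAt_pi.2 fun a => differentiableAt_pi.2 fun b => hU i a b
  have h3 : DifferentiableAt ℂ (fun t => (d t).toSpace.2.2.1) t₀ :=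
    differentiableAt_pi.2 fun i => differentiableAt_pi.2 fun a => differentiableAt_pi.2 fun b => hUt i a b
  have h4 : DifferentiableAt ℂ (fun t => (d t).toSpace.2.2.2) t₀ :=
    differentiableAt_pi.2 fun i => differentiableAt_pi.2 fun a => differentiableAt_pi.2 fun b => hW i a b
  exact h1.prodMk (h2.prodMk (h3.prodMk h4))

theorem mdifferentiableOn_mk {E : Type} [NormedAddCommGroup E] [NormedSpace ℂ E] {T : Set E}
    {d : E → HalfADHM n k L} (hT : IsOpen T) (hd : HolomorphicData E T (fun t => (d t).1)) :
    MDifferentiableOn 𝓘(ℂ, E) 𝓘(ℂ, Fin (dimension n k L) → ℂ)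
      (fun t => (Quotient.mk _ (d t) : HalfADHMQuotient n k L)) T := by
  intro t ht
  have h : ∀ {f : E → ℂ}, MDifferentiableOn 𝓘(ℂ, E) 𝓘(ℂ, ℂ) f T → DifferentiableAt ℂ f t :=
    fun hf => (mdifferentiableOn_iff_differentiableOn.1 hf).differentiableAt (hT.mem_nhds ht)
  exact (mdifferentiableAt_mk (Data.differentiableAt_toSpace (fun i a b => h (hd.Z i a b))
    (fun i a b => h (hd.U i a b)) (fun i a b => h (hd.Ut i a b))
    (fun i a b => h (hd.W i a b)))).mdifferentiableWithinAt

open Classical in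
/-- The normalized data of a slice, parametrized by the quotient. -/
def Slice.family (s : Slice n k L) (p : HalfADHMQuotient n k L) : HalfADHM n k L :=
  if h : p ∈ s.domain then ⟨s.sec (s.quotChart p), s.sec_constraint _ (s.toChart.map_source h),
    s.free_sec (s.toChart.map_source h)⟩ else s.base

theorem Slice.family_val (s : Slice n k L) {p : HalfADHMQuotient n k L} (h : p ∈ s.domain) :
    (s.family p).1 = s.sec (s.quotChart p) := by
  rw [family, dif_pos h]

theorem Slice.mk_family (s : Slice n k L) {p : HalfADHMQuotient n k L} (h : p ∈ s.domain) :
    Quotient.mk _ (s.family p) = p := by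
  rw [family, dif_pos h]
  exact (s.toQuotient_eq (s.toChart.map_source h)).symm.trans (s.toChart.left_inv h)

theorem Slice.holomorphicData_family (s : Slice n k L) :
    HolomorphicData (Fin (dimension n k L) → ℂ) s.domain (fun x => (s.family x).1) := by
  have h := s.analytic_sec
  have hω : (ω : WithTop ℕ∞) ≠ 0 := by simp
  refine ⟨fun i a b => ?_, fun i a b => ?_, fun i a b => ?_, fun i a b => ?_⟩
  · exact (s.mdifferentiableOn_comp ((h.Z i a b).differentiableOn hω)).congr
      fun x hx => by rw [s.family_val hx]
  · exact (s.mdifferentiableOn_comp ((h.U i a b).differentiableOn hω)).congr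
      fun x hx => by rw [s.family_val hx]
  · exact (s.mdifferentiableOn_comp ((h.Ut i a b).differentiableOn hω)).congr
      fun x hx => by rw [s.family_val hx]
  · exact (s.mdifferentiableOn_comp ((h.W i a b).differentiableOn hω)).congr
      fun x hx => by rw [s.family_val hx]

end

end VortexQuiver
end

noncomputable section

namespace VortexQuiver

/-! ### Holomorphic families of polynomials -/

section HolPoly

variable {E : Type} [NormedAddCommGroup E] [NormedSpace ℂ E] {α β γ κ : Type} {s : Set E}

/-- A family of polynomials of bounded degree, with coefficients that are holomorphic on `s`. -/
structure HolPoly (s : Set E) (P : E → ℂ[X]) : Prop where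
  bounded : ∃ M : ℕ, ∀ v ∈ s, (P v).natDegree ≤ M
  coeff : ∀ l, DifferentiableOn ℂ (fun v => (P v).coeff l) s

namespace HolPoly

variable {P Q : E → ℂ[X]}

theorem congr (hP : HolPoly s P) (h : ∀ v ∈ s, Q v = P v) : HolPoly s Q :=
  ⟨hP.bounded.imp fun _ hM v hv => (h v hv).symm ▸ hM v hv,
    fun l => (hP.coeff l).congr fun v hv => by rw [h v hv]⟩

theorem const (p : ℂ[X]) : HolPoly s (fun _ => p) :=
  ⟨⟨p.natDegree, fun _ _ => le_rfl⟩, fun _ => differentiableOn_const _⟩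

theorem map_C {f : E → ℂ} (hf : DifferentiableOn ℂ f s) : HolPoly s (fun v => C (f v)) := by
  refine ⟨⟨0, fun v _ => (natDegree_C _).le⟩, fun l => ?_⟩
  simp only [coeff_C]
  split_ifs
  exacts [hf, differentiableOn_const _]

theorem add (hP : HolPoly s P) (hQ : HolPoly s Q) : HolPoly s (fun v => P v + Q v) := by
  obtain ⟨M, hM⟩ := hP.bounded
  obtain ⟨M', hM'⟩ := hQ.bounded
  refine ⟨⟨max M M', fun v hv => (natDegree_add_le _ _).trans (max_le_max (hM v hv) (hM' v hv))⟩,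
    fun l => ?_⟩
  simp only [coeff_add]
  exact (hP.coeff l).add (hQ.coeff l)

theorem mul (hP : HolPoly s P) (hQ : HolPoly s Q) : HolPoly s (fun v => P v * Q v) := by
  obtain ⟨M, hM⟩ := hP.bounded
  obtain ⟨M', hM'⟩ := hQ.bounded
  refine ⟨⟨M + M', fun v hv => natDegree_mul_le.trans (add_le_add (hM v hv) (hM' v hv))⟩,
    fun l => ?_⟩
  simp only [coeff_mul]
  exact DifferentiableOn.fun_sum fun x _ => (hP.coeff _).mul (hQ.coeff _)

theorem sub (hP : HolPoly s P) (hQ : HolPoly s Q) : HolPoly s (fun v => P v - Q v) := by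
  simpa [sub_eq_add_neg] using hP.add ((const (-1)).mul hQ)

theorem sum {ι : Type*} (u : Finset ι) {P : ι → E → ℂ[X]} (hP : ∀ i ∈ u, HolPoly s (P i)) :
    HolPoly s (fun v => ∑ i ∈ u, P i v) := by
  classical
  induction u using Finset.induction_on with
  | empty => simpa using const 0
  | insert i u hi ih =>
    simp only [Finset.sum_insert hi]
    exact (hP i (Finset.mem_insert_self i u)).add (ih fun j hj => hP j (Finset.mem_insert_of_mem hj))

theorem prod {ι : Type*} (u : Finset ι) {P : ι → E → ℂ[X]} (hP : ∀ i ∈ u, HolPoly s (P i)) :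
    HolPoly s (fun v => ∏ i ∈ u, P i v) := by
  classical
  induction u using Finset.induction_on with
  | empty => simpa using const 1
  | insert i u hi ih =>
    simp only [Finset.prod_insert hi]
    exact (hP i (Finset.mem_insert_self i u)).mul (ih fun j hj => hP j (Finset.mem_insert_of_mem hj))

/-- Division by a family of monic polynomials of constant degree. -/
theorem divByMonic {N : ℕ} (hP : HolPoly s P) (hQ : HolPoly s Q)
    (hm : ∀ v ∈ s, (Q v).Monic ∧ (Q v).natDegree = N) : HolPoly s (fun v => P v /ₘ Q v) := by
  obtain ⟨M, hM⟩ := hP.bounded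
  -- Long division: each round removes the coefficient of degree `M` by a multiple of the monic
  -- divisor whose coefficients are again holomorphic.
  induction M using Nat.strong_induction_on generalizing P with
  | _ M ih =>
  rcases lt_or_ge M N with hlt | hge
  · refine (const 0).congr fun v hv => ?_
    rw [divByMonic_eq_zero_iff (hm v hv).1]
    refine degree_lt_degree ?_
    rw [(hm v hv).2]
    exact (hM v hv).trans_lt hlt
  · have hcX : HolPoly s (fun v => C ((P v).coeff M) * X ^ (M - N)) :=
      (map_C (hP.coeff M)).mul (const _)
    have hdiv : ∀ v ∈ s, P v /ₘ Q v = C ((P v).coeff M) * X ^ (M - N) +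
        (P v - Q v * (C ((P v).coeff M) * X ^ (M - N))) /ₘ Q v := by
      intro v hv
      have hQ1 := (hm v hv).1
      set R := P v - Q v * (C ((P v).coeff M) * X ^ (M - N)) with hR
      refine (div_modByMonic_unique _ (R %ₘ Q v) hQ1 ⟨?_, degree_modByMonic_lt _ hQ1⟩).1
      have h1 := modByMonic_add_div R (Q v)
      rw [mul_add, add_left_comm, h1, hR]
      ring
    have hR := hP.sub (hQ.mul hcX)
    have hRM : ∀ v ∈ s, (P v - Q v * (C ((P v).coeff M) * X ^ (M - N))).natDegree ≤ M ∧
        (P v - Q v * (C ((P v).coeff M) * X ^ (M - N))).coeff M = 0 := by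
      intro v hv
      have h1 : (Q v * (C ((P v).coeff M) * X ^ (M - N))).natDegree ≤ M := by
        refine natDegree_mul_le.trans ?_
        have := natDegree_C_mul_X_pow_le ((P v).coeff M) (M - N)
        rw [(hm v hv).2]; omega
      refine ⟨(natDegree_sub_le _ _).trans (max_le (hM v hv) h1), ?_⟩
      have h2 : (Q v * (C ((P v).coeff M) * X ^ (M - N))).coeff M = (P v).coeff M := by
        have h3 : M = N + (M - N) := by omega
        conv_lhs => rw [show Q v * (C ((P v).coeff M) * X ^ (M - N)) =
          C ((P v).coeff M) * Q v * X ^ (M - N) by ring]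
        nth_rewrite 3 [h3]
        rw [coeff_mul_X_pow, coeff_C_mul]
        have h4 : (Q v).coeff N = 1 := by
          have := (hm v hv).1.coeff_natDegree
          rwa [(hm v hv).2] at this
        rw [h4, mul_one]
      rw [coeff_sub, h2, sub_self]
    -- For `M = 0` the degree bound cannot drop further, but the remaining polynomial is constant
    -- with vanishing coefficient.
    rcases Nat.eq_zero_or_pos M with h0 | hpos
    · refine hcX.congr fun v hv => ?_
      obtain ⟨h1, h2⟩ := hRM v hv
      have h3 : P v - Q v * (C ((P v).coeff M) * X ^ (M - N)) = 0 := by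
        subst h0
        rw [eq_C_of_natDegree_le_zero h1, h2, C_0]
      rw [hdiv v hv, h3, zero_divByMonic, add_zero]
    · refine (hcX.add (ih (M - 1) (by omega) hR fun v hv => ?_)).congr hdiv
      obtain ⟨h1, h2⟩ := hRM v hv
      refine natDegree_le_iff_coeff_eq_zero.2 fun l hl => ?_
      rcases eq_or_ne l M with rfl | hne
      · exact h2
      · exact coeff_eq_zero_of_natDegree_lt (h1.trans_lt (by omega))

end HolPoly

/-- All entries form holomorphic families of polynomials. -/
def HolPolyMat (s : Set E) (M : E → Matrix α β ℂ[X]) : Prop := ∀ a b, HolPoly s (fun v => M v a b)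

namespace HolPolyMat

theorem mul [Fintype β] {M : E → Matrix α β ℂ[X]} {N : E → Matrix β γ ℂ[X]}
    (hM : HolPolyMat s M) (hN : HolPolyMat s N) : HolPolyMat s (fun v => M v * N v) := by
  intro a c
  simp only [Matrix.mul_apply]
  exact HolPoly.sum _ fun b _ => (hM a b).mul (hN b c)

theorem sub {M N : E → Matrix α β ℂ[X]} (hM : HolPolyMat s M) (hN : HolPolyMat s N) :
    HolPolyMat s (fun v => M v - N v) := fun a b => (hM a b).sub (hN a b)

theorem const (M : Matrix α β ℂ[X]) : HolPolyMat s (fun _ : E => M) := fun _ _ => HolPoly.const _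

theorem map_C {M : E → Matrix α β ℂ} (hM : ∀ a b, DifferentiableOn ℂ (fun v => M v a b) s) :
    HolPolyMat s (fun v => (M v).map C) := fun a b => HolPoly.map_C (hM a b)

theorem det [Fintype α] [DecidableEq α] {M : E → Matrix α α ℂ[X]} (hM : HolPolyMat s M) :
    HolPoly s (fun v => (M v).det) := by
  simp only [Matrix.det_apply']
  exact HolPoly.sum _ fun σ _ => (HolPoly.const _).mul (HolPoly.prod _ fun i _ => hM _ _)

theorem adjugate [Fintype α] [DecidableEq α] {M : E → Matrix α α ℂ[X]} (hM : HolPolyMat s M) :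
    HolPolyMat s (fun v => (M v).adjugate) := by
  intro a b
  simp only [Matrix.adjugate_apply]
  refine det fun c d => ?_
  by_cases h : c = b
  · subst h; simp only [Matrix.updateRow_self]; exact HolPoly.const _
  · simp only [Matrix.updateRow_ne h]; exact hM c d

theorem rightDiv [Fintype β] [DecidableEq β] {P : E → Matrix α β ℂ[X]} {Q : E → Matrix β β ℂ[X]}
    {N : ℕ} (hP : HolPolyMat s P) (hQ : HolPolyMat s Q)
    (hm : ∀ v ∈ s, (Q v).det.Monic ∧ (Q v).det.natDegree = N) :
    HolPolyMat s (fun v => rightDiv (P v) (Q v)) :=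
  fun a b => ((hP.mul hQ.adjugate) a b).divByMonic hQ.det hm

end HolPolyMat

end HolPoly

variable {n k : ℕ → ℕ} {L : ℕ}

/-! ### The family of moduli matrices of a slice -/

namespace Data

variable {E : Type} [NormedAddCommGroup E] [NormedSpace ℂ E] {s : Set E} {d : E → Data n k L}

theorem _root_.VortexQuiver.ContDiffMat.holPolyMat {α β : Type} {M : E → Matrix α β ℂ}
    (hM : ContDiffMat s M) : HolPolyMat s (fun v => (M v).map C) :=
  HolPolyMat.map_C fun a b => (hM a b).differentiableOn (by simp)

theorem IsAnalytic.dMat (hd : IsAnalytic s d) (S : Staircase n k L) (i : Fin L) :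
    HolPolyMat s (fun v => (d v).dMat S i) := by
  intro a b
  have h : ∀ m, ContDiffMat s (fun v => (d v).Psi i * (d v).Z i ^ m) := fun m =>
    (hd.Psi i).mul ((hd.Z i).pow m)
  exact (HolPoly.const _).sub (HolPoly.sum _ fun c _ => ((h _).holPolyMat _ _).mul (HolPoly.const _))

theorem IsAnalytic.jMat (hd : IsAnalytic s d) (S : Staircase n k L) (i : Fin L) :
    HolPolyMat s (fun v => (d v).jMat S i) := by
  refine ((hd.dMat S i).mul (hd.Psi i).holPolyMat).rightDiv (N := k i) ?_ fun v _ => ?_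
  · simp only [charmatrix_eq]
    exact (HolPolyMat.const _).sub (hd.Z i).holPolyMat
  · refine ⟨(d v).Z i |>.charpoly_monic, ?_⟩
    have := ((d v).Z i).charpoly_natDegree_eq_dim
    rwa [Fintype.card_fin] at this

theorem IsAnalytic.toQ (hd : IsAnalytic s d) (S : Staircase n k L) (i : Fin L) :
    HolPolyMat s (fun v => (d v).toQ S i) := by
  have h1 : HolPolyMat s (fun v => (d v).dExtMat S i) := by
    intro a c
    by_cases h : (c.1 : ℕ) < i + 1
    · simp only [dExtMat, dif_pos h]
      exact hd.dMat S i _ _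
    · simp only [dExtMat, dif_neg h]
      exact ((hd.jMat S i).mul (hd.Ut i).holPolyMat) _ _
  by_cases h : (i : ℕ) + 1 < L
  · refine h1.rightDiv (N := k (i + 1)) ?_ fun v _ => ⟨dMatExt_det _, ?_⟩
    · simp only [dMatExt, dif_pos h]
      exact hd.dMat S _
    · simp only [dMatExt, dif_pos h]
      exact (dMat_det _).2
  · refine h1.rightDiv (N := 0) ?_ fun v _ => ⟨dMatExt_det _, ?_⟩
    · simp only [dMatExt, dif_neg h]
      exact HolPolyMat.const _
    · simp only [dMatExt, dif_neg h, Matrix.det_one, natDegree_one]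

end Data

open Classical in
/-- The moduli matrices of a slice, parametrized by the quotient. -/
def Slice.matrixFamily (s : Slice n k L) (p : HalfADHMQuotient n k L) : ModuliMatrix n k L :=
  if h : p ∈ s.domain then ⟨(s.sec (s.quotChart p)).toQ s.S,
    Data.isModuliMatrix_toQ (s.sec_frame _ (s.toChart.map_source h))
      (s.sec_constraint _ (s.toChart.map_source h))⟩ else s.base.exists_moduliMatrix.choose

theorem Slice.matrixFamily_val (s : Slice n k L) {p : HalfADHMQuotient n k L} (h : p ∈ s.domain) :
    (s.matrixFamily p).1 = (s.sec (s.quotChart p)).toQ s.S := by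
  rw [matrixFamily, dif_pos h]

theorem Slice.mappingRelation_family (s : Slice n k L) {p : HalfADHMQuotient n k L}
    (h : p ∈ s.domain) : ∃ J, MappingRelation (s.matrixFamily p).1 (s.family p).1 J := by
  rw [s.matrixFamily_val h, s.family_val h]
  exact ⟨_, Data.mappingRelation_toQ (s.sec_frame _ (s.toChart.map_source h))
      (s.sec_constraint _ (s.toChart.map_source h))⟩

section

attribute [local instance] sliceChartedSpace

theorem Slice.holomorphicQ_matrixFamily (s : Slice n k L) :
    HolomorphicQ (Fin (dimension n k L) → ℂ) s.domain (fun x => (s.matrixFamily x).1) := by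
  have h := s.analytic_sec.toQ s.S
  refine ⟨?_, fun i a b l => ?_⟩
  · choose M hM using fun i a b => (h i a b).bounded
    refine ⟨∑ i, ∑ a, ∑ b, M i a b, fun p hp i a b => ?_⟩
    rw [s.matrixFamily_val hp]
    refine (hM i a b _ (s.toChart.map_source hp)).trans ?_
    refine (Finset.single_le_sum (f := fun b => M i a b) (fun _ _ => Nat.zero_le _)
      (Finset.mem_univ b)).trans ?_
    refine (Finset.single_le_sum (f := fun a => ∑ b, M i a b) (fun _ _ => Nat.zero_le _)
      (Finset.mem_univ a)).trans ?_
    exact Finset.single_le_sum (f := fun i => ∑ a, ∑ b, M i a b) (fun _ _ => Nat.zero_le _)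
      (Finset.mem_univ i)
  · exact (s.mdifferentiableOn_comp ((h i a b).coeff l)).congr
      fun x hx => by rw [s.matrixFamily_val hx]

end

end VortexQuiver
end

noncomputable section

namespace VortexQuiver

/-! ### Holomorphic solutions of linear systems -/

section Solve

variable {E : Type} [NormedAddCommGroup E] [NormedSpace ℂ E] {t₀ : E}
variable {α β κ ρ σ τ : Type}

/-- All entries are holomorphic at `t₀`. -/
def DiffMatAt (t₀ : E) (M : E → Matrix α β ℂ) : Prop :=
  ∀ a b, DifferentiableAt ℂ (fun t => M t a b) t₀

theorem DiffMatAt.congr {M N : E → Matrix α β ℂ} (hM : DiffMatAt t₀ M)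
    (h : ∀ᶠ t in nhds t₀, N t = M t) : DiffMatAt t₀ N := fun a b =>
  (hM a b).congr_of_eventuallyEq (h.mono fun t ht => by simp only [ht])

theorem DiffMatAt.mul [Fintype β] {M : E → Matrix α β ℂ} {N : E → Matrix β τ ℂ} (hM : DiffMatAt t₀ M)
    (hN : DiffMatAt t₀ N) : DiffMatAt t₀ (fun t => M t * N t) := by
  intro a c
  simp only [Matrix.mul_apply]
  exact DifferentiableAt.fun_sum fun b _ => (hM a b).mul (hN b c)

theorem diffMatAt_const (M : Matrix α β ℂ) : DiffMatAt t₀ (fun _ => M) :=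
  fun _ _ => differentiableAt_const _

theorem differentiableAt_prod {ι : Type} (u : Finset ι) {f : ι → E → ℂ}
    (hf : ∀ i, DifferentiableAt ℂ (f i) t₀) : DifferentiableAt ℂ (fun t => ∏ i ∈ u, f i t) t₀ := by
  classical
  induction u using Finset.induction_on with
  | empty => simp
  | insert i u hi ih =>
    simp only [Finset.prod_insert hi]
    exact (hf i).mul ih

theorem DiffMatAt.det [Fintype α] [DecidableEq α] {M : E → Matrix α α ℂ} (hM : DiffMatAt t₀ M) :
    DifferentiableAt ℂ (fun t => (M t).det) t₀ := by
  simp only [Matrix.det_apply']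
  exact DifferentiableAt.fun_sum fun σ _ => (differentiableAt_const _).mul
    (differentiableAt_prod _ fun i => hM _ _)

theorem DiffMatAt.inv [Fintype α] [DecidableEq α] {M : E → Matrix α α ℂ} (hM : DiffMatAt t₀ M) (h : (M t₀).det ≠ 0) :
    DiffMatAt t₀ (fun t => (M t)⁻¹) := by
  intro a b
  simp only [Matrix.inv_def, Ring.inverse_eq_inv', Matrix.smul_apply, smul_eq_mul,
    Matrix.adjugate_apply]
  refine (hM.det.inv h).mul (DiffMatAt.det fun c d => ?_)
  by_cases h : c = b
  · subst h; simp only [Matrix.updateRow_self]; exact differentiableAt_const _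
  · simp only [Matrix.updateRow_ne h]; exact hM c d

theorem exists_mul_eq_one_of_injective [Fintype ρ] [DecidableEq ρ] [Fintype σ] [DecidableEq σ]
    {A : Matrix ρ σ ℂ} (h : ∀ v, A.mulVec v = 0 → v = 0) :
    ∃ G : Matrix σ ρ ℂ, G * A = 1 := by
  obtain ⟨g, hg⟩ := LinearMap.exists_leftInverse_of_injective A.toLin'
    (LinearMap.ker_eq_bot'.2 fun v hv => h v (by simpa using hv))
  refine ⟨LinearMap.toMatrix' g, ?_⟩
  have := congrArg LinearMap.toMatrix' hg
  rwa [LinearMap.toMatrix'_comp, LinearMap.toMatrix'_toLin', LinearMap.toMatrix'_id] at this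

/-- A holomorphic family of matrices that is injective at `t₀` has a holomorphic left inverse. -/
theorem DiffMatAt.exists_left_inverse [Fintype ρ] [DecidableEq ρ] [Fintype σ] [DecidableEq σ]
    {A : E → Matrix ρ σ ℂ} (hA : DiffMatAt t₀ A)
    (h : ∀ v, (A t₀).mulVec v = 0 → v = 0) :
    ∃ G : E → Matrix σ ρ ℂ, DiffMatAt t₀ G ∧ ∀ᶠ t in nhds t₀, G t * A t = 1 := by
  obtain ⟨G, hG⟩ := exists_mul_eq_one_of_injective h
  have h1 : DiffMatAt t₀ (fun t => G * A t) := (diffMatAt_const G).mul hA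
  have h2 : (G * A t₀).det ≠ 0 := by rw [hG, Matrix.det_one]; exact one_ne_zero
  -- A left inverse at `t₀` alone makes `G * A t` invertible nearby.
  refine ⟨fun t => (G * A t)⁻¹ * G, (h1.inv h2).mul (diffMatAt_const G), ?_⟩
  filter_upwards [h1.det.continuousAt.eventually_ne h2] with t ht
  rw [Matrix.mul_assoc, Matrix.nonsing_inv_mul _ (Ne.isUnit ht)]

/-- No regularity of `Y` is presupposed: it is recovered from `A Y` by a holomorphic left inverse.
This makes pointwise choices holomorphic. -/
theorem DiffMatAt.of_mul [Fintype ρ] [DecidableEq ρ] [Fintype σ] [DecidableEq σ]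
    {A : E → Matrix ρ σ ℂ} {Y : E → Matrix σ τ ℂ} (hA : DiffMatAt t₀ A)
    (h : ∀ v, (A t₀).mulVec v = 0 → v = 0) (hY : DiffMatAt t₀ (fun t => A t * Y t)) :
    DiffMatAt t₀ Y := by
  obtain ⟨G, hG, hGA⟩ := hA.exists_left_inverse h
  refine (hG.mul hY).congr (hGA.mono fun t ht => ?_)
  rw [← Matrix.mul_assoc, ht, Matrix.one_mul]

/-- The matrix of the coefficients of degree less than `N`. -/
def coeffMat (N : ℕ) (M : Matrix α κ ℂ[X]) : Matrix (α × Fin N) κ ℂ :=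
  Matrix.of fun r c => (M r.1 c).coeff r.2

theorem coeffMat_mul_C [Fintype κ] (N : ℕ) (M : Matrix α κ ℂ[X]) (A : Matrix κ τ ℂ) :
    coeffMat N (M * A.map C) = coeffMat N M * A := by
  ext r c
  simp [coeffMat, Matrix.mul_apply, finsetSum_coeff]

/-- All coefficients are holomorphic at `t₀`. -/
def DiffPolyMatAt (t₀ : E) (M : E → Matrix α β ℂ[X]) : Prop :=
  ∀ a b l, DifferentiableAt ℂ (fun t => (M t a b).coeff l) t₀

theorem DiffPolyMatAt.mul [Fintype β] {M : E → Matrix α β ℂ[X]} {N : E → Matrix β τ ℂ[X]}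
    (hM : DiffPolyMatAt t₀ M) (hN : DiffPolyMatAt t₀ N) :
    DiffPolyMatAt t₀ (fun t => M t * N t) := by
  intro a c l
  simp only [Matrix.mul_apply, finsetSum_coeff, coeff_mul]
  exact DifferentiableAt.fun_sum fun b _ => DifferentiableAt.fun_sum fun x _ =>
    (hM a b _).mul (hN b c _)

theorem HolPolyMat.diffPolyMatAt {T : Set E} {M : E → Matrix α β ℂ[X]} (hM : HolPolyMat T M)
    (hT : T ∈ nhds t₀) : DiffPolyMatAt t₀ M :=
  fun a b l => ((hM a b).coeff l).differentiableAt hT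

/-- Constant solutions of polynomial linear systems depend holomorphically on the system. -/
theorem DiffPolyMatAt.of_mul [Fintype α] [DecidableEq α] [Fintype κ] [DecidableEq κ]
    {P : E → Matrix α κ ℂ[X]} {Y : E → Matrix κ β ℂ}
    (hP : DiffPolyMatAt t₀ P) (h : ∀ B : Matrix κ Unit ℂ, P t₀ * B.map C = 0 → B = 0)
    (hY : DiffPolyMatAt t₀ (fun t => P t * (Y t).map C)) : DiffMatAt t₀ Y := by
  -- Degrees need to be bounded at `t₀` only: truncation commutes with constant right factors for
  -- every `t`, and injectivity is required at `t₀` alone.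
  let N := (∑ a, ∑ c, (P t₀ a c).natDegree) + 1
  have hN : ∀ a c, (P t₀ a c).natDegree < N := fun a c => Nat.lt_succ_of_le
    ((Finset.single_le_sum (f := fun c => (P t₀ a c).natDegree) (fun _ _ => Nat.zero_le _)
      (Finset.mem_univ c)).trans
    (Finset.single_le_sum (f := fun a => ∑ c, (P t₀ a c).natDegree) (fun _ _ => Nat.zero_le _)
      (Finset.mem_univ a)))
  refine DiffMatAt.of_mul (A := fun t => coeffMat N (P t)) (fun r c => hP r.1 c r.2)
    (fun v hv => ?_) ?_
  · have h1 := h (Matrix.of fun c _ => v c) (by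
      ext a u l
      rw [Matrix.zero_apply, coeff_zero]
      by_cases hl : l < N
      · have h2 := congrFun hv (a, ⟨l, hl⟩)
        have h3 := congrFun (congrFun (coeffMat_mul_C N (P t₀) (Matrix.of fun c (_ : Unit) => v c))
          (a, ⟨l, hl⟩)) u
        exact h3.trans h2
      · rw [Matrix.mul_apply, finsetSum_coeff]
        refine Finset.sum_eq_zero fun c _ => ?_
        rw [Matrix.map_apply, coeff_mul_C, coeff_eq_zero_of_natDegree_lt, zero_mul]
        exact (hN a c).trans_le (not_lt.1 hl))
    funext c
    exact congrFun (congrFun h1 c) ()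
  · simp only [← coeffMat_mul_C]
    exact fun r c => hY r.1 c r.2

end Solve

/-! ### Holomorphic families of solutions -/

section Solutions

variable {α β κ : Type} [Fintype α] [DecidableEq α]

/-- `J = D (D⁻¹ J)` with a decaying second factor. The bound depends only on the degrees of `D`, so
it is uniform in families. -/
theorem StrictlyProper.natDegree_lt {D : Matrix α α ℂ[X]} {J : Matrix α β ℂ[X]}
    (hD : D.det ≠ 0) (h : StrictlyProper D J) {M : ℕ} (hM : ∀ a b, (D a b).natDegree ≤ M) (a : α)
    (b : β) (l : ℕ) (hl : M ≤ l) : (J a b).coeff l = 0 := by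
  have h1 : D.det * J a b = ∑ c, D a c * (D.adjugate * J) c b := by
    have : D * (D.adjugate * J) = D.det • J := by
      rw [← Matrix.mul_assoc, Matrix.mul_adjugate, Matrix.smul_mul, Matrix.one_mul]
    have := congrFun (congrFun this a) b
    rw [Matrix.mul_apply, Matrix.smul_apply, smul_eq_mul] at this
    exact this.symm
  have h2 : (D.det * J a b).degree < ((M + D.det.natDegree : ℕ) : WithBot ℕ) := by
    rw [degree_lt_iff_coeff_zero]
    intro m hm
    rw [h1, finsetSum_coeff]
    refine Finset.sum_eq_zero fun c _ => ?_
    rw [coeff_mul]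
    refine Finset.sum_eq_zero fun x hx => ?_
    have hx' := Finset.HasAntidiagonal.mem_antidiagonal.1 hx
    rcases lt_or_ge M x.1 with hlt | hge
    · rw [coeff_eq_zero_of_natDegree_lt ((hM a c).trans_lt hlt), zero_mul]
    · rw [(strictlyProper_iff_coeff hD).1 h c b x.2 (by omega), mul_zero]
  by_cases h0 : J a b = 0
  · rw [h0, coeff_zero]
  refine coeff_eq_zero_of_degree_lt ?_
  rw [degree_mul, degree_eq_natDegree hD, degree_eq_natDegree h0] at h2
  rw [degree_eq_natDegree h0]
  have h3 : D.det.natDegree + (J a b).natDegree < M + D.det.natDegree := by exact_mod_cast h2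
  exact_mod_cast (by omega : (J a b).natDegree < l)

/-- The matrix of the linear map that takes the coefficients of a vector `f` to the coefficients of
`A f` in the degrees from `m` on. -/
def shiftMat (A : Matrix α α ℂ[X]) (m B N : ℕ) : Matrix (α × Fin B) (α × Fin N) ℂ :=
  Matrix.of fun r c => (A r.1 c.1 * X ^ (c.2 : ℕ)).coeff (m + r.2)

theorem shiftMat_mul_coeffMat (A : Matrix α α ℂ[X]) (m B : ℕ) {N : ℕ} {J : Matrix α β ℂ[X]}
    (hJ : ∀ a b l, N ≤ l → (J a b).coeff l = 0) :
    shiftMat A m B N * coeffMat N J = Matrix.of fun r c => ((A * J) r.1 c).coeff (m + r.2) := by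
  ext r c
  have h : ∀ a, J a c = ∑ j : Fin N, C ((J a c).coeff j) * X ^ (j : ℕ) := by
    intro a
    rw [Fin.sum_univ_eq_sum_range (fun j => C ((J a c).coeff j) * X ^ j)]
    ext l
    simp only [finsetSum_coeff, coeff_C_mul_X_pow]
    rw [Finset.sum_ite_eq (Finset.range N) l]
    split_ifs with hl
    · rfl
    · exact hJ a c l (by simpa using hl)
  rw [Matrix.of_apply, Matrix.mul_apply, Matrix.mul_apply, Fintype.sum_prod_type, finsetSum_coeff]
  refine Finset.sum_congr rfl fun a _ => ?_
  conv_rhs => rw [h a, Finset.mul_sum, finsetSum_coeff]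
  refine Finset.sum_congr rfl fun j _ => ?_
  rw [mul_left_comm, coeff_C_mul, mul_comm]
  rfl

theorem HolPolyMat.exists_bound {E : Type} [NormedAddCommGroup E] [NormedSpace ℂ E] {T : Set E}
    [Fintype β] {M : E → Matrix α β ℂ[X]} (hM : HolPolyMat T M) :
    ∃ N : ℕ, ∀ t ∈ T, ∀ a b, (M t a b).natDegree ≤ N := by
  choose N hN using fun a b => (hM a b).bounded
  refine ⟨∑ a, ∑ b, N a b, fun t ht a b => (hN a b t ht).trans ?_⟩
  exact (Finset.single_le_sum (f := fun b => N a b) (fun _ _ => Nat.zero_le _)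
      (Finset.mem_univ b)).trans (Finset.single_le_sum (f := fun a => ∑ b, N a b)
        (fun _ _ => Nat.zero_le _) (Finset.mem_univ a))

theorem coeffMat_injective {N : ℕ} {M M' : Matrix α β ℂ[X]}
    (hM : ∀ a b l, N ≤ l → (M a b).coeff l = 0) (hM' : ∀ a b l, N ≤ l → (M' a b).coeff l = 0)
    (h : coeffMat N M = coeffMat N M') : M = M' := by
  ext a b l
  by_cases hl : l < N
  · exact congrFun (congrFun h (a, ⟨l, hl⟩)) b
  · rw [hM a b l (not_lt.1 hl), hM' a b l (not_lt.1 hl)]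

/-- The solution spaces of a holomorphic family of constant determinantal degree have holomorphic
bases. -/
theorem exists_gauge_diffPolyMatAt [Fintype κ] [DecidableEq κ] {E : Type} [NormedAddCommGroup E] [NormedSpace ℂ E] {T : Set E}
    {t₀ : E} (hT : T ∈ nhds t₀) {D : E → Matrix α α ℂ[X]} {J : E → Matrix α κ ℂ[X]} {K : ℕ}
    (hD : HolPolyMat T D) (hdet : ∀ t ∈ T, (D t).det ≠ 0) (hK : ∀ t ∈ T, (D t).det.natDegree = K)
    (hJ : ∀ t ∈ T, IsSolutionBasis (D t) (J t)) :
    ∃ g : E → Matrix.GeneralLinearGroup κ ℂ,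
      DiffPolyMatAt t₀ (fun t => J t * (g t).val.map C) := by
  have ht₀ := mem_of_mem_nhds hT
  obtain ⟨N, hN⟩ := hD.exists_bound
  obtain ⟨N', hN'⟩ := hD.adjugate.exists_bound
  have hJN : ∀ t ∈ T, ∀ a b l, N ≤ l → (J t a b).coeff l = 0 := fun t ht =>
    ((hJ t ht).strictlyProper (hdet t ht)).natDegree_lt (hdet t ht) (hN t ht)
  have hJC : ∀ t ∈ T, ∀ {ι : Type} (A : Matrix κ ι ℂ) a b l, N ≤ l →
      ((J t * A.map C) a b).coeff l = 0 := fun t ht _ A a b l hl => by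
    rw [Matrix.mul_apply, finsetSum_coeff]
    exact Finset.sum_eq_zero fun c _ => by
      rw [Matrix.map_apply, coeff_mul_C, hJN t ht a c l hl, zero_mul]
  have hinj : ∀ t ∈ T, ∀ v, (coeffMat N (J t)).mulVec v = 0 → v = 0 := by
    intro t ht v hv
    have h1 : (Matrix.of fun c (_ : Unit) => v c) = 0 := (hJ t ht).eq_zero (by
      refine coeffMat_injective (N := N) (hJC t ht _) (fun _ _ _ _ => by simp) ?_
      rw [coeffMat_mul_C]
      ext r u
      exact (congrFun hv r).trans (by simp [coeffMat]))
    exact funext fun c => congrFun (congrFun h1 c) ()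
  -- `Λ` gives linear coordinates on the solution space at `t₀`. The required basis is the one with
  -- `Λ`-coordinates `1`.
  obtain ⟨Λ, hΛ⟩ := exists_mul_eq_one_of_injective (hinj t₀ ht₀)
  -- Large enough to record every coefficient of `adj D * f` of degree at least `K`, as all degrees
  -- are at most `N + N'`.
  let B := N + N' + 1
  -- The equations of strict properness stacked on the normalization `Λ`; a solution at `t₀` with
  -- zero coordinates vanishes, so this system is injective there.
  let A : E → Matrix (α × Fin B ⊕ κ) (α × Fin N) ℂ := fun t =>
    Matrix.fromRows (shiftMat (D t).adjugate K B N) Λ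
  have hA : DiffMatAt t₀ A := by
    rintro (r | r) c
    · exact (((hD.adjugate r.1 c.1).mul (HolPoly.const _)).coeff _).differentiableAt hT
    · exact differentiableAt_const _
  have hzero : ∀ t ∈ T, shiftMat (D t).adjugate K B N * coeffMat N (J t) = 0 := by
    intro t ht
    rw [shiftMat_mul_coeffMat _ _ _ (hJN t ht)]
    ext r c
    exact (strictlyProper_iff_coeff (hdet t ht)).1 ((hJ t ht).strictlyProper (hdet t ht)) r.1 c _
      (by rw [hK t ht]; exact Nat.le_add_right _ _)
  have hAinj : ∀ v, (A t₀).mulVec v = 0 → v = 0 := by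
    intro v hv
    rw [Matrix.fromRows_mulVec] at hv
    let f : Matrix α Unit ℂ[X] := Matrix.of fun a _ => ∑ j : Fin N, C (v (a, j)) * X ^ (j : ℕ)
    have hf : ∀ a u l, (f a u).coeff l = if h : l < N then v (a, ⟨l, h⟩) else 0 := by
      intro a u l
      simp only [f, Matrix.of_apply, finsetSum_coeff, coeff_C_mul_X_pow]
      split_ifs with h
      · rw [Finset.sum_eq_single ⟨l, h⟩]
        · rw [if_pos rfl]
        · intro j _ hj
          exact if_neg fun h => hj (Fin.ext h.symm)
        · exact fun h => absurd (Finset.mem_univ _) h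
      · exact Finset.sum_eq_zero fun j _ => if_neg fun h' => h (by rw [h']; exact j.2)
    have hfN : ∀ a u l, N ≤ l → (f a u).coeff l = 0 := fun a u l hl => by
      rw [hf, dif_neg (not_lt.2 hl)]
    have hfv : coeffMat N f = Matrix.of fun r _ => v r := by
      ext r u
      rw [coeffMat, Matrix.of_apply, hf, dif_pos r.2.2]
      rfl
    have hfp : StrictlyProper (D t₀) f := by
      rw [strictlyProper_iff_coeff (hdet t₀ ht₀), hK t₀ ht₀]
      intro a u m hm
      by_cases hmB : m - K < B
      · have h1 := congrFun (congrFun (shiftMat_mul_coeffMat (D t₀).adjugate K B hfN)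
          (a, ⟨m - K, hmB⟩)) u
        rw [Matrix.of_apply, hfv] at h1
        have h2 : (shiftMat (D t₀).adjugate K B N).mulVec v (a, ⟨m - K, hmB⟩) = 0 :=
          congrFun hv (Sum.inl (a, ⟨m - K, hmB⟩))
        have h3 : K + (m - K) = m := by omega
        dsimp only at h1
        rw [h3] at h1
        exact h1.symm.trans h2
      · rw [Matrix.mul_apply, finsetSum_coeff]
        refine Finset.sum_eq_zero fun c _ => coeff_eq_zero_of_natDegree_lt ?_
        have h1 : (f c u).natDegree ≤ N := natDegree_le_iff_coeff_eq_zero.2 fun l hl =>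
          hfN c u l hl.le
        have h2 := hN' t₀ ht₀ a c
        have h3 := natDegree_mul_le (p := (D t₀).adjugate a c) (q := f c u)
        omega
    obtain ⟨R, hR⟩ := (hJ t₀ ht₀).exists_eq (hdet t₀ ht₀) hfp
    have hR0 : R = 0 := by
      have h1 : Λ * coeffMat N f = R := by
        rw [hR, coeffMat_mul_C, ← Matrix.mul_assoc, hΛ, Matrix.one_mul]
      rw [← h1, hfv]
      ext c u
      exact congrFun hv (Sum.inr c)
    funext r
    have h1 := congrFun (congrFun hfv r) ()
    rw [hR, hR0] at h1
    rw [Matrix.of_apply] at h1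
    rw [← h1]
    simp [coeffMat]
  obtain ⟨G, hG, hGA⟩ := hA.exists_left_inverse hAinj
  have hmul : ∀ t ∈ T, A t * coeffMat N (J t) = Matrix.fromRows 0 (Λ * coeffMat N (J t)) := by
    intro t ht
    rw [Matrix.fromRows_mul, hzero t ht]
  have hunit : ∀ t ∈ T, G t * A t = 1 → IsUnit (Λ * coeffMat N (J t)) := by
    intro t ht hGt
    rw [← Matrix.mulVec_injective_iff_isUnit, ← Matrix.coe_mulVecLin, injective_iff_map_eq_zero]
    intro v hv
    refine hinj t ht v ?_
    have h1 : (A t).mulVec ((coeffMat N (J t)).mulVec v) = 0 := by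
      rw [Matrix.mulVec_mulVec, hmul t ht, Matrix.fromRows_mulVec, Matrix.zero_mulVec]
      funext r
      rcases r with r | r
      · rfl
      · exact congrFun hv r
    have h2 := congrArg (G t).mulVec h1
    rwa [Matrix.mulVec_mulVec, hGt, Matrix.one_mulVec, Matrix.mulVec_zero] at h2
  classical
  let g : E → Matrix.GeneralLinearGroup κ ℂ := fun t =>
    if h : IsUnit (Λ * coeffMat N (J t)) then h.unit⁻¹ else 1
  refine ⟨g, ?_⟩
  have hev : ∀ᶠ t in nhds t₀, t ∈ T ∧ G t * A t = 1 := Filter.Eventually.and hT hGA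
  have hJg : DiffMatAt t₀ (fun t => coeffMat N (J t * (g t).val.map C)) := by
    -- The normalized basis solves `A t * Y = (0, 1)`, so it equals `G t` applied to a constant
    -- matrix.
    refine (hG.mul (diffMatAt_const (Matrix.fromRows 0 1))).congr (hev.mono fun t ht => ?_)
    have hu := hunit t ht.1 ht.2
    have hg : Λ * coeffMat N (J t) * (g t).val = 1 := by
      have : g t = hu.unit⁻¹ := dif_pos hu
      rw [this]
      exact hu.mul_val_inv
    rw [coeffMat_mul_C, ← hg]
    calc coeffMat N (J t) * (g t).val
        = G t * (A t * coeffMat N (J t)) * (g t).val := by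
          rw [← Matrix.mul_assoc, ht.2, Matrix.one_mul]
      _ = _ := by
          rw [hmul t ht.1, Matrix.mul_assoc, Matrix.fromRows_mul, Matrix.zero_mul]
  intro a b l
  by_cases hl : l < N
  · exact hJg (a, ⟨l, hl⟩) b
  · refine (differentiableAt_const 0).congr_of_eventuallyEq (hev.mono fun t ht => ?_)
    exact hJC t ht.1 _ a b l (not_lt.1 hl)

end Solutions

variable {n k : ℕ → ℕ} {L : ℕ}

/-! ### Half-ADHM data of a holomorphic family of moduli matrices -/

section Family

variable {E : Type} [NormedAddCommGroup E] [NormedSpace ℂ E] {T : Set E} {t₀ : E}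

theorem HolPolyMat.xi {q : E → QTuple n L} (hq : ∀ i, HolPolyMat T (fun t => q t i)) :
    ∀ (j m : ℕ) (hm : m ≤ L), m + j = L → HolPolyMat T (fun t => xi (q t) m hm) := by
  intro j
  induction j with
  | zero =>
    intro m hm hj
    obtain rfl : m = L := by omega
    simp only [xi_self]
    exact HolPolyMat.const _
  | succ j ih =>
    intro m hm hj
    have h : m < L := by omega
    simp only [xi_eq_mul _ h]
    exact (hq _).mul (ih (m + 1) h (by omega))

/-- Data are chosen pointwise, without regularity, and then gauged so that the `J_i` become
holomorphic at `t₀`. Then `𝔇 Ψ + J Z = X J`, `J Ψ̃ = 𝔇̃` and `J_i W_i = q_i J_{i+1}` are injective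
linear systems with holomorphic coefficients, so `DiffPolyMatAt.of_mul` applies to their solutions.
-/
theorem exists_differentiableAt_data {q : E → ModuliMatrix n k L} (hT : T ∈ nhds t₀)
    (hq : ∀ i, HolPolyMat T (fun t => (q t).1 i)) :
    ∃ d : E → HalfADHM n k L, (∀ t, ∃ J, MappingRelation (q t).1 (d t).1 J) ∧
      DifferentiableAt ℂ (fun t => (d t).1.toSpace) t₀ := by
  have hxi := fun i : Fin L => HolPolyMat.xi hq (L - i) i i.2.le (by omega)
  have hD : ∀ i, HolPolyMat T (fun t => frakD (q t).1 i) := fun i a b => hxi i _ _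
  have hDt : ∀ i, HolPolyMat T (fun t => frakDt (q t).1 i) := fun i a b => hxi i _ _
  have hdet := fun t => (q t).2.det_ne_zero
  choose d' J' h' using fun t => (q t).2.exists_data
  have hg := fun i : Fin L => exists_gauge_diffPolyMatAt (K := k i) hT (hD i) (fun t _ => hdet t i)
    (fun t _ => natDegree_eq_of_degree_eq_some ((q t).2.degree_det i)) (fun t _ => (h' t).basis i)
  choose g hg using hg
  have h := fun t => (h' t).act (hdet t) (fun i => g i t)
  let d : E → HalfADHM n k L := fun t => (d' t).act (fun i => g i t)
  let J : (t : E) → (i : Fin L) → Matrix (Col n (i + 1)) (Fin (k i)) ℂ[X] :=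
    fun t i => J' t i * (g i t).val.map C
  have hJ : ∀ i, DiffPolyMatAt t₀ (fun t => J t i) := hg
  have hm : ∀ t, MappingRelation (q t).1 (d t).1 (J t) := h
  clear_value d J
  have hJinj : ∀ i : Fin L, ∀ B : Matrix (Fin (k i)) Unit ℂ, J t₀ i * B.map C = 0 → B = 0 := fun i B hB =>
    ((hm t₀).basis i).eq_zero hB
  have hΨZ : ∀ i, DiffMatAt t₀ (fun t => Matrix.fromRows ((d t).1.Psi i) ((d t).1.Z i)) := by
    intro i
    refine DiffPolyMatAt.of_mul (P := fun t => Matrix.fromCols (frakD (q t).1 i) (J t i)) ?_ ?_ ?_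
    · rintro a (b | b) l
      · exact (hD i).diffPolyMatAt hT a b l
      · exact hJ i a b l
    · intro B hB
      rw [← Matrix.fromRows_toRows B, Matrix.fromRows_map, Matrix.fromCols_mul_fromRows] at hB
      have h1 : J t₀ i * B.toRows₂.map C = frakD (q t₀).1 i * -(B.toRows₁.map C) := by
        rw [Matrix.mul_neg]
        exact eq_neg_of_add_eq_zero_right hB
      obtain ⟨h2, h3⟩ := ((hm t₀).basis i).eq_zero_of_eq (hdet t₀ i) h1
      have h4 : B.toRows₁ = 0 := by
        ext a u
        have := congrFun (congrFun (neg_eq_zero.1 h3) a) u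
        exact C_eq_zero.1 this
      rw [← Matrix.fromRows_toRows B, h2, h4, Matrix.fromRows_zero]
    · have h1 : ∀ t, Matrix.fromCols (frakD (q t).1 i) (J t i) *
          (Matrix.fromRows ((d t).1.Psi i) ((d t).1.Z i)).map C = (X : ℂ[X]) • J t i := by
        intro t
        rw [Matrix.fromRows_map, Matrix.fromCols_mul_fromRows, (hm t).mul_eq, mul_charmatrix]
        abel
      simp only [h1]
      intro a b l
      simp only [Matrix.smul_apply, smul_eq_mul]
      rcases l with _ | l
      · simp only [coeff_X_mul_zero]; exact differentiableAt_const _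
      · simp only [coeff_X_mul]; exact hJ i a b l
  have hΨt : ∀ i, DiffMatAt t₀ (fun t => (d t).1.Psit i) := by
    intro i
    refine DiffPolyMatAt.of_mul (hJ i) (hJinj i) ?_
    simp only [← (hm _).rest]
    exact (hDt i).diffPolyMatAt hT
  refine ⟨d, fun t => ⟨_, hm t⟩, Data.differentiableAt_toSpace (fun i a b => ?_) (fun i a b => ?_)
    (fun i a b => ?_) (fun i a b => ?_)⟩
  · exact hΨZ i (Sum.inr a) b
  · have := hΨZ i (Sum.inl (Col.last a)) b
    refine this.congr_of_eventuallyEq (Filter.Eventually.of_forall fun t => ?_)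
    change _ = ((d t).1.Psi ⟨i, i.2⟩).submatrix Col.last id a b
    rw [Data.Psi_last]
  · have := hΨt i a (CoCol.first i.2 b)
    refine this.congr_of_eventuallyEq (Filter.Eventually.of_forall fun t => ?_)
    change _ = ((d t).1.chain le_rfl i.2 * (d t).1.Ut i) a b
    rw [Data.chain_self, Matrix.one_mul]
  · have hi : (i : ℕ) < L := by omega
    have hi' : (i : ℕ) + 1 < L := by omega
    refine DiffPolyMatAt.of_mul (hJ ⟨i, hi⟩) (hJinj ⟨i, hi⟩) (Y := fun t => (d t).1.W i) ?_ a b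
    have h1 : ∀ t, J t ⟨i, hi⟩ * ((d t).1.W i).map C = (q t).1 ⟨i, hi⟩ * J t ⟨i + 1, hi'⟩ :=
      fun t => ((hm t).mul_solutions (d t).2.1 hi').symm
    simp only [h1]
    exact ((hq ⟨i, hi⟩).diffPolyMatAt hT).mul (hJ ⟨i + 1, hi'⟩)

end Family

end VortexQuiver
end

/-! ### The main theorem. -/

theorem mainTheorem1 (L : ℕ) (n k : ℕ → ℕ) (hn : ∀ j, j ≤ L → 0 < n j) :
    -- the bijection given by the half-ADHM mapping relations
    ∃ Φ : VortexModuli n k L ≃ HalfADHMQuotient n k L,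
      (∀ (q : ModuliMatrix n k L) (d : HalfADHM n k L),
        Φ (Quotient.mk _ q) = Quotient.mk _ d ↔ ∃ J, MappingRelation q.1 d.1 J) ∧
      (∀ (q : ModuliMatrix n k L) (d : HalfADHM n k L) (J), MappingRelation q.1 d.1 J →
        ∀ i : Fin (L - 1),
          q.1 ⟨i, by omega⟩ * J ⟨i + 1, by omega⟩ = J ⟨i, by omega⟩ * (d.1.W i).map Polynomial.C) ∧
      -- the quotient is a complex manifold of dimension `∑ k_i (n_i + n_{i+1})`
      Nonempty (HalfADHMQuotient n k L) ∧
      T2Space (HalfADHMQuotient n k L) ∧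
      SecondCountableTopology (HalfADHMQuotient n k L) ∧
      ∃ _ : ChartedSpace (Fin (∑ i : Fin L, k i * (n i + n (i + 1))) → ℂ) (HalfADHMQuotient n k L),
        IsManifold 𝓘(ℂ, Fin (∑ i : Fin L, k i * (n i + n (i + 1))) → ℂ) ω
          (HalfADHMQuotient n k L) ∧
        -- its complex structure is the quotient structure of the half-ADHM data
        (∀ (m : ℕ) (T : Set (Fin m → ℂ)) (d : (Fin m → ℂ) → HalfADHM n k L), IsOpen T →
          HolomorphicData (Fin m → ℂ) T (fun t => (d t).1) →
          MDifferentiableOn 𝓘(ℂ, Fin m → ℂ)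
            𝓘(ℂ, Fin (∑ i : Fin L, k i * (n i + n (i + 1))) → ℂ)
            (fun t => (Quotient.mk _ (d t) : HalfADHMQuotient n k L)) T) ∧
        (∀ p : HalfADHMQuotient n k L, ∃ (T : Set (HalfADHMQuotient n k L))
          (d : HalfADHMQuotient n k L → HalfADHM n k L), IsOpen T ∧ p ∈ T ∧
          HolomorphicData (Fin (∑ i : Fin L, k i * (n i + n (i + 1))) → ℂ) T (fun x => (d x).1) ∧
          ∀ x ∈ T, Quotient.mk _ (d x) = x) ∧
        -- and it is, through `Φ`, the structure given by holomorphic families of moduli matrices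
        (∀ (m : ℕ) (T : Set (Fin m → ℂ)) (q : (Fin m → ℂ) → ModuliMatrix n k L), IsOpen T →
          HolomorphicQ (Fin m → ℂ) T (fun t => (q t).1) →
          MDifferentiableOn 𝓘(ℂ, Fin m → ℂ)
            𝓘(ℂ, Fin (∑ i : Fin L, k i * (n i + n (i + 1))) → ℂ)
            (fun t => Φ (Quotient.mk _ (q t))) T) ∧
        (∀ p : HalfADHMQuotient n k L, ∃ (T : Set (HalfADHMQuotient n k L))
          (q : HalfADHMQuotient n k L → ModuliMatrix n k L), IsOpen T ∧ p ∈ T ∧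
          HolomorphicQ (Fin (∑ i : Fin L, k i * (n i + n (i + 1))) → ℂ) T (fun x => (q x).1) ∧
          ∀ x ∈ T, Φ (Quotient.mk _ (q x)) = x) := by
  obtain ⟨Φ, hΦ⟩ := exists_mapping_equiv n k L
  refine ⟨Φ, hΦ, fun q d J h i => h.mul_solutions d.2.1 (by omega), ?_, t2Space_quotient,
    secondCountableTopology_quotient, sliceChartedSpace n k L, isManifold_quotient,
    fun m T d hT hd => mdifferentiableOn_mk hT hd, fun p => ?_, fun m T q hT hq t ht => ?_,
    fun p => ?_⟩
  · obtain ⟨d⟩ := nonempty_halfADHM (n := n) (k := k) hn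
    exact ⟨Quotient.mk _ d⟩
  · obtain ⟨s, hs⟩ := exists_slice_mem_domain p
    exact ⟨s.domain, s.family, s.isOpen_domain, hs, s.holomorphicData_family,
      fun x hx => s.mk_family hx⟩
  · have hq' : ∀ i, HolPolyMat T (fun t => (q t).1 i) := fun i a b =>
      ⟨hq.bounded.imp fun M hM v hv => hM v hv i a b,
        fun l => mdifferentiableOn_iff_differentiableOn.1 (hq.coeff i a b l)⟩
    -- The family `d` is chosen anew for each point `t` and is only known to be differentiable
    -- there; this suffices, since its class does not depend on the choice.
    obtain ⟨d, hd, hdt⟩ := exists_differentiableAt_data (hT.mem_nhds ht) hq'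
    have h : (fun t => Φ (Quotient.mk _ (q t))) = fun t => Quotient.mk _ (d t) :=
      funext fun t => (hΦ _ _).2 (hd t)
    rw [h]
    let := sliceChartedSpace n k L
    exact (mdifferentiableAt_mk hdt).mdifferentiableWithinAt
  · obtain ⟨s, hs⟩ := exists_slice_mem_domain p
    exact ⟨s.domain, s.matrixFamily, s.isOpen_domain, hs, s.holomorphicQ_matrixFamily,
      fun x hx => ((hΦ _ _).2 (s.mappingRelation_family hx)).trans (s.mk_family hx)⟩
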